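/- **The game.** Agents $i\in\mathcal I=\{1,\dots,N\}$ choose $x_i\in\Omega_i\subseteq\mathbb R^{n_i}$; write $\boldsymbol x=\mathrm{col}(x_1,\dots,x_N)\in\mathbb R^n$ and $\boldsymbol\Omega=\prod_i\Omega_i$. Agent $i$ has the cost $\mathbb J_i(\boldsymbol x)=\mathbb E[f_i(\boldsymbol x,\xi_i)]+g_i(x_i)$ and the agents share the constraint $\sum_iA_ix_i\le b:=\sum_ib_i\in\mathbb R^m$; let $\boldsymbol{\mathcal X}=\{\boldsymbol x\in\boldsymbol\Omega:\sum_iA_ix_i\le b\}$. A point $\boldsymbol x^*\in\boldsymbol{\mathcal X}$ is a stochastic generalized Nash equilibrium (SGNE) if each $x_i^*$ minimizes $\mathbb J_i(\cdot,\boldsymbol x_{-i}^*)$ over $\{y\in\Omega_i:A_iy\le b-\sum_{j\ne i}A_jx_j^*\}$. It is a variational one (v-SGNE) if moreover $\langle\mathbb F(\boldsymbol x^*),\boldsymbol y-\boldsymbol x^*\rangle+\sum_i(g_i(y_i)-g_i(x_i^*))\ge0$ for all $\boldsymbol y\in\boldsymbol{\mathcal X}$, where $\mathbb F(\boldsymbol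 x)=\mathrm{col}(\mathbb E[\nabla_{x_i}f_i(\boldsymbol x,\xi_i)])_i$ is the pseudogradient. Let $D_i\supseteq\Omega_i$ be convex sets in which estimates of $x_i$ are kept (e.g. $D_i=\Omega_i$ or $D_i=\mathbb R^{n_i}$), and $\boldsymbol D=\prod_iD_i$. **Assumptions.** (1) $\Omega_i$ is nonempty, compact and convex; $g_i$ is convex and lower semicontinuous with domain $\Omega_i$. (2) Slater: some $\boldsymbol x\in\boldsymbol\Omega$ satisfies $\sum_iA_ix_i<b$. (3) $f_i$ is measurable, and $\mathbb E[f_i(\boldsymbol x,\xi_i)]$ on $\boldsymbol\Omega$ and $\mathbb F$ on $\boldsymbol D$ are well defined. For every value $s$ of $\xi_i$, $f_i(\cdot,\boldsymbol x_{-i},s)$ is continuously differentiable for each $\boldsymbol x_{-i}\in\prod_{j\neq i}D_j$; and for each $\boldsymbol x_{-i}\in\prod_{j\ne i}\Omega_j$ it is convex on $\Omega_i$ and Lipschitz on $\Omega_i$ with a constant integrable in $\xi_i$. (4) $\mathbb F$ is $\eta$-strongly monotone and $\ell_{\mathbb F}$-Lipschitz on $\boldsymbol D$, with $\eta,\ell_{\mathbb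 F}>0$. (5) The communication graph is undirected and connected, with weights $w_{ij}=w_{ji}>0$ on edges and $w_{ij}=0$ otherwise; $L$ is its weighted Laplacian and $V$ its weighted (oriented) incidence matrix, so $L=V^\top V$. (6) The batch sizes satisfy $M_k\ge C(k+k_0)^{a+1}$ for some $C,k_0,a>0$. (7) At iteration $k$ the agents draw $M_k$ samples of $(\xi_1,\dots,\xi_N)$; all samples are i.i.d. with the law of $(\xi_1,\dots,\xi_N)$ and independent of the (possibly random) initial state. With $F^{\rm SA}_i(\boldsymbol x,\bar\xi_i^k)=\frac1{M_k}\sum_{t=1}^{M_k}\nabla_{x_i}f_i(\boldsymbol x,\xi_i^{(k,t)})$ and $F^{\rm SA}=\mathrm{col}(F^{\rm SA}_i)_i$, there is $\sigma>0$ with $\mathbb E\|F^{\rm SA}(\boldsymbol x,\boldsymbol\xi^k)-\mathbb F(\boldsymbol x)\|^2\le\sigma^2$ for all $k$ and all $\boldsymbol x\in\boldsymbol D$. **The edge-based algorithm.** Agent $i$ keeps $\hat{\boldsymbol x}_i=(\hat x_{i,j})_j$ with $\hat x_{i,i}=x_i$, and $z_i,\lambda_i\in\mathbb R^m$. Initially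 $x_i^0\in\Omega_i$, $\hat x_{i,j}^0\in D_j$, $\lambda_i^0\ge0$ and $\sum_iz_i^0=0$ (that is, $z^0=(V^\top\otimes I_m)v^0$ for some $v^0$; e.g. $z^0=0$). With step sizes $\alpha_i,\nu,\delta_i>0$ and gains $c,\kappa>0$ (e.g. $\kappa=c$ or $\kappa=1$), iteration $k$ reads $$\begin{aligned}x_i^{k+1}&=\mathrm{prox}_{\alpha_ig_i}\Big[x_i^k-\alpha_i\Big(F_i^{\rm SA}(\hat{\boldsymbol x}_i^k,\bar\xi_i^k)+A_i^\top\lambda_i^k+c\sum_jw_{ij}(x_i^k-\hat x_{j,i}^k)\Big)\Big],\\ \hat x_{i,l}^{k+1}&=\hat x_{i,l}^k-\alpha_i\kappa\sum_jw_{ij}(\hat x_{i,l}^k-\hat x_{j,l}^k)\quad(l\ne i),\\ z_i^{k+1}&=z_i^k+\nu\sum_jw_{ij}(\lambda_i^k-\lambda_j^k),\\ \lambda_i^{k+1}&=\mathrm{proj}_{\mathbb R^m_{\ge0}}\big[\lambda_i^k+\delta_i(2A_ix_i^{k+1}-A_ix_i^k-b_i-2z_i^{k+1}+z_i^k)\big].\end{aligned}$$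 **Theorem.** Let these assumptions hold, let $\ell_p>0$ be a Lipschitz constant on $\boldsymbol D^N$ of the extended pseudogradient $\hat{\boldsymbol x}\mapsto\mathrm{col}(\mathbb F_i(\hat{\boldsymbol x}_i))_i$, and let $c>0$ satisfy $c\,\lambda_2(L)>\frac{(\ell_p+\ell_{\mathbb F})^2}{4\eta}+\ell_p$, with $\lambda_2(L)$ the least nonzero eigenvalue of $L$ (no such condition if $N=1$). Then: (a) One communication round per iteration suffices: the new variables of agent $i$ are determined by its own sampled gradient, its own current variables and the current $\hat{\boldsymbol x}_j^k,\lambda_j^k$ of its neighbours $j$. Moreover, the trajectories $(\hat{\boldsymbol x}^k,z^k,\lambda^k)$ of the algorithm with $\sum_iz_i^0=0$ are exactly those obtained by $z^k=(V^\top\otimes I_m)v^k$ from the iteration that imposes dual consensus $(V\otimes I_m)\lambda=0$ by edge variables $v$, namely the same updates of $x_i,\hat{\boldsymbol x}_i$ together with $v^{k+1}=v^k+\nu(V\otimes I_m)\lambda^k$ and $\lambda_i^{k+1}=\mathrm{proj}_{\mathbb R^m_{\ge0}}[\lambda_i^k+\delta_i(2A_ix_i^{k+1}-A_ix_i^k-b_i-((V^\top\otimes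 I_m)(2v^{k+1}-v^k))_i)]$. (b) There is exactly one v-SGNE $\boldsymbol x^*$, and there are $\bar\alpha,\bar\nu,\bar\delta>0$, depending neither on the samples, the batch sizes nor the initial state, such that for all $\alpha_i\in(0,\bar\alpha)$, $\nu\in(0,\bar\nu)$, $\delta_i\in(0,\bar\delta)$ the sequence $(\boldsymbol x^k)_k$ generated by the algorithm converges almost surely to $\boldsymbol x^*$. -/

import Mathlib

open MeasureTheory ProbabilityTheory Filter Topology
open scoped ENNReal NNReal

noncomputable section

namespace SGNE

/-- Euclidean space of dimension `q`. -/
abbrev Vec (q : ℕ) : Type := EuclideanSpace ℝ (Fin q)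

/-- Collective strategies: the vector `x = col(x_1, …, x_N)` with `x_i` of dimension `n i`, with the
Euclidean norm. -/
abbrev Profile {N : ℕ} (n : Fin N → ℕ) : Type := PiLp 2 (fun i => Vec (n i))

/-- Stacked estimates: the `i`-th entry is agent `i`'s estimate of the collective strategy, and
its own `i`-th component is the actual decision of agent `i`. -/
abbrev Estimates {N : ℕ} (n : Fin N → ℕ) : Type := PiLp 2 (fun _ : Fin N => Profile n)

/-- The profile `x` with the decision of agent `i` replaced by `y`. -/
def setAt {N : ℕ} {n : Fin N → ℕ} (x : Profile n) (i : Fin N) (y : Vec (n i)) : Profile n :=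
  WithLp.toLp 2 (Function.update (fun j => x j) i y)

/-! ### The game -/

/-- The data of a stochastic generalized Nash equilibrium problem with `N` agents, `m` affine
coupling constraints and random vectors `ξ_i` of dimension `d`. The extended-valued function
with domain `Ω i` is represented by its real values `g i` on `Ω i`. -/
structure Game (N m d : ℕ) where
  /-- dimensions of the decision variables -/
  n : Fin N → ℕ
  /-- local feasible sets -/
  Ω : ∀ i, Set (Vec (n i))
  /-- smooth parts of the costs, as functions of the collective strategy and of `ξ_i` -/
  f : Fin N → Profile n → Vec d → ℝ
  /-- nonsmooth parts of the costs (only the values on `Ω i` matter) -/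
  g : ∀ i, Vec (n i) → ℝ
  /-- blocks of the coupling constraint matrix -/
  A : ∀ i, Matrix (Fin m) (Fin (n i)) ℝ
  /-- local portions of the right-hand side of the coupling constraint -/
  b : Fin N → Vec m
  /-- possible values of `ξ_i` -/
  Ξ : Fin N → Set (Vec d)
  /-- joint law of `(ξ_1, …, ξ_N)` -/
  P : Measure (Fin N → Vec d)

namespace Game

variable {N m d : ℕ} (Γ : Game N m d)

/-- The collective strategies with `x_i ∈ S_i` for all `i`. -/
def box (S : ∀ i, Set (Vec (Γ.n i))) : Set (Profile Γ.n) := {x | ∀ i, x i ∈ S i}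

/-- The right-hand side `b = ∑ b_i` of the coupling constraint `∑ A_i x_i ≤ b`. -/
def rhs : Vec m := ∑ i, Γ.b i

/-- The collective feasible set. -/
def feasible : Set (Profile Γ.n) :=
  {x | x ∈ Γ.box Γ.Ω ∧ ∀ r, (∑ i, (Γ.A i).toEuclideanLin (x i)) r ≤ Γ.rhs r}

/-- The feasible set of agent `i`, given the decisions of the others. -/
def feasibleAt (i : Fin N) (x : Profile Γ.n) : Set (Vec (Γ.n i)) :=
  {y | y ∈ Γ.Ω i ∧ ∀ r, (Γ.A i).toEuclideanLin y r ≤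
    (Γ.rhs - ∑ j ∈ Finset.univ.erase i, (Γ.A j).toEuclideanLin (x j)) r}

/-- The cost `E[f_i(x, ξ_i)] + g_i(x_i)` of agent `i`. -/
def cost (i : Fin N) (x : Profile Γ.n) : ℝ := (∫ s, Γ.f i x (s i) ∂Γ.P) + Γ.g i (x i)

/-- The partial gradient of `f_i(·, s)` with respect to `x_i`. -/
def partialGrad (i : Fin N) (x : Profile Γ.n) (s : Vec d) : Vec (Γ.n i) :=
  gradient (fun y => Γ.f i (setAt x i y) s) (x i)

/-- The pseudogradient `F(x) = col(E[∇_{x_i} f_i(x, ξ_i)])`. -/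
def pseudograd (x : Profile Γ.n) : Profile Γ.n :=
  WithLp.toLp 2 fun i => ∫ s, Γ.partialGrad i x (s i) ∂Γ.P

/-- The extended pseudogradient: agent `i` evaluates its partial gradient at its own estimate. -/
def extPseudograd (X : Estimates Γ.n) : Profile Γ.n :=
  WithLp.toLp 2 fun i => Γ.pseudograd (X i) i

/-- Stochastic generalized Nash equilibria. -/
def IsSGNE (x : Profile Γ.n) : Prop :=
  x ∈ Γ.feasible ∧ ∀ i, ∀ y ∈ Γ.feasibleAt i x, Γ.cost i x ≤ Γ.cost i (setAt x i y)

/-- Variational equilibria: equilibria that solve the stochastic variational inequality of the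
pseudogradient and of the nonsmooth costs over the collective feasible set. -/
def IsVariational (x : Profile Γ.n) : Prop :=
  Γ.IsSGNE x ∧
    ∀ y ∈ Γ.feasible, 0 ≤ inner ℝ (Γ.pseudograd x) (y - x) + ∑ i, (Γ.g i (y i) - Γ.g i (x i))

/-- The assumptions on the game. Here `D i ⊇ Ω i` is a convex set in which the agents keep their
estimates of the decision of agent `i` (for instance `Ω i` or the whole space). -/
structure Assumptions (D : ∀ i, Set (Vec (Γ.n i))) (η ℓF : ℝ) : Prop where
  Ω_nonempty : ∀ i, (Γ.Ω i).Nonempty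
  Ω_compact : ∀ i, IsCompact (Γ.Ω i)
  Ω_convex : ∀ i, Convex ℝ (Γ.Ω i)
  g_convex : ∀ i, ConvexOn ℝ (Γ.Ω i) (Γ.g i)
  g_lsc : ∀ i, LowerSemicontinuousOn (Γ.g i) (Γ.Ω i)
  /-- Slater's condition -/
  slater : ∃ x ∈ Γ.box Γ.Ω, ∀ r, (∑ i, (Γ.A i).toEuclideanLin (x i)) r < Γ.rhs r
  D_convex : ∀ i, Convex ℝ (D i)
  Ω_subset_D : ∀ i, Γ.Ω i ⊆ D i
  prob : IsProbabilityMeasure Γ.P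
  Ξ_measurable : ∀ i, MeasurableSet (Γ.Ξ i)
  mem_Ξ : ∀ᵐ s ∂Γ.P, ∀ i, s i ∈ Γ.Ξ i
  f_measurable : ∀ i, Measurable (fun q : Profile Γ.n × Vec d => Γ.f i q.1 q.2)
  /-- the expected costs are well defined -/
  f_integrable : ∀ i, ∀ x ∈ Γ.box Γ.Ω, Integrable (fun s => Γ.f i x (s i)) Γ.P
  f_convex : ∀ i, ∀ x ∈ Γ.box Γ.Ω, ∀ s ∈ Γ.Ξ i,
    ConvexOn ℝ (Γ.Ω i) (fun y => Γ.f i (setAt x i y) s)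
  f_contDiff : ∀ i, ∀ x ∈ Γ.box D, ∀ s ∈ Γ.Ξ i, ContDiff ℝ 1 (fun y => Γ.f i (setAt x i y) s)
  /-- Lipschitz in the own decision, with an integrable constant -/
  f_lipschitz : ∀ i, ∀ x ∈ Γ.box Γ.Ω, ∃ ℓ : Vec d → ℝ, Integrable (fun s => ℓ (s i)) Γ.P ∧
    ∀ s ∈ Γ.Ξ i, ∀ y ∈ Γ.Ω i, ∀ y' ∈ Γ.Ω i,
      |Γ.f i (setAt x i y) s - Γ.f i (setAt x i y') s| ≤ ℓ s * ‖y - y'‖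
  /-- the pseudogradient is well defined -/
  grad_integrable : ∀ i, ∀ x ∈ Γ.box D, Integrable (fun s => Γ.partialGrad i x (s i)) Γ.P
  η_pos : 0 < η
  ℓF_pos : 0 < ℓF
  strongly_monotone : ∀ x ∈ Γ.box D, ∀ y ∈ Γ.box D,
    η * ‖x - y‖ ^ 2 ≤ inner ℝ (Γ.pseudograd x - Γ.pseudograd y) (x - y)
  lipschitz : ∀ x ∈ Γ.box D, ∀ y ∈ Γ.box D,
    ‖Γ.pseudograd x - Γ.pseudograd y‖ ≤ ℓF * ‖x - y‖

/-- `ℓp` is a Lipschitz constant of the extended pseudogradient. -/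
def ExtLipschitz (D : ∀ i, Set (Vec (Γ.n i))) (ℓp : ℝ) : Prop :=
  ∀ X Y : Estimates Γ.n, (∀ i, X i ∈ Γ.box D) → (∀ i, Y i ∈ Γ.box D) →
    ‖Γ.extPseudograd X - Γ.extPseudograd Y‖ ≤ ℓp * ‖X - Y‖

end Game

/-! ### The communication network -/

/-- `w` is a weighted adjacency matrix of the undirected graph `G`. -/
structure IsWeighting {N : ℕ} (G : SimpleGraph (Fin N)) (w : Matrix (Fin N) (Fin N) ℝ) :
    Prop where
  symm : w.IsSymm
  pos : ∀ i j, G.Adj i j → 0 < w i j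
  zero : ∀ i j, ¬ G.Adj i j → w i j = 0

/-- The weighted Laplacian. -/
def laplacian {N : ℕ} (w : Matrix (Fin N) (Fin N) ℝ) : Matrix (Fin N) (Fin N) ℝ :=
  Matrix.diagonal (fun i => ∑ j, w i j) - w

/-- `c λ₂(L) > (ℓp + ℓF)² / (4 η) + ℓp`, where `λ₂(L)` is the least nonzero eigenvalue of the
Laplacian `L` (no condition if there is none, that is, for a single agent). -/
def CouplingLarge {N : ℕ} (w : Matrix (Fin N) (Fin N) ℝ) (η ℓF ℓp c : ℝ) : Prop :=
  ∀ μ : ℝ, μ ≠ 0 → Module.End.HasEigenvalue (Matrix.toLin' (laplacian w)) μ →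
    (ℓp + ℓF) ^ 2 / (4 * η) + ℓp < c * μ

/-- The edges of `G`, each one oriented from its smaller to its larger endpoint. -/
abbrev Edge {N : ℕ} (G : SimpleGraph (Fin N)) : Type :=
  {e : Fin N × Fin N // e.1 < e.2 ∧ G.Adj e.1 e.2}

instance {N : ℕ} (G : SimpleGraph (Fin N)) : Fintype (Edge G) := Fintype.ofFinite _

/-- The weighted incidence matrix `V`, for which `L = Vᵀ V`. -/
def incidence {N : ℕ} (G : SimpleGraph (Fin N)) (w : Matrix (Fin N) (Fin N) ℝ) :
    Matrix (Edge G) (Fin N) ℝ :=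
  Matrix.of fun e i =>
    if i = e.1.1 then √(w e.1.1 e.1.2) else if i = e.1.2 then -√(w e.1.1 e.1.2) else 0

/-- `V ⊗ I_m` applied to a stacked dual variable. -/
def incidenceMul {N m : ℕ} (G : SimpleGraph (Fin N)) (w : Matrix (Fin N) (Fin N) ℝ)
    (lam : Fin N → Vec m) : Edge G → Vec m :=
  fun e => ∑ i, incidence G w e i • lam i

/-- `Vᵀ ⊗ I_m` applied to a stacked edge variable. -/
def incidenceTransposeMul {N m : ℕ} (G : SimpleGraph (Fin N)) (w : Matrix (Fin N) (Fin N) ℝ)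
    (v : Edge G → Vec m) : Fin N → Vec m :=
  fun i => ∑ e, incidence G w e i • v e

/-! ### The algorithm -/

/-- `u` minimizes `α g(u) + ‖u - y‖² / 2` over `Ω`. -/
def IsProx {q : ℕ} (Ω : Set (Vec q)) (g : Vec q → ℝ) (α : ℝ) (y u : Vec q) : Prop :=
  u ∈ Ω ∧ ∀ v ∈ Ω, α * g u + ‖u - y‖ ^ 2 / 2 ≤ α * g v + ‖v - y‖ ^ 2 / 2

/-- The proximal operator of `α g`, where `g` has domain `Ω`. -/
def prox {q : ℕ} (Ω : Set (Vec q)) (g : Vec q → ℝ) (α : ℝ) (y : Vec q) : Vec q :=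
  Classical.epsilon (IsProx Ω g α y)

/-- The projection onto the nonnegative orthant. -/
def projNonneg {q : ℕ} (y : Vec q) : Vec q := WithLp.toLp 2 fun r => max (y r) 0

/-- The parameters of the algorithm: step sizes `α_i`, `ν`, `δ_i`, the weight `c` of the
disagreement term in the decision update, and the gain `κ` of the estimate update. -/
structure Params (N : ℕ) where
  α : Fin N → ℝ
  ν : ℝ
  δ : Fin N → ℝ
  c : ℝ
  κ : ℝ

/-- The state `(x̂, z, λ)`: the decision of agent `i` is `xhat i i`. -/
@[ext] structure State {N : ℕ} (n : Fin N → ℕ) (m : ℕ) where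
  xhat : Estimates n
  z : Fin N → Vec m
  lam : Fin N → Vec m

/-- The actual decisions contained in a collection of estimates. -/
def decisions {N : ℕ} {n : Fin N → ℕ} (X : Estimates n) : Profile n := WithLp.toLp 2 fun i => X i i

/-- The partial gradients that the agents use in one iteration: the `i`-th one is a function of the
collective strategy. -/
abbrev Oracle {N : ℕ} (n : Fin N → ℕ) : Type := ∀ i, Profile n → Vec (n i)

section Algorithm

variable {N m d : ℕ} (Γ : Game N m d) (w : Matrix (Fin N) (Fin N) ℝ) (p : Params N)

/-- The new decision of agent `i`. -/
def nextDecision (S : Oracle Γ.n) (X : Estimates Γ.n) (lam : Fin N → Vec m) (i : Fin N) :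
    Vec (Γ.n i) :=
  prox (Γ.Ω i) (Γ.g i) (p.α i)
    (X i i - p.α i • (S i (X i) + (Γ.A i).transpose.toEuclideanLin (lam i)
      + p.c • ∑ j, w i j • (X i i - X j i)))

/-- The new estimates; the `i`-th component of the estimate of agent `i` is its new decision. -/
def nextEstimates (S : Oracle Γ.n) (X : Estimates Γ.n) (lam : Fin N → Vec m) : Estimates Γ.n :=
  WithLp.toLp 2 fun i =>
    setAt (X i - (p.α i * p.κ) • ∑ j, w i j • (X i - X j)) i (nextDecision Γ w p S X lam i)

/-- One iteration of the edge-based algorithm. -/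
def step (S : Oracle Γ.n) (s : State Γ.n m) : State Γ.n m :=
  let X' := nextEstimates Γ w p S s.xhat s.lam
  let z' : Fin N → Vec m := fun i => s.z i + p.ν • ∑ j, w i j • (s.lam i - s.lam j)
  { xhat := X'
    z := z'
    lam := fun i => projNonneg (s.lam i + p.δ i •
      ((2 : ℝ) • (Γ.A i).toEuclideanLin (X' i i) - (Γ.A i).toEuclideanLin (s.xhat i i) - Γ.b i
        - (2 : ℝ) • z' i + s.z i)) }

/-- The sequence of states that the algorithm generates from `s₀`, where `S k` is the oracle of
iteration `k`. -/
def iterate (S : ℕ → Oracle Γ.n) (s₀ : State Γ.n m) : ℕ → State Γ.n m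
  | 0 => s₀
  | k + 1 => step Γ w p (S k) (iterate S s₀ k)

/-- The state `(x̂, v, λ)` of the iteration that imposes `V λ = 0` by variables on the edges. -/
structure EdgeState {N : ℕ} (n : Fin N → ℕ) (m : ℕ) (G : SimpleGraph (Fin N)) where
  xhat : Estimates n
  v : Edge G → Vec m
  lam : Fin N → Vec m

/-- One step of the preconditioned forward-backward iteration in which dual consensus is imposed
through the incidence matrix, with one variable per edge. -/
def edgeStep (G : SimpleGraph (Fin N)) (S : Oracle Γ.n) (u : EdgeState Γ.n m G) :
    EdgeState Γ.n m G :=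
  let X' := nextEstimates Γ w p S u.xhat u.lam
  let v' : Edge G → Vec m := u.v + p.ν • incidenceMul G w u.lam
  { xhat := X'
    v := v'
    lam := fun i => projNonneg (u.lam i + p.δ i •
      ((2 : ℝ) • (Γ.A i).toEuclideanLin (X' i i) - (Γ.A i).toEuclideanLin (u.xhat i i) - Γ.b i
        - incidenceTransposeMul G w ((2 : ℝ) • v' - u.v) i)) }

/-- One communication round per iteration: the new variables of agent `i` are determined by its own
sampled gradient, by its own current variables, and by the current estimates and dual variables
of its neighbours. -/
def OneRound (G : SimpleGraph (Fin N)) : Prop :=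
  ∀ (S S' : Oracle Γ.n) (s s' : State Γ.n m) (i : Fin N), S i = S' i →
    s.xhat i = s'.xhat i → s.z i = s'.z i → s.lam i = s'.lam i →
    (∀ j, G.Adj i j → s.xhat j = s'.xhat j ∧ s.lam j = s'.lam j) →
    (step Γ w p S s).xhat i = (step Γ w p S' s').xhat i ∧
      (step Γ w p S s).z i = (step Γ w p S' s').z i ∧
      (step Γ w p S s).lam i = (step Γ w p S' s').lam i

/-- The change of variables `z = Vᵀ v`: the trajectories of the algorithm with `∑ z_i = 0` at the
beginning are exactly the trajectories of the iteration with edge variables, with `z = Vᵀ v`. -/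
def ChangeOfVariables (G : SimpleGraph (Fin N)) : Prop :=
  ∀ (S : ℕ → Oracle Γ.n) (s : ℕ → State Γ.n m),
    ((∀ k, s (k + 1) = step Γ w p (S k) (s k)) ∧ ∑ i, (s 0).z i = 0) ↔
      ∃ u : ℕ → EdgeState Γ.n m G, (∀ k, u (k + 1) = edgeStep Γ w p G (S k) (u k)) ∧
        ∀ k, (s k).xhat = (u k).xhat ∧ (s k).lam = (u k).lam ∧
          (s k).z = incidenceTransposeMul G w (u k).v

end Algorithm

/-! ### Sampling -/

section Sampling

variable {N m d : ℕ} (Γ : Game N m d) {Θ : Type*} [MeasurableSpace Θ] (μ : Measure Θ)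

/-- The oracle of iteration `k`: agent `i` averages its partial gradient over the `i`-th components
of the samples `ξ k 0, …, ξ k (M k - 1)`. -/
def sampleOracle (M : ℕ → ℕ) (ξ : ℕ → ℕ → Θ → Fin N → Vec d) (θ : Θ) (k : ℕ) : Oracle Γ.n :=
  fun i x => (M k : ℝ)⁻¹ • ∑ t ∈ Finset.range (M k), Γ.partialGrad i x (ξ k t θ i)

/-- The batch sizes satisfy `M_k ≥ C (k + k₀)^(a + 1)` for some `C, k₀, a > 0`. -/
def IncreasingBatch (M : ℕ → ℕ) : Prop :=
  ∃ C k₀ a : ℝ, 0 < C ∧ 0 < k₀ ∧ 0 < a ∧ ∀ k : ℕ, C * ((k : ℝ) + k₀) ^ (a + 1) ≤ M k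

/-- The samples are independent and identically distributed with law `Γ.P`. -/
structure IsIIDSampling (ξ : ℕ → ℕ → Θ → Fin N → Vec d) : Prop where
  measurable : ∀ k t, Measurable (ξ k t)
  law : ∀ k t, μ.map (ξ k t) = Γ.P
  indep : iIndepFun (fun q : ℕ × ℕ => ξ q.1 q.2) μ

/-- The sampled pseudogradients have uniformly bounded variance. -/
def BoundedVariance (D : ∀ i, Set (Vec (Γ.n i))) (M : ℕ → ℕ) (ξ : ℕ → ℕ → Θ → Fin N → Vec d) :
    Prop :=
  ∃ σ : ℝ, 0 < σ ∧ ∀ k, ∀ x ∈ Γ.box D,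
    ∫⁻ θ, ‖WithLp.toLp 2 (fun i => sampleOracle Γ M ξ θ k i x) - Γ.pseudograd x‖ₑ ^ 2 ∂μ
      ≤ ENNReal.ofReal (σ ^ 2)

/-- Admissible random initial states, independent of the samples: `x_i ∈ Ω_i`, `λ_i ≥ 0`, the
estimates of the decision of agent `j` lie in `D j`, and `∑ z_i = 0`. -/
structure IsInit (D : ∀ i, Set (Vec (Γ.n i))) (ξ : ℕ → ℕ → Θ → Fin N → Vec d)
    (s₀ : Θ → State Γ.n m) : Prop where
  measurable : Measurable (fun θ => ((s₀ θ).xhat, (s₀ θ).z, (s₀ θ).lam))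
  indep : IndepFun (fun θ => ((s₀ θ).xhat, (s₀ θ).z, (s₀ θ).lam))
    (fun θ (q : ℕ × ℕ) => ξ q.1 q.2 θ) μ
  decision_mem : ∀ θ i, (s₀ θ).xhat i i ∈ Γ.Ω i
  estimate_mem : ∀ θ i j, (s₀ θ).xhat i j ∈ D j
  lam_nonneg : ∀ θ i r, 0 ≤ (s₀ θ).lam i r
  z_sum : ∀ θ, ∑ i, (s₀ θ).z i = 0

end Sampling

end SGNE

end

noncomputable section

namespace SGNE

/-! ### Proximal points and variational inequalities -/

section Convex

variable {E : Type*} [NormedAddCommGroup E] [InnerProductSpace ℝ E]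

/-! Under the substitution `z = Vᵀ v` the algorithm becomes a forward-backward iteration on `(x̂, v,
λ)`, preconditioned by a quadratic form (`metricSq`) whose cross terms couple `λ` with `A x - Vᵀ v`.
The substitution is legitimate because `Vᵀ V = L` and because, on a connected graph, the range of
`Vᵀ` is exactly the space of zero-sum vectors.

The equilibrium comes from the variational inequality over the compact convex feasible set: a
proximal gradient map is a contraction there, which gives existence, and strong monotonicity gives
uniqueness. Integrating the gradient inequality shows that the solution is an SGNE. Slater's
condition supplies a multiplier `l`, and spreading the constraint residual evenly over the agents
turns `l` into a KKT point `(x, v, l)` with dual consensus (`exists_isKKT`).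

For convergence, the three-point identity of the metric bounds the change of the squared distance to
the KKT point by minus the metric of the displacement, minus twice the forward operator tested
against the new iterate (`metricSq_edgeStep_le`). At the old iterate, the extended pseudogradient
plus `c L` is strongly monotone towards consensus points: write the estimates as their average plus
a disagreement; the spectral gap controls the disagreement, and the condition on `c λ₂(L)` is
positive definiteness of the resulting form in two variables (`exists_restricted_strong_monotone`).
The displacement terms are absorbed by the metric once the step sizes are small
(`exists_stepsizes`). Telescoping yields `exists_energy_bound`: the sum of `‖x^k - x*‖²` is
controlled by the initial energy, the squared gradient errors, and the products of these errors with
`x^k - x*`.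

The stochastic part takes expectations. The state at time `k` is independent of batch `k`, so those
products have mean zero. The variance bound on batch 0 forces a finite variance of a single sample,
hence second moments of order `1 / M k`, which are summable. The initial energy need not be
integrable, so the argument runs on each event where it is at most `R`. Thus `E ‖x^k - x*‖²`,
restricted to such an event, is summable, and `x^k → x*` almost surely there; convergence of the
dual variables is never needed. -/

lemma nonneg_of_forall_quadratic_nonneg {a b : ℝ}
    (h : ∀ t : ℝ, 0 < t → t ≤ 1 → 0 ≤ t * a + t ^ 2 * b) : 0 ≤ a := by
  have h1 : ∀ t : ℝ, 0 < t → t ≤ 1 → -(t * b) ≤ a := fun t ht ht1 => by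
    have h2 := h t ht ht1
    have : 0 ≤ t * (a + t * b) := by linarith [h2, show t * (a + t * b) = t * a + t ^ 2 * b by ring]
    linarith [nonneg_of_mul_nonneg_right this ht]
  have hl : Tendsto (fun t : ℝ => -(t * b)) (𝓝[>] 0) (𝓝 0) := by
    have : Continuous (fun t : ℝ => -(t * b)) := by fun_prop
    simpa using (this.tendsto 0).mono_left nhdsWithin_le_nhds
  refine le_of_tendsto hl ?_
  filter_upwards [Ioc_mem_nhdsGT (zero_lt_one (α := ℝ))] with t ht
  exact h1 t ht.1 ht.2

lemma exists_prox_minimizer {E : Type*} [NormedAddCommGroup E] {K : Set E}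
    (hK : IsCompact K) (hne : K.Nonempty) {g : E → ℝ} (hg : LowerSemicontinuousOn g K) {α : ℝ}
    (hα : 0 ≤ α) (y : E) :
    ∃ u ∈ K, ∀ v ∈ K, α * g u + ‖u - y‖ ^ 2 / 2 ≤ α * g v + ‖v - y‖ ^ 2 / 2 := by
  have h1 : LowerSemicontinuousOn (fun u => α * g u) K := by
    have hc : Continuous fun t : ℝ => α * t := by fun_prop
    exact hc.comp_lowerSemicontinuousOn hg (fun a b hab => mul_le_mul_of_nonneg_left hab hα)
  have h2 : LowerSemicontinuousOn (fun u => ‖u - y‖ ^ 2 / 2) K :=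
    (by fun_prop : Continuous fun u : E => ‖u - y‖ ^ 2 / 2).lowerSemicontinuous
      |>.lowerSemicontinuousOn K
  obtain ⟨u, hu, hmin⟩ := (h1.add h2).exists_isMinOn hne hK
  exact ⟨u, hu, fun v hv => hmin hv⟩

/-- Compare `u` with the points `(1 - t) u + t v`: convexity of `g` leaves an expression of order
`t` plus one of order `t ^ 2`, and the former must be nonnegative. -/
lemma inner_le_of_prox_minimizer {K : Set E} {g : E → ℝ} (hg : ConvexOn ℝ K g) {α : ℝ}
    (hα : 0 ≤ α) {y u : E} (hu : u ∈ K)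
    (hmin : ∀ v ∈ K, α * g u + ‖u - y‖ ^ 2 / 2 ≤ α * g v + ‖v - y‖ ^ 2 / 2) {v : E} (hv : v ∈ K) :
    inner ℝ (y - u) (v - u) ≤ α * (g v - g u) := by
  suffices 0 ≤ α * (g v - g u) + inner ℝ (u - y) (v - u) by
    have h : inner ℝ (y - u) (v - u) = -inner ℝ (u - y) (v - u) := by
      rw [← inner_neg_left, neg_sub]
    linarith
  refine nonneg_of_forall_quadratic_nonneg (b := ‖v - u‖ ^ 2 / 2) fun t ht ht1 => ?_
  have hw : (1 - t) • u + t • v ∈ K := hg.1 hu hv (by linarith) ht.le (by ring)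
  have h1 := hmin _ hw
  have h2 : g ((1 - t) • u + t • v) ≤ (1 - t) * g u + t * g v :=
    hg.2 hu hv (by linarith) ht.le (by ring)
  have h3 : (1 - t) • u + t • v - y = (u - y) + t • (v - u) := by module
  rw [h3, norm_add_sq_real, inner_smul_right, norm_smul, Real.norm_of_nonneg ht.le] at h1
  nlinarith [mul_le_mul_of_nonneg_left h2 hα]

/-- Adding the first-order inequalities of the two minimizers, each tested at the other one, cancels
`g` and gives firm nonexpansiveness. -/
lemma norm_prox_sub_le {K : Set E} {g : E → ℝ} (hg : ConvexOn ℝ K g) {α : ℝ}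
    (hα : 0 ≤ α) {y u y' u' : E} (hu : u ∈ K)
    (hmin : ∀ v ∈ K, α * g u + ‖u - y‖ ^ 2 / 2 ≤ α * g v + ‖v - y‖ ^ 2 / 2) (hu' : u' ∈ K)
    (hmin' : ∀ v ∈ K, α * g u' + ‖u' - y'‖ ^ 2 / 2 ≤ α * g v + ‖v - y'‖ ^ 2 / 2) :
    ‖u - u'‖ ≤ ‖y - y'‖ := by
  have h1 := inner_le_of_prox_minimizer hg hα hu hmin hu'
  have h2 := inner_le_of_prox_minimizer hg hα hu' hmin' hu
  have h3 : ‖u - u'‖ ^ 2 ≤ inner ℝ (y - y') (u - u') := by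
    rw [← real_inner_self_eq_norm_sq]
    simp only [inner_sub_left, inner_sub_right] at h1 h2 ⊢
    linarith
  have h4 := real_inner_le_norm (y - y') (u - u')
  by_contra! hlt
  nlinarith [norm_nonneg (y - y'), norm_nonneg (u - u')]

/-- A strongly monotone Lipschitz variational inequality of the second kind over a compact convex
set has a solution. -/
lemma exists_variational_solution {K : Set E} (hK : IsCompact K) (hne : K.Nonempty) {g : E → ℝ}
    (hg : ConvexOn ℝ K g) (hlsc : LowerSemicontinuousOn g K) {F : E → E} {η ℓ : ℝ} (hη : 0 < η)
    (hℓ : 0 < ℓ) (hmono : ∀ x ∈ K, ∀ y ∈ K, η * ‖x - y‖ ^ 2 ≤ inner ℝ (F x - F y) (x - y))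
    (hlip : ∀ x ∈ K, ∀ y ∈ K, ‖F x - F y‖ ≤ ℓ * ‖x - y‖) :
    ∃ x ∈ K, ∀ y ∈ K, 0 ≤ inner ℝ (F x) (y - x) + (g y - g x) := by
  -- This `τ` minimizes the squared contraction factor `1 - 2 τ η + τ ^ 2 ℓ ^ 2`, with value `1 - η
  -- ^ 2 / ℓ ^ 2`.
  set τ : ℝ := η / ℓ ^ 2 with hτ
  have hτ0 : 0 < τ := by positivity
  choose T hTK hTmin using fun x : E => exists_prox_minimizer hK hne hlsc hτ0.le (x - τ • F x)
  have hcontr : ∀ x ∈ K, ∀ y ∈ K, ‖T x - T y‖ ^ 2 ≤ (1 - η ^ 2 / ℓ ^ 2) * ‖x - y‖ ^ 2 := by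
    intro x hx y hy
    have h1 := norm_prox_sub_le hg hτ0.le (hTK x) (hTmin x) (hTK y) (hTmin y)
    have h2 : x - τ • F x - (y - τ • F y) = (x - y) - τ • (F x - F y) := by module
    rw [h2] at h1
    have h3 : ‖(x - y) - τ • (F x - F y)‖ ^ 2
        = ‖x - y‖ ^ 2 - 2 * τ * inner ℝ (F x - F y) (x - y) + τ ^ 2 * ‖F x - F y‖ ^ 2 := by
      rw [norm_sub_sq_real, inner_smul_right, norm_smul, Real.norm_of_nonneg hτ0.le,
        real_inner_comm]
      ring
    have h4 := hmono x hx y hy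
    have h5 : ‖F x - F y‖ ^ 2 ≤ ℓ ^ 2 * ‖x - y‖ ^ 2 := by
      rw [← mul_pow]; exact pow_le_pow_left₀ (norm_nonneg _) (hlip x hx y hy) 2
    calc ‖T x - T y‖ ^ 2 ≤ ‖(x - y) - τ • (F x - F y)‖ ^ 2 :=
          pow_le_pow_left₀ (norm_nonneg _) h1 2
      _ ≤ ‖x - y‖ ^ 2 - 2 * τ * (η * ‖x - y‖ ^ 2) + τ ^ 2 * (ℓ ^ 2 * ‖x - y‖ ^ 2) := by
          rw [h3]
          have := mul_le_mul_of_nonneg_left h4 hτ0.le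
          have := mul_le_mul_of_nonneg_left h5 (sq_nonneg τ)
          linarith
      _ = _ := by rw [hτ]; field_simp; ring
  have hcont : ContinuousOn T K := by
    have : LipschitzOnWith 1 T K := LipschitzOnWith.of_dist_le_mul fun x hx y hy => by
      rw [dist_eq_norm, dist_eq_norm, NNReal.coe_one, one_mul]
      have h1 := hcontr x hx y hy
      have h2 : 0 ≤ η ^ 2 / ℓ ^ 2 * ‖x - y‖ ^ 2 := by positivity
      exact abs_le_of_sq_le_sq' (by linarith) (norm_nonneg _) |>.2
    exact this.continuousOn
  -- Compactness replaces completeness of `E`: where the residual `‖T x - x‖` is minimal it must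
  -- vanish, since `T` would otherwise decrease it strictly.
  obtain ⟨x, hx, hxmin⟩ := hK.exists_isMinOn hne
    (f := fun x => ‖T x - x‖) ((hcont.sub continuousOn_id).norm)
  have hfix : T x = x := by
    have h1 : ‖T x - x‖ ≤ ‖T (T x) - T x‖ := hxmin (hTK x)
    have h2 := hcontr (T x) (hTK x) x hx
    have h3 := pow_le_pow_left₀ (norm_nonneg _) h1 2
    have h4 : 0 < η ^ 2 / ℓ ^ 2 := by positivity
    have h5 : ‖T x - x‖ ^ 2 ≤ 0 := by
      by_contra! h
      nlinarith [mul_pos h4 h]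
    have h6 : ‖T x - x‖ = 0 := by
      have := sq_nonneg ‖T x - x‖
      exact pow_eq_zero_iff two_ne_zero |>.1 (le_antisymm h5 this)
    exact sub_eq_zero.1 (norm_eq_zero.1 h6)
  refine ⟨x, hx, fun y hy => ?_⟩
  have h := inner_le_of_prox_minimizer hg hτ0.le (hTK x) (hTmin x) hy
  rw [hfix, sub_sub_cancel_left, inner_neg_left, inner_smul_left] at h
  have h' : 0 ≤ τ * (inner ℝ (F x) (y - x) + (g y - g x)) := by
    simp only [conj_trivial] at h
    linarith
  exact nonneg_of_mul_nonneg_right h' hτ0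

/-- Existence of Lagrange multipliers for a convex program under Slater's condition. -/
lemma exists_lagrange_multiplier {m : ℕ} {K : Set E} {φ : E → ℝ} (hφ : ConvexOn ℝ K φ)
    {ψ : Fin m → E → ℝ} (hψ : ∀ r, ConvexOn ℝ K (ψ r)) {x₀ xs : E} (hx₀ : x₀ ∈ K)
    (hslater : ∀ r, ψ r x₀ < 0) (hxs : xs ∈ K) (hfeas : ∀ r, ψ r xs ≤ 0)
    (hmin : ∀ x ∈ K, (∀ r, ψ r x ≤ 0) → φ xs ≤ φ x) :
    ∃ l : Fin m → ℝ, (∀ r, 0 ≤ l r) ∧ (∀ r, l r * ψ r xs = 0) ∧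
      ∀ x ∈ K, φ xs ≤ φ x + ∑ r, l r * ψ r x := by
  -- The values that strictly exceed the objective gap and the constraints at some point of `K`.
  -- Strictness makes this set open whatever the regularity of `φ` and `ψ`, and optimality of `xs`
  -- keeps `0` out of it.
  set C : Set (ℝ × (Fin m → ℝ)) :=
    {c | ∃ x ∈ K, φ x - φ xs < c.1 ∧ ∀ r, ψ r x < c.2 r} with hC
  have hopen : IsOpen C := by
    have : C = ⋃ x ∈ K, {c : ℝ × (Fin m → ℝ) | φ x - φ xs < c.1} ∩
        ⋂ r, {c : ℝ × (Fin m → ℝ) | ψ r x < c.2 r} := by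
      ext c; simp only [hC, Set.mem_ofPred_eq, Set.mem_iUnion, Set.mem_inter_iff, Set.mem_iInter,
        exists_prop]
    rw [this]
    refine isOpen_biUnion fun x _ => IsOpen.inter ?_ (isOpen_iInter_of_finite fun r => ?_)
    · exact isOpen_lt continuous_const continuous_fst
    · exact isOpen_lt continuous_const (by fun_prop)
  have hconv : Convex ℝ C := by
    rintro c ⟨x, hx, hx1, hx2⟩ c' ⟨y, hy, hy1, hy2⟩ a b ha hb hab
    have key : ∀ s t s' t' : ℝ, s < s' → t < t' → a * s + b * t < a * s' + b * t' := by
      intro s t s' t' h h'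
      rcases ha.eq_or_lt with rfl | ha'
      · have : b = 1 := by linarith
        subst this; linarith
      · nlinarith [mul_lt_mul_of_pos_left h ha', mul_le_mul_of_nonneg_left h'.le hb]
    refine ⟨a • x + b • y, hφ.1 hx hy ha hb hab, ?_, fun r => ?_⟩
    · have h1 := hφ.2 hx hy ha hb hab
      have h2 := key _ _ _ _ hx1 hy1
      simp only [smul_eq_mul, Prod.fst_add, Prod.smul_fst] at h1 ⊢
      have : (a + b) * φ xs = φ xs := by rw [hab, one_mul]
      linarith
    · have h1 := (hψ r).2 hx hy ha hb hab
      have h2 := key _ _ _ _ (hx2 r) (hy2 r)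
      simp only [smul_eq_mul, Prod.snd_add, Prod.smul_snd, Pi.add_apply, Pi.smul_apply] at h1 ⊢
      linarith
  have h0 : (0 : ℝ × (Fin m → ℝ)) ∉ C := by
    rintro ⟨x, hx, hx1, hx2⟩
    have := hmin x hx fun r => (hx2 r).le
    simp only [Prod.fst_zero] at hx1
    linarith
  obtain ⟨f, hf⟩ := geometric_hahn_banach_point_open hconv hopen h0
  simp only [map_zero] at hf
  set μ : ℝ := f (1, 0) with hμ
  set l : Fin m → ℝ := fun r => f (0, Pi.single r 1) with hl
  have hfrep : ∀ (r : ℝ) (u : Fin m → ℝ), f (r, u) = r * μ + ∑ j, u j * l j := by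
    intro r u
    have h1 : (r, u) = r • ((1 : ℝ), (0 : Fin m → ℝ)) +
        ∑ j, u j • ((0 : ℝ), (Pi.single j 1 : Fin m → ℝ)) := by
      ext j
      · simp [Prod.fst_sum]
      · simp [Prod.snd_sum, Finset.sum_apply, Pi.single_apply]
    rw [h1, map_add, map_smul, map_sum]
    simp only [map_smul, smul_eq_mul, hμ, hl]
  have hμpos : 0 < μ := by
    -- Slater's point puts a vector with vanishing constraint part into `C`, so the separating
    -- functional cannot vanish in the objective direction.
    have h1 : ((|φ x₀ - φ xs| + 1, 0) : ℝ × (Fin m → ℝ)) ∈ C :=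
      ⟨x₀, hx₀, by simpa using (le_abs_self (φ x₀ - φ xs)).trans_lt (lt_add_one _), hslater⟩
    have h2 := hf _ h1
    rw [hfrep] at h2
    simp only [Pi.zero_apply, zero_mul, Finset.sum_const_zero, add_zero] at h2
    exact pos_of_mul_pos_right h2 (by positivity)
  have hlnn : ∀ r, 0 ≤ l r := by
    intro r
    by_contra! hneg
    set R := |φ x₀ - φ xs| + 1
    have h1 : ∀ t : ℝ, 0 ≤ t → 0 < R * μ + t * l r := by
      intro t ht
      have hmem : ((R, Pi.single r t) : ℝ × (Fin m → ℝ)) ∈ C := by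
        refine ⟨x₀, hx₀, by simpa using (le_abs_self (φ x₀ - φ xs)).trans_lt (lt_add_one _),
          fun j => (hslater j).trans_le ?_⟩
        by_cases hj : j = r
        · subst hj; simpa using ht
        · simp [hj]
      have := hf _ hmem
      rw [hfrep] at this
      simpa [Pi.single_apply] using this
    -- If `l r < 0`, this is the `t` at which `R * μ + t * l r` reaches zero.
    have h2 := h1 (R * μ / (-l r)) (div_nonneg (by positivity) (by linarith))
    have h3 : R * μ / (-l r) * l r = -(R * μ) := by
      have : l r ≠ 0 := hneg.ne
      field_simp
    linarith
  have hlag : ∀ x ∈ K, 0 ≤ (φ x - φ xs) * μ + ∑ r, ψ r x * l r := by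
    intro x hx
    -- The values at `x` themselves need not belong to `C`; shifting all coordinates by `ε` brings
    -- them in, and `ε` then tends to zero.
    have h1 : ∀ ε : ℝ, 0 < ε →
        0 ≤ (φ x - φ xs) * μ + ∑ r, ψ r x * l r + ε * (μ + ∑ r, l r) := by
      intro ε hε
      have hmem : ((φ x - φ xs + ε, fun r => ψ r x + ε) : ℝ × (Fin m → ℝ)) ∈ C :=
        ⟨x, hx, by simpa using hε, fun r => by simpa using hε⟩
      have := hf _ hmem
      rw [hfrep] at this
      simp only [add_mul, Finset.sum_add_distrib, ← Finset.mul_sum] at this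
      linarith
    have hl : Tendsto (fun ε : ℝ => (φ x - φ xs) * μ + ∑ r, ψ r x * l r + ε * (μ + ∑ r, l r))
        (𝓝[>] 0) (𝓝 ((φ x - φ xs) * μ + ∑ r, ψ r x * l r)) := by
      have : Continuous
          (fun ε : ℝ => (φ x - φ xs) * μ + ∑ r, ψ r x * l r + ε * (μ + ∑ r, l r)) := by fun_prop
      simpa using (this.tendsto 0).mono_left nhdsWithin_le_nhds
    refine ge_of_tendsto hl ?_
    filter_upwards [self_mem_nhdsWithin] with ε hε using h1 ε hε
  have hcomp : ∀ r, ψ r xs * l r = 0 := by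
    have h1 := hlag xs hxs
    rw [sub_self, zero_mul, zero_add] at h1
    have h2 : ∀ r ∈ Finset.univ, ψ r xs * l r ≤ 0 :=
      fun r _ => mul_nonpos_of_nonpos_of_nonneg (hfeas r) (hlnn r)
    have h3 : ∑ r, ψ r xs * l r = 0 := le_antisymm (Finset.sum_nonpos h2) h1
    exact fun r => (Finset.sum_eq_zero_iff_of_nonpos h2).1 h3 r (Finset.mem_univ r)
  refine ⟨fun r => l r / μ, fun r => div_nonneg (hlnn r) hμpos.le, fun r => ?_, fun x hx => ?_⟩
  · rw [div_mul_eq_mul_div, mul_comm, hcomp, zero_div]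
  · have h1 := hlag x hx
    have h2 : ∑ r, l r / μ * ψ r x = (∑ r, ψ r x * l r) / μ := by
      rw [Finset.sum_div]; exact Finset.sum_congr rfl fun r _ => by ring
    rw [h2]
    have h3 : 0 ≤ ((φ x - φ xs) * μ + ∑ r, ψ r x * l r) / μ := div_nonneg h1 hμpos.le
    rw [add_div, mul_div_cancel_right₀ _ hμpos.ne'] at h3
    linarith

/-- The gradient inequality for a function that is convex on a set and differentiable at a point
of it. -/
lemma inner_gradient_le_of_convexOn [CompleteSpace E] {K : Set E} {f : E → ℝ}
    (hf : ConvexOn ℝ K f) {x y : E} (hx : x ∈ K) (hy : y ∈ K) (hd : DifferentiableAt ℝ f x) :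
    inner ℝ (gradient f x) (y - x) ≤ f y - f x := by
  have hpath : HasDerivAt (fun t : ℝ => x + t • (y - x)) (y - x) 0 := by
    simpa using ((hasDerivAt_id (0 : ℝ)).smul_const (y - x)).const_add x
  have hder : HasDerivAt (fun t : ℝ => f (x + t • (y - x))) (inner ℝ (gradient f x) (y - x)) 0 := by
    have h1 : HasFDerivAt f (InnerProductSpace.toDual ℝ E (gradient f x))
        (x + (0 : ℝ) • (y - x)) := by
      simpa using hd.hasGradientAt.hasFDerivAt
    have h2 := h1.comp_hasDerivAt (0 : ℝ) hpath
    rwa [InnerProductSpace.toDual_apply_apply] at h2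
  -- Only right difference quotients are used: for `t` in `(0, 1]` the segment stays in `K`, and
  -- convexity bounds the quotient by `f y - f x`.
  have hslope := hder.tendsto_slope_zero_right
  refine le_of_tendsto hslope ?_
  filter_upwards [Ioc_mem_nhdsGT (zero_lt_one (α := ℝ))] with t ht
  have h2 : f (x + t • (y - x)) ≤ (1 - t) * f x + t * f y := by
    have := hf.2 hx hy (by linarith [ht.2] : 0 ≤ 1 - t) ht.1.le (by ring)
    rwa [show (1 - t) • x + t • y = x + t • (y - x) by module] at this
  simp only [zero_add, zero_smul, add_zero, smul_eq_mul]
  rw [inv_mul_le_iff₀ ht.1]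
  linarith

end Convex

/-! ### Replacing one decision -/

section SetAt

variable {N : ℕ} {n : Fin N → ℕ}

@[simp] lemma setAt_same (x : Profile n) (i : Fin N) (y : Vec (n i)) : setAt x i y i = y := by
  simp [setAt]

lemma setAt_of_ne (x : Profile n) {i j : Fin N} (h : j ≠ i) (y : Vec (n i)) :
    setAt x i y j = x j := by
  simp [setAt, h]

@[simp] lemma setAt_self (x : Profile n) (i : Fin N) : setAt x i (x i) = x := by
  ext j : 1
  by_cases h : j = i
  · subst h; simp
  · rw [setAt_of_ne x h]

lemma sum_setAt_sub {M : Type*} [AddCommGroup M] (φ : ∀ j, Vec (n j) → M) (x : Profile n)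
    (i : Fin N) (y : Vec (n i)) :
    ∑ j, (φ j (setAt x i y j) - φ j (x j)) = φ i y - φ i (x i) := by
  rw [Finset.sum_eq_single i]
  · rw [setAt_same]
  · intro j _ hj; rw [setAt_of_ne x hj, sub_self]
  · intro h; exact absurd (Finset.mem_univ i) h

lemma inner_setAt_sub (v x : Profile n) (i : Fin N) (y : Vec (n i)) :
    inner ℝ v (setAt x i y - x) = inner ℝ (v i) (y - x i) := by
  have h := sum_setAt_sub (fun j u => (inner ℝ (v j) u : ℝ)) x i y
  rw [inner_sub_right, PiLp.inner_apply, PiLp.inner_apply, ← Finset.sum_sub_distrib, h,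
    inner_sub_right]

lemma setAt_mem_box {S : ∀ i, Set (Vec (n i))} {x : Profile n} (hx : ∀ i, x i ∈ S i) {i : Fin N}
    {y : Vec (n i)} (hy : y ∈ S i) : ∀ j, setAt x i y j ∈ S j := by
  intro j
  by_cases h : j = i
  · subst h; simpa using hy
  · rw [setAt_of_ne x h]; exact hx j

lemma measurable_setAt (i : Fin N) :
    Measurable (fun q : Profile n × Vec (n i) => setAt q.1 i q.2) := by
  have : Continuous (fun q : Profile n × Vec (n i) => setAt q.1 i q.2) := by
    refine (PiLp.continuous_toLp 2 _).comp (Continuous.update (i := i) ?_ (by fun_prop))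
    exact continuous_pi fun j => by fun_prop
  exact this.measurable

end SetAt

/-! ### Equilibria of the game -/

namespace Game

variable {N m d : ℕ} (Γ : Game N m d)

lemma box_mono {S S' : ∀ i, Set (Vec (Γ.n i))} (h : ∀ i, S i ⊆ S' i) : Γ.box S ⊆ Γ.box S' :=
  fun _ hx i => h i (hx i)

lemma convex_box {S : ∀ i, Set (Vec (Γ.n i))} (h : ∀ i, Convex ℝ (S i)) : Convex ℝ (Γ.box S) :=
  fun _ hx _ hy _ _ ha hb hab i => h i (hx i) (hy i) ha hb hab

lemma isCompact_box {S : ∀ i, Set (Vec (Γ.n i))} (h : ∀ i, IsCompact (S i)) :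
    IsCompact (Γ.box S) := by
  have : Γ.box S = WithLp.toLp 2 '' (Set.univ.pi S) := by
    ext x
    constructor
    · intro hx
      exact ⟨WithLp.ofLp x, fun i _ => hx i, rfl⟩
    · rintro ⟨y, hy, rfl⟩ i
      exact hy i (Set.mem_univ i)
  rw [this]
  exact (isCompact_univ_pi h).image (PiLp.continuous_toLp 2 _)

/-- The coupling map `x ↦ ∑ A_i x_i`. -/
def coupling : Profile Γ.n →ₗ[ℝ] Vec m :=
  ∑ i, (Γ.A i).toEuclideanLin ∘ₗ (PiLp.projₗ 2 (fun i => Vec (Γ.n i)) i)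

lemma coupling_apply (x : Profile Γ.n) : Γ.coupling x = ∑ i, (Γ.A i).toEuclideanLin (x i) := by
  simp [coupling]

lemma coupling_setAt (x : Profile Γ.n) (i : Fin N) (y : Vec (Γ.n i)) :
    Γ.coupling (setAt x i y) = Γ.coupling x + (Γ.A i).toEuclideanLin (y - x i) := by
  have h := sum_setAt_sub (fun j u => (Γ.A j).toEuclideanLin u) x i y
  rw [Finset.sum_sub_distrib, ← map_sub] at h
  rw [coupling_apply, coupling_apply, ← h]; abel

lemma mem_feasible_iff {x : Profile Γ.n} :
    x ∈ Γ.feasible ↔ x ∈ Γ.box Γ.Ω ∧ ∀ r, Γ.coupling x r ≤ Γ.rhs r := by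
  rw [coupling_apply]; rfl

variable {Γ} {D : ∀ i, Set (Vec (Γ.n i))} {η ℓF : ℝ}

namespace Assumptions

lemma box_subset (hΓ : Γ.Assumptions D η ℓF) : Γ.box Γ.Ω ⊆ Γ.box D := Γ.box_mono hΓ.Ω_subset_D

lemma convexOn_sum_g (hΓ : Γ.Assumptions D η ℓF) :
    ConvexOn ℝ (Γ.box Γ.Ω) (fun x => ∑ i, Γ.g i (x i)) := by
  refine ⟨Γ.convex_box hΓ.Ω_convex, fun x hx y hy a b ha hb hab => ?_⟩
  simp only [smul_eq_mul, Finset.mul_sum, ← Finset.sum_add_distrib]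
  exact Finset.sum_le_sum fun i _ => (hΓ.g_convex i).2 (hx i) (hy i) ha hb hab

lemma lsc_sum_g (hΓ : Γ.Assumptions D η ℓF) :
    LowerSemicontinuousOn (fun x => ∑ i, Γ.g i (x i)) (Γ.box Γ.Ω) := by
  refine lowerSemicontinuousOn_sum fun i _ => ?_
  exact (hΓ.g_lsc i).comp (by fun_prop : Continuous fun x : Profile Γ.n => x i).continuousOn
    (fun x hx => hx i)

lemma convex_feasible (hΓ : Γ.Assumptions D η ℓF) : Convex ℝ Γ.feasible := by
  intro x hx y hy a b ha hb hab
  rw [mem_feasible_iff] at *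
  refine ⟨Γ.convex_box hΓ.Ω_convex hx.1 hy.1 ha hb hab, fun r => ?_⟩
  have h1 : Γ.coupling (a • x + b • y) r = a * Γ.coupling x r + b * Γ.coupling y r := by
    simp [map_add, map_smul]
  have h2 : Γ.rhs r = a * Γ.rhs r + b * Γ.rhs r := by rw [← add_mul, hab, one_mul]
  rw [h1, h2]
  exact add_le_add (mul_le_mul_of_nonneg_left (hx.2 r) ha) (mul_le_mul_of_nonneg_left (hy.2 r) hb)

lemma isCompact_feasible (hΓ : Γ.Assumptions D η ℓF) : IsCompact Γ.feasible := by
  have h1 : Γ.feasible = Γ.box Γ.Ω ∩ {x | ∀ r, Γ.coupling x r ≤ Γ.rhs r} := by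
    ext x; exact Γ.mem_feasible_iff
  rw [h1]
  refine (Γ.isCompact_box hΓ.Ω_compact).inter_right ?_
  simp only [Set.ofPred_forall]
  refine isClosed_iInter fun r => isClosed_le ?_ continuous_const
  have : Continuous Γ.coupling := Γ.coupling.continuous_of_finiteDimensional
  fun_prop

/-- The variational inequality has a solution. -/
lemma exists_variational (hΓ : Γ.Assumptions D η ℓF) : ∃ x ∈ Γ.feasible, ∀ y ∈ Γ.feasible,
    0 ≤ inner ℝ (Γ.pseudograd x) (y - x) + ∑ i, (Γ.g i (y i) - Γ.g i (x i)) := by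
  have hsub : Γ.feasible ⊆ Γ.box Γ.Ω := fun x hx => hx.1
  have hne : Γ.feasible.Nonempty := by
    obtain ⟨x, hx, hx'⟩ := hΓ.slater
    exact ⟨x, hx, fun r => (hx' r).le⟩
  obtain ⟨x, hx, h⟩ := exists_variational_solution hΓ.isCompact_feasible hne
    (hΓ.convexOn_sum_g.subset hsub hΓ.convex_feasible) (hΓ.lsc_sum_g.mono hsub) hΓ.η_pos hΓ.ℓF_pos
    (fun x hx y hy => hΓ.strongly_monotone x (hΓ.box_subset (hsub hx)) y (hΓ.box_subset (hsub hy)))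
    (fun x hx y hy => hΓ.lipschitz x (hΓ.box_subset (hsub hx)) y (hΓ.box_subset (hsub hy)))
  exact ⟨x, hx, fun y hy => by simpa only [Finset.sum_sub_distrib] using h y hy⟩

/-- The variational inequality has at most one solution. -/
lemma variational_unique (hΓ : Γ.Assumptions D η ℓF) {x y : Profile Γ.n}
    (hx : x ∈ Γ.feasible) (hy : y ∈ Γ.feasible)
    (hxy : 0 ≤ inner ℝ (Γ.pseudograd x) (y - x) + ∑ i, (Γ.g i (y i) - Γ.g i (x i)))
    (hyx : 0 ≤ inner ℝ (Γ.pseudograd y) (x - y) + ∑ i, (Γ.g i (x i) - Γ.g i (y i))) : y = x := by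
  have h := hΓ.strongly_monotone x (hΓ.box_subset hx.1) y (hΓ.box_subset hy.1)
  simp only [Finset.sum_sub_distrib] at hxy hyx
  have h1 : inner ℝ (Γ.pseudograd x - Γ.pseudograd y) (x - y) ≤ 0 := by
    rw [inner_sub_left]
    rw [← neg_sub x y, inner_neg_right] at hxy
    linarith
  have h2 : ‖x - y‖ ^ 2 ≤ 0 := by
    by_contra! h3
    nlinarith [mul_pos hΓ.η_pos h3]
  have h3 : ‖x - y‖ = 0 := by
    have := sq_nonneg ‖x - y‖
    exact (pow_eq_zero_iff two_ne_zero).1 (le_antisymm h2 this)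
  exact (sub_eq_zero.1 (norm_eq_zero.1 h3)).symm

lemma differentiableAt_f (hΓ : Γ.Assumptions D η ℓF) {i : Fin N} {x : Profile Γ.n}
    (hx : x ∈ Γ.box D) {s : Vec d} (hs : s ∈ Γ.Ξ i) :
    DifferentiableAt ℝ (fun y => Γ.f i (setAt x i y) s) (x i) :=
  ((hΓ.f_contDiff i x hx s hs).differentiable one_ne_zero) _

/-- The gradient inequality holds for each `s` and is then integrated, so no differentiation under
the integral is required. -/
lemma inner_pseudograd_le (hΓ : Γ.Assumptions D η ℓF) {i : Fin N} {x : Profile Γ.n}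
    (hx : x ∈ Γ.box Γ.Ω) {y : Vec (Γ.n i)} (hy : y ∈ Γ.Ω i) : inner ℝ (Γ.pseudograd x i) (y - x i) ≤
      (∫ s, Γ.f i (setAt x i y) (s i) ∂Γ.P) - ∫ s, Γ.f i x (s i) ∂Γ.P := by
  have hgi := hΓ.grad_integrable i x (hΓ.box_subset hx)
  have h1 : inner ℝ (Γ.pseudograd x i) (y - x i)
      = ∫ s, inner ℝ (y - x i) (Γ.partialGrad i x (s i)) ∂Γ.P := by
    rw [integral_inner hgi, real_inner_comm]; rfl
  rw [h1, ← integral_sub (hΓ.f_integrable i _ (setAt_mem_box hx hy)) (hΓ.f_integrable i x hx)]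
  refine integral_mono_ae (hgi.const_inner _)
    ((hΓ.f_integrable i _ (setAt_mem_box hx hy)).sub (hΓ.f_integrable i x hx)) ?_
  filter_upwards [hΓ.mem_Ξ] with s hs
  have h2 := inner_gradient_le_of_convexOn (hΓ.f_convex i x hx (s i) (hs i)) (hx i) hy
    (hΓ.differentiableAt_f (hΓ.box_subset hx) (hs i))
  rw [setAt_self] at h2
  rw [real_inner_comm]
  exact h2

/-- A solution of the variational inequality is an equilibrium. -/
lemma isSGNE_of_variational (hΓ : Γ.Assumptions D η ℓF) {x : Profile Γ.n} (hx : x ∈ Γ.feasible)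
    (hvi : ∀ y ∈ Γ.feasible,
      0 ≤ inner ℝ (Γ.pseudograd x) (y - x) + ∑ i, (Γ.g i (y i) - Γ.g i (x i))) : Γ.IsSGNE x := by
  refine ⟨hx, fun i y hy => ?_⟩
  -- A unilateral deviation that is feasible for agent `i` keeps the whole profile feasible, so the
  -- variational inequality may be tested with it.
  have hfeas : setAt x i y ∈ Γ.feasible := by
    rw [mem_feasible_iff]
    refine ⟨setAt_mem_box hx.1 hy.1, fun r => ?_⟩
    have h := hy.2 r
    rw [coupling_setAt, coupling_apply, ← Finset.add_sum_erase _ _ (Finset.mem_univ i), map_sub]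
    simp only [PiLp.sub_apply, PiLp.add_apply] at h ⊢
    linarith
  have h1 := hvi _ hfeas
  rw [inner_setAt_sub, sum_setAt_sub (fun j u => Γ.g j u)] at h1
  have h2 := hΓ.inner_pseudograd_le hx.1 hy.1
  simp only [cost, setAt_same]
  linarith

/-- The solution of the variational inequality has a multiplier of the coupling constraint. -/
lemma exists_multiplier (hΓ : Γ.Assumptions D η ℓF) {x : Profile Γ.n} (hx : x ∈ Γ.feasible)
    (hvi : ∀ y ∈ Γ.feasible,
      0 ≤ inner ℝ (Γ.pseudograd x) (y - x) + ∑ i, (Γ.g i (y i) - Γ.g i (x i))) :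
    ∃ l : Vec m, (∀ r, 0 ≤ l r) ∧ (∀ r, l r * (Γ.coupling x r - Γ.rhs r) = 0) ∧
      ∀ i, ∀ u ∈ Γ.Ω i, 0 ≤ inner ℝ (Γ.pseudograd x i) (u - x i)
        + inner ℝ l ((Γ.A i).toEuclideanLin (u - x i)) + (Γ.g i u - Γ.g i (x i)) := by
  obtain ⟨x₀, hx₀, hs⟩ := hΓ.slater
  have hφ : ConvexOn ℝ (Γ.box Γ.Ω)
      (fun y => inner ℝ (Γ.pseudograd x) y + ∑ i, Γ.g i (y i)) := by
    refine ConvexOn.add ?_ hΓ.convexOn_sum_g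
    exact (innerₗ (Profile Γ.n) (Γ.pseudograd x)).convexOn (Γ.convex_box hΓ.Ω_convex)
  have hψ : ∀ r, ConvexOn ℝ (Γ.box Γ.Ω) (fun y => Γ.coupling y r - Γ.rhs r) := by
    intro r
    refine ⟨Γ.convex_box hΓ.Ω_convex, fun y _ z _ a b _ _ hab => le_of_eq ?_⟩
    have h2 : Γ.rhs r = a * Γ.rhs r + b * Γ.rhs r := by rw [← add_mul, hab, one_mul]
    simp only [map_add, map_smul, PiLp.add_apply, PiLp.smul_apply, smul_eq_mul]
    linarith
  -- The variational inequality says that `x` minimizes the convex function `⟨F(x), y⟩ + ∑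
  -- g_i(y_i)`, with `F(x)` frozen, over the feasible set.
  obtain ⟨l, hl, hc, hlag⟩ := exists_lagrange_multiplier hφ hψ hx₀
    (fun r => by rw [coupling_apply]; exact sub_neg.2 (hs r)) hx.1
    (fun r => sub_nonpos.2 ((Γ.mem_feasible_iff.1 hx).2 r)) (fun y hy hy' => by
      have h := hvi y (Γ.mem_feasible_iff.2 ⟨hy, fun r => sub_nonpos.1 (hy' r)⟩)
      rw [inner_sub_right, Finset.sum_sub_distrib] at h
      linarith)
  refine ⟨WithLp.toLp 2 l, hl, hc, fun i u hu => ?_⟩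
  -- Varying one block at a time decouples the Lagrangian inequality into one inequality per agent;
  -- complementary slackness removes the constraint value at `x`.
  have h1 := hlag _ (setAt_mem_box hx.1 hu)
  have h2 := inner_setAt_sub (Γ.pseudograd x) x i u
  have h3 := sum_setAt_sub (fun j v => Γ.g j v) x i u
  rw [inner_sub_right] at h2
  rw [Finset.sum_sub_distrib] at h3
  have h4 : ∑ r, l r * (Γ.coupling (setAt x i u) r - Γ.rhs r)
      = inner ℝ (WithLp.toLp 2 l) ((Γ.A i).toEuclideanLin (u - x i)) := by
    rw [PiLp.inner_apply]
    refine Finset.sum_congr rfl fun r _ => ?_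
    have := hc r
    rw [coupling_setAt, PiLp.add_apply]
    simp only [RCLike.inner_apply, conj_trivial]
    linarith
  rw [h4] at h1
  linarith

end Assumptions

end Game

/-! ### Incidence matrix and Laplacian -/

section Graph

variable {N m : ℕ} {G : SimpleGraph (Fin N)} {w : Matrix (Fin N) (Fin N) ℝ}

lemma IsWeighting.nonneg (hw : IsWeighting G w) (i j : Fin N) : 0 ≤ w i j := by
  by_cases h : G.Adj i j
  · exact (hw.pos i j h).le
  · exact (hw.zero i j h).ge

lemma IsWeighting.comm (hw : IsWeighting G w) (i j : Fin N) : w i j = w j i := hw.symm.apply j i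

lemma incidence_apply (e : Edge G) (i : Fin N) : incidence G w e i =
    (if i = e.1.1 then √(w e.1.1 e.1.2) else 0) - (if i = e.1.2 then √(w e.1.1 e.1.2) else 0) := by
  have hne : e.1.1 ≠ e.1.2 := e.2.1.ne
  simp only [incidence, Matrix.of_apply]
  by_cases h1 : i = e.1.1
  · subst h1; simp [hne]
  · rw [if_neg h1, if_neg h1]
    by_cases h2 : i = e.1.2 <;> simp [h2]

lemma incidenceMul_apply (lam : Fin N → Vec m) (e : Edge G) :
    incidenceMul G w lam e = √(w e.1.1 e.1.2) • (lam e.1.1 - lam e.1.2) := by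
  simp only [incidenceMul, incidence_apply, sub_smul, Finset.sum_sub_distrib, ite_smul, zero_smul,
    Finset.sum_ite_eq', Finset.mem_univ, if_true, smul_sub]

lemma sum_edge {M : Type*} [AddCommMonoid M] (F : Fin N → Fin N → M)
    (hF : ∀ i j, ¬ G.Adj i j → F i j = 0) :
    ∑ e : Edge G, F e.1.1 e.1.2 = ∑ i, ∑ j, if i < j then F i j else 0 := by
  classical
  rw [← Finset.sum_subtype (Finset.univ.filter fun p : Fin N × Fin N => p.1 < p.2 ∧ G.Adj p.1 p.2)
    (by simp) (fun p => F p.1 p.2), Finset.sum_filter, Fintype.sum_prod_type]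
  refine Finset.sum_congr rfl fun i _ => Finset.sum_congr rfl fun j _ => ?_
  by_cases h1 : i < j <;> by_cases h2 : G.Adj i j <;> simp [h1, h2, hF]

/-- `Vᵀ V = L`. -/
lemma incidenceTransposeMul_incidenceMul (hw : IsWeighting G w) (lam : Fin N → Vec m) (i : Fin N) :
    incidenceTransposeMul G w (incidenceMul G w lam) i = ∑ j, w i j • (lam i - lam j) := by
  set F : Fin N → Fin N → Vec m := fun a b =>
    (if i = a then w a b • (lam i - lam b) else 0) + (if i = b then w a b • (lam i - lam a) else 0)
    with hF
  have h1 : ∀ e : Edge G, incidence G w e i • incidenceMul G w lam e = F e.1.1 e.1.2 := by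
    intro e
    have hne : e.1.1 ≠ e.1.2 := e.2.1.ne
    have hs : √(w e.1.1 e.1.2) * √(w e.1.1 e.1.2) = w e.1.1 e.1.2 :=
      Real.mul_self_sqrt (hw.nonneg _ _)
    rw [incidenceMul_apply, incidence_apply, smul_smul]
    simp only [hF]
    by_cases ha : i = e.1.1
    · subst ha; simp [hne, hs]
    · by_cases hb : i = e.1.2
      · subst hb
        simp only [hne.symm, if_false, if_true, zero_sub, neg_mul, hs, zero_add]
        module
      · simp [ha, hb]
  rw [incidenceTransposeMul, Finset.sum_congr rfl fun e _ => h1 e, sum_edge]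
  · have h2 : ∀ a b, (if a < b then F a b else 0) =
        (if i = a then (if a < b then w a b • (lam i - lam b) else 0) else 0) +
        (if i = b then (if a < b then w a b • (lam i - lam a) else 0) else 0) := by
      intro a b
      by_cases hab : a < b <;> simp [hF, hab]
    simp only [h2, Finset.sum_add_distrib]
    rw [Finset.sum_comm]
    simp only [Finset.sum_ite_eq, Finset.mem_univ, if_true]
    rw [← Finset.sum_add_distrib]
    refine Finset.sum_congr rfl fun j _ => ?_
    -- Each neighbour `j` contributes once, through the edge whose orientation is decided by the
    -- order of `i` and `j`; symmetry of `w` makes both cases equal.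
    rcases lt_trichotomy i j with h | h | h
    · simp [h, h.not_gt]
    · subst h; simp
    · simp [h, h.not_gt, hw.comm j i]
  · intro a b hab
    simp [hF, hw.zero a b hab]

lemma sum_incidenceTransposeMul (v : Edge G → Vec m) :
    ∑ i, incidenceTransposeMul G w v i = 0 := by
  simp only [incidenceTransposeMul]
  rw [Finset.sum_comm]
  refine Finset.sum_eq_zero fun e _ => ?_
  rw [← Finset.sum_smul]
  simp [incidence_apply]

lemma sum_inner_incidenceTransposeMul (lam : Fin N → Vec m) (v : Edge G → Vec m) :
    ∑ i, inner ℝ (lam i) (incidenceTransposeMul G w v i)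
      = ∑ e, inner ℝ (incidenceMul G w lam e) (v e) := by
  simp only [incidenceTransposeMul, incidenceMul, inner_sum, sum_inner, inner_smul_left,
    inner_smul_right, conj_trivial]
  rw [Finset.sum_comm]

variable (G w) in
/-- `Vᵀ ⊗ I_m` as a linear map. -/
def incidenceTransposeLin (m : ℕ) : (Edge G → Vec m) →ₗ[ℝ] (Fin N → Vec m) where
  toFun := incidenceTransposeMul G w
  map_add' u v := by
    ext i : 1
    simp [incidenceTransposeMul, smul_add, Finset.sum_add_distrib]
  map_smul' a v := by
    ext i : 1
    simp only [incidenceTransposeMul, Pi.smul_apply, RingHom.id_apply, Finset.smul_sum]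
    exact Finset.sum_congr rfl fun e _ => smul_comm _ _ _

@[simp] lemma incidenceTransposeLin_apply (v : Edge G → Vec m) :
    incidenceTransposeLin G w m v = incidenceTransposeMul G w v := rfl

/-- Loading the one edge between `i` and `j` with `u` divided by the square root of its weight
produces `u` at one end and `-u` at the other. -/
lemma single_sub_single_mem_range (hw : IsWeighting G w) {i j : Fin N} (hij : G.Adj i j)
    (u : Vec m) :
    (Pi.single i u - Pi.single j u : Fin N → Vec m) ∈ (incidenceTransposeLin G w m).range := by
  classical
  wlog h : i < j generalizing i j
  · have hlt : j < i := lt_of_le_of_ne (not_lt.1 h) hij.ne'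
    have := this hij.symm hlt
    rw [← neg_sub]
    exact Submodule.neg_mem _ this
  have hpos : √(w i j) ≠ 0 := (Real.sqrt_pos.2 (hw.pos i j hij)).ne'
  refine ⟨Pi.single ⟨(i, j), h, hij⟩ ((√(w i j))⁻¹ • u), ?_⟩
  ext l : 1
  rw [incidenceTransposeLin_apply, incidenceTransposeMul,
    Finset.sum_eq_single (⟨(i, j), h, hij⟩ : Edge G)]
  · rw [Pi.single_eq_same, incidence_apply, smul_smul, Pi.sub_apply]
    by_cases h1 : l = i
    · subst h1; simp [h.ne, hpos]
    · by_cases h2 : l = j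
      · subst h2; simp [h1, hpos]
      · simp [h1, h2]
  · intro e _ he
    rw [Pi.single_eq_of_ne he, smul_zero]
  · intro h; exact absurd (Finset.mem_univ _) h

/-- For a connected graph, the range of `Vᵀ ⊗ I_m` is the space of vectors with zero sum. -/
lemma mem_range_incidenceTransposeLin (hG : G.Connected) (hw : IsWeighting G w)
    {z : Fin N → Vec m} (hz : ∑ i, z i = 0) : z ∈ (incidenceTransposeLin G w m).range := by
  obtain ⟨i₀⟩ := hG.nonempty
  -- Along a walk from `i` to `i₀` the edge differences telescope.
  have key : ∀ (i : Fin N) (u : Vec m),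
      (Pi.single i u - Pi.single i₀ u : Fin N → Vec m) ∈ (incidenceTransposeLin G w m).range := by
    intro i u
    obtain ⟨p⟩ := hG.preconnected i i₀
    induction p with
    | nil => simp
    | cons hadj _ ih =>
      have := Submodule.add_mem _ (single_sub_single_mem_range (m := m) hw hadj u) ih
      simpa using this
  have h1 : z = ∑ i, (Pi.single i (z i) - Pi.single i₀ (z i) : Fin N → Vec m) := by
    rw [Finset.sum_sub_distrib, Finset.univ_sum_single]
    have : ∑ i, (Pi.single i₀ (z i) : Fin N → Vec m) = Pi.single i₀ (∑ i, z i) :=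
      (map_sum (AddMonoidHom.single (fun _ : Fin N => Vec m) i₀) _ _).symm
    rw [this, hz, Pi.single_zero, sub_zero]
  rw [h1]
  exact Submodule.sum_mem _ fun i _ => key i (z i)

/-- A linear choice of edge variables for given `z`. Linearity makes the initial energy a
continuous, hence measurable, function of the initial state. -/
lemma exists_incidenceTranspose_rightInverse (hG : G.Connected) (hw : IsWeighting G w) (m : ℕ) :
    ∃ T : (Fin N → Vec m) →ₗ[ℝ] (Edge G → Vec m),
      ∀ z, ∑ i, z i = 0 → incidenceTransposeMul G w (T z) = z := by
  obtain ⟨T, hT⟩ := (incidenceTransposeLin G w m).rangeRestrict.exists_rightInverse_of_surjective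
    (LinearMap.range_rangeRestrict _)
  obtain ⟨T', hT'⟩ := T.exists_extend
  refine ⟨T', fun z hz => ?_⟩
  have hmem := mem_range_incidenceTransposeLin hG hw hz
  have h1 : T' z = T ⟨z, hmem⟩ := by rw [← hT']; rfl
  have h2 := congrArg Subtype.val (LinearMap.congr_fun hT ⟨z, hmem⟩)
  rw [h1]
  exact h2

/-! ### Spectral gap -/

lemma laplacian_mulVec (y : Fin N → ℝ) (i : Fin N) :
    (laplacian w).mulVec y i = ∑ j, w i j * (y i - y j) := by
  rw [laplacian, Matrix.sub_mulVec, Pi.sub_apply, Matrix.mulVec_diagonal]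
  simp only [Matrix.mulVec, dotProduct, mul_sub, Finset.sum_sub_distrib, Finset.sum_mul]

/-- Symmetrize the double sum in `i` and `j`, using `w i j = w j i`. -/
lemma sum_inner_laplacian {E : Type*} [NormedAddCommGroup E] [InnerProductSpace ℝ E]
    (hw : IsWeighting G w) (y : Fin N → E) :
    ∑ i, inner ℝ (y i) (∑ j, w i j • (y i - y j)) = 2⁻¹ * ∑ i, ∑ j, w i j * ‖y i - y j‖ ^ 2 := by
  have h1 : ∑ i, inner ℝ (y i) (∑ j, w i j • (y i - y j))
      = ∑ i, ∑ j, w i j * inner ℝ (y i) (y i - y j) := by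
    simp only [inner_sum, inner_smul_right]
  have h2 : ∑ i, ∑ j, w i j * inner ℝ (y i) (y i - y j)
      = ∑ i, ∑ j, w i j * inner ℝ (y j) (y j - y i) := by
    rw [Finset.sum_comm]
    exact Finset.sum_congr rfl fun i _ => Finset.sum_congr rfl fun j _ => by rw [hw.comm j i]
  have h3 : ∑ i, ∑ j, w i j * ‖y i - y j‖ ^ 2 = ∑ i, ∑ j, w i j * inner ℝ (y i) (y i - y j)
      + ∑ i, ∑ j, w i j * inner ℝ (y j) (y j - y i) := by
    simp only [← Finset.sum_add_distrib, ← mul_add]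
    refine Finset.sum_congr rfl fun i _ => Finset.sum_congr rfl fun j _ => ?_
    rw [← real_inner_self_eq_norm_sq]
    simp only [inner_sub_left, inner_sub_right]
    ring
  rw [h1, h3, ← h2]; ring

/-- The Dirichlet energy of `y` vanishes, so `y` is constant across every edge and therefore along
every walk. -/
lemma eq_of_laplacian_mulVec_eq_zero (hG : G.Connected) (hw : IsWeighting G w) {y : Fin N → ℝ}
    (hy : (laplacian w).mulVec y = 0) (i j : Fin N) : y i = y j := by
  have h1 := sum_inner_laplacian hw y
  have h2 : ∀ i, ∑ j, w i j • (y i - y j) = 0 := fun i => by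
    simpa [laplacian_mulVec] using congrFun hy i
  simp only [h2, inner_zero_right, Finset.sum_const_zero] at h1
  have hnn : ∀ i j, 0 ≤ w i j * ‖y i - y j‖ ^ 2 := fun i j =>
    mul_nonneg (hw.nonneg i j) (sq_nonneg _)
  have h3 : ∑ i, ∑ j, w i j * ‖y i - y j‖ ^ 2 = 0 := by linarith
  have hadj : ∀ i j, G.Adj i j → y i = y j := by
    intro i j hij
    rw [Finset.sum_eq_zero_iff_of_nonneg fun i _ => Finset.sum_nonneg fun j _ => hnn i j] at h3
    have h4 := h3 i (Finset.mem_univ i)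
    rw [Finset.sum_eq_zero_iff_of_nonneg fun j _ => hnn i j] at h4
    have h5 := h4 j (Finset.mem_univ j)
    have h6 : ‖y i - y j‖ ^ 2 = 0 := (mul_eq_zero.1 h5).resolve_left (hw.pos i j hij).ne'
    exact sub_eq_zero.1 (norm_eq_zero.1 ((pow_eq_zero_iff two_ne_zero).1 h6))
  obtain ⟨p⟩ := hG.preconnected i j
  induction p with
  | nil => rfl
  | cons h _ ih => exact (hadj _ _ h).trans ih

lemma laplacian_isHermitian (hw : IsWeighting G w) : (laplacian w).IsHermitian := by
  refine Matrix.IsHermitian.ext fun i j => ?_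
  simp only [laplacian, Matrix.sub_apply, star_trivial, hw.comm j i]
  by_cases h : i = j
  · subst h; rfl
  · rw [Matrix.diagonal_apply_ne _ h, Matrix.diagonal_apply_ne _ (Ne.symm h)]

/-- If `K < c μ` for all nonzero eigenvalues `μ` of the Laplacian, then `c L` is bounded below on
the zero-sum vectors by some `K' > K`. -/
lemma exists_spectral_gap (hG : G.Connected) (hw : IsWeighting G w) {c K : ℝ}
    (hc : ∀ μ : ℝ, μ ≠ 0 → Module.End.HasEigenvalue (Matrix.toLin' (laplacian w)) μ → K < c * μ) :
    ∃ K', K < K' ∧ ∀ y : Fin N → ℝ, ∑ i, y i = 0 →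
      K' * ∑ i, y i ^ 2 ≤ c * ∑ i, y i * ∑ j, w i j * (y i - y j) := by
  have hL := laplacian_isHermitian hw
  set b := hL.eigenvectorBasis with hb
  set μ := hL.eigenvalues with hμ
  have heig : ∀ k, Module.End.HasEigenvalue (Matrix.toLin' (laplacian w)) (μ k) := by
    intro k
    refine Module.End.hasEigenvalue_of_hasEigenvector (x := ⇑(b k)) ⟨?_, ?_⟩
    · rw [Module.End.mem_eigenspace_iff, Matrix.toLin'_apply]
      exact hL.mulVec_eigenvectorBasis k
    · intro h
      have h1 : b k = 0 := by ext i; exact congrFun h i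
      have h2 := b.orthonormal.1 k
      rw [h1, norm_zero] at h2
      exact zero_ne_one h2
  -- There are finitely many eigenvalues, so the strict inequalities leave common room for some `K'
  -- > K`; without nonzero eigenvalues any such `K'` will do.
  obtain ⟨K', hK', hK⟩ : ∃ K', (∀ k, μ k ≠ 0 → K' ≤ c * μ k) ∧ K < K' := by
    have h1 : ∀ᶠ K' in 𝓝[>] K, ∀ k, μ k ≠ 0 → K' ≤ c * μ k := by
      rw [eventually_all]
      intro k
      by_cases hk : μ k = 0
      · exact Eventually.of_forall fun _ h => absurd hk h
      · filter_upwards [Ioc_mem_nhdsGT (hc _ hk (heig k))] with t ht _ using ht.2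
    exact (h1.and self_mem_nhdsWithin).exists
  refine ⟨K', hK, fun y hy => ?_⟩
  set Y : Vec N := WithLp.toLp 2 y with hY
  set LY : Vec N := WithLp.toLp 2 ((laplacian w).mulVec y) with hLY
  have h1 : ∑ i, y i ^ 2 = ∑ k, inner ℝ Y (b k) * inner ℝ (b k) Y := by
    rw [b.sum_inner_mul_inner, PiLp.inner_apply]
    exact Finset.sum_congr rfl fun i _ => by simp [hY, sq]
  have h2 : ∑ i, y i * ∑ j, w i j * (y i - y j) = ∑ k, inner ℝ Y (b k) * inner ℝ (b k) LY := by
    rw [b.sum_inner_mul_inner, PiLp.inner_apply]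
    refine Finset.sum_congr rfl fun i _ => ?_
    simp [hY, hLY, laplacian_mulVec, mul_comm]
  have h3 : ∀ k, inner ℝ (b k) LY = μ k * inner ℝ (b k) Y := by
    intro k
    have e1 : inner ℝ (b k) LY = (⇑(b k)) ⬝ᵥ ((laplacian w).mulVec y) := by
      rw [PiLp.inner_apply, dotProduct]
      exact Finset.sum_congr rfl fun i _ => by simp [hLY, mul_comm]
    have e2 : inner ℝ (b k) Y = (⇑(b k)) ⬝ᵥ y := by
      rw [PiLp.inner_apply, dotProduct]
      exact Finset.sum_congr rfl fun i _ => by simp [hY, mul_comm]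
    have hT : (laplacian w).transpose = laplacian w := by
      have := hL.eq
      rwa [Matrix.conjTranspose_eq_transpose_of_trivial] at this
    rw [e1, e2, Matrix.dotProduct_mulVec, ← Matrix.mulVec_transpose, hT,
      hL.mulVec_eigenvectorBasis k, smul_dotProduct, smul_eq_mul]
  rw [h1, h2, Finset.mul_sum, Finset.mul_sum]
  refine Finset.sum_le_sum fun k _ => ?_
  rw [h3, real_inner_comm (b k) Y]
  -- A kernel eigenvector is constant, hence orthogonal to the zero-sum vector `y`; all other modes
  -- satisfy the bound by the choice of `K'`.
  by_cases hk : μ k = 0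
  · have hconst : ∀ i j, b k i = b k j := by
      refine eq_of_laplacian_mulVec_eq_zero hG hw (y := ⇑(b k)) ?_
      rw [hL.mulVec_eigenvectorBasis k, ← hμ, hk, zero_smul]
    obtain ⟨i₀⟩ := hG.nonempty
    have h0 : inner ℝ (b k) Y = 0 := by
      rw [PiLp.inner_apply]
      have : ∀ i, inner ℝ (b k i) (Y i) = b k i₀ * y i := fun i => by
        rw [hconst i i₀]; simp [hY, mul_comm]
      rw [Finset.sum_congr rfl fun i _ => this i, ← Finset.mul_sum, hy, mul_zero]
    rw [h0]; simp
  · have := mul_le_mul_of_nonneg_right (hK' k hk) (mul_self_nonneg (inner ℝ (b k) Y))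
    linarith

end Graph

/-! ### Communication and the change of variables -/

section Communication

variable {N m d : ℕ} (Γ : Game N m d) {w : Matrix (Fin N) (Fin N) ℝ} (p : Params N)
  {G : SimpleGraph (Fin N)}

/-- Weights vanish off the neighbourhood, so the network sums see only neighbours. New variables
that enter an update, namely `z'` and the new decision in the multiplier step, are the agent's own.
-/
lemma oneRound (hw : IsWeighting G w) : OneRound Γ w p G := by
  intro S S' s s' i hS hx hz hl hadj
  have h1 : ∑ j, w i j • (s'.xhat i - s.xhat j) = ∑ j, w i j • (s'.xhat i - s'.xhat j) := by
    refine Finset.sum_congr rfl fun j _ => ?_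
    by_cases h : G.Adj i j
    · rw [(hadj j h).1]
    · rw [hw.zero i j h, zero_smul, zero_smul]
  have h2 : ∑ j, w i j • (s'.lam i - s.lam j) = ∑ j, w i j • (s'.lam i - s'.lam j) := by
    refine Finset.sum_congr rfl fun j _ => ?_
    by_cases h : G.Adj i j
    · rw [(hadj j h).2]
    · rw [hw.zero i j h, zero_smul, zero_smul]
  have h3 : ∑ j, w i j • (s'.xhat i i - s.xhat j i) =
      ∑ j, w i j • (s'.xhat i i - s'.xhat j i) := by
    refine Finset.sum_congr rfl fun j _ => ?_
    by_cases h : G.Adj i j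
    · rw [(hadj j h).1]
    · rw [hw.zero i j h, zero_smul, zero_smul]
  have h4 : nextDecision Γ w p S s.xhat s.lam i = nextDecision Γ w p S' s'.xhat s'.lam i := by
    simp only [nextDecision, h3, hx, hl, hS]
  have h5 : (step Γ w p S s).xhat i = (step Γ w p S' s').xhat i := by
    simp only [step, nextEstimates, h1, h4, hx]
  refine ⟨h5, ?_, ?_⟩
  · simp only [step, h2, hz, hl]
  · simp only [step] at h5 ⊢
    simp only [h5, h2, hz, hl, hx]

/-- The state of the algorithm that corresponds to a state with edge variables. -/
def EdgeState.toState {n : Fin N → ℕ} (w : Matrix (Fin N) (Fin N) ℝ) (u : EdgeState n m G) :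
    State n m := ⟨u.xhat, incidenceTransposeMul G w u.v, u.lam⟩

/-- Applying `Vᵀ` to the edge update turns `Vᵀ V λ` into the Laplacian sum, and `Vᵀ (2 v' - v)` into
`2 z' - z`: the map `v ↦ Vᵀ v` intertwines the two iterations. -/
lemma toState_edgeStep (hw : IsWeighting G w) (S : Oracle Γ.n) (u : EdgeState Γ.n m G) :
    (edgeStep Γ w p G S u).toState w = step Γ w p S (u.toState w) := by
  have h1 : incidenceTransposeMul G w (u.v + p.ν • incidenceMul G w u.lam) =
      fun i => incidenceTransposeMul G w u.v i + p.ν • ∑ j, w i j • (u.lam i - u.lam j) := by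
    ext i : 1
    rw [← incidenceTransposeLin_apply, map_add, map_smul]
    simp [incidenceTransposeMul_incidenceMul hw]
  ext1
  · rfl
  · exact h1
  · ext i : 1
    simp only [EdgeState.toState, edgeStep, step]
    congr 4
    rw [← incidenceTransposeLin_apply, map_sub, map_smul, incidenceTransposeLin_apply, h1]
    simp only [Pi.sub_apply, Pi.smul_apply, incidenceTransposeLin_apply]
    abel

/-- Forwards, lift `z⁰` to some `v⁰` by connectedness and iterate the intertwining. Backwards,
everything in the range of `Vᵀ` has zero sum. -/
lemma changeOfVariables (hG : G.Connected) (hw : IsWeighting G w) :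
    ChangeOfVariables Γ w p G := by
  intro S s
  constructor
  · rintro ⟨hs, hz⟩
    obtain ⟨v₀, hv₀⟩ := mem_range_incidenceTransposeLin hG hw hz
    let u : ℕ → EdgeState Γ.n m G := fun k =>
      Nat.rec ⟨(s 0).xhat, v₀, (s 0).lam⟩ (fun k u => edgeStep Γ w p G (S k) u) k
    have hu : ∀ k, (u k).toState w = s k := by
      intro k
      induction k with
      | zero =>
        ext1
        · rfl
        · exact hv₀
        · rfl
      | succ k ih => rw [hs k, ← ih]; exact toState_edgeStep Γ p hw (S k) (u k)
    refine ⟨u, fun k => rfl, fun k => ?_⟩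
    rw [← hu k]
    exact ⟨rfl, rfl, rfl⟩
  · rintro ⟨u, hu, hus⟩
    have hs : ∀ k, s k = (u k).toState w := fun k =>
      State.ext (hus k).1 (hus k).2.2 (hus k).2.1
    refine ⟨fun k => ?_, ?_⟩
    · rw [hs, hs, hu, toState_edgeStep Γ p hw]
    · rw [hs]; exact sum_incidenceTransposeMul _

end Communication

/-! ### Restricted strong monotonicity -/

section Monotone

variable {N : ℕ} {n : Fin N → ℕ}

/-- The `i`-th block `∑ w_ij (X_i - X_j)` of the Laplacian applied to the estimates. -/
def lapAt (w : Matrix (Fin N) (Fin N) ℝ) (X : Estimates n) (i : Fin N) : Profile n :=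
  ∑ j, w i j • (X i - X j)

/-- All agents hold the same estimate `x`. -/
def consensus (x : Profile n) : Estimates n := WithLp.toLp 2 fun _ => x

@[simp] lemma consensus_apply (x : Profile n) (i : Fin N) : consensus x i = x := rfl

@[simp] lemma decisions_apply (X : Estimates n) (i : Fin N) : decisions X i = X i i := rfl

lemma lapAt_apply (w : Matrix (Fin N) (Fin N) ℝ) (X : Estimates n) (i l : Fin N) :
    lapAt w X i l = ∑ j, w i j • (X i l - X j l) := by
  simp [lapAt]

lemma lapAt_sub_consensus (w : Matrix (Fin N) (Fin N) ℝ) (X : Estimates n) (x : Profile n)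
    (i : Fin N) : lapAt w (X - consensus x) i = lapAt w X i := by
  simp [lapAt]

lemma sum_lapAt {w : Matrix (Fin N) (Fin N) ℝ} (hw : w.IsSymm) (X : Estimates n) :
    ∑ i, lapAt w X i = 0 := by
  simp only [lapAt, smul_sub, Finset.sum_sub_distrib]
  rw [sub_eq_zero, Finset.sum_comm]
  exact Finset.sum_congr rfl fun i _ => Finset.sum_congr rfl fun j _ => by rw [hw.apply i j]

/-- The Laplacian as a linear map of the stacked estimates. -/
def lapLin (w : Matrix (Fin N) (Fin N) ℝ) (n : Fin N → ℕ) : Estimates n →ₗ[ℝ] Estimates n where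
  toFun X := WithLp.toLp 2 (lapAt w X)
  map_add' X Y := by
    ext i : 1
    simp only [lapAt, PiLp.add_apply, ← Finset.sum_add_distrib, ← smul_add]
    exact Finset.sum_congr rfl fun j _ => by rw [add_sub_add_comm]
  map_smul' a X := by
    ext i : 1
    simp only [lapAt, PiLp.smul_apply, Finset.smul_sum, RingHom.id_apply]
    exact Finset.sum_congr rfl fun j _ => by rw [← smul_sub, smul_comm]

lemma exists_lapLin_bound (w : Matrix (Fin N) (Fin N) ℝ) (n : Fin N → ℕ) :
    ∃ C, 0 ≤ C ∧ ∀ X : Estimates n, ‖lapLin w n X‖ ≤ C * ‖X‖ :=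
  ⟨‖(lapLin w n).toContinuousLinearMap‖, norm_nonneg _,
    fun X => (lapLin w n).toContinuousLinearMap.le_opNorm X⟩

lemma norm_decisions_le (X : Estimates n) : ‖decisions X‖ ≤ ‖X‖ := by
  refine abs_le_of_sq_le_sq' ?_ (norm_nonneg _) |>.2
  rw [PiLp.norm_sq_eq_of_L2, PiLp.norm_sq_eq_of_L2]
  refine Finset.sum_le_sum fun i _ => ?_
  exact pow_le_pow_left₀ (norm_nonneg _) (PiLp.norm_apply_le (X i) i) 2

/-- The Laplacian acts separately on each scalar coordinate of the estimates, so the scalar gap is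
applied to each coordinate and summed. -/
lemma spectral_gap_estimates {w : Matrix (Fin N) (Fin N) ℝ} {c K : ℝ}
    (hgap : ∀ y : Fin N → ℝ, ∑ i, y i = 0 →
      K * ∑ i, y i ^ 2 ≤ c * ∑ i, y i * ∑ j, w i j * (y i - y j))
    (X : Estimates n) (hX : ∑ i, X i = 0) :
    K * ‖X‖ ^ 2 ≤ c * ∑ i, inner ℝ (X i) (lapAt w X i) := by
  have h1 : ‖X‖ ^ 2 = ∑ l, ∑ r, ∑ i, X i l r ^ 2 := by
    rw [PiLp.norm_sq_eq_of_L2]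
    simp_rw [PiLp.norm_sq_eq_of_L2]
    rw [Finset.sum_comm]
    refine Finset.sum_congr rfl fun l _ => ?_
    rw [Finset.sum_comm]
    simp
  have h2 : ∑ i, inner ℝ (X i) (lapAt w X i)
      = ∑ l, ∑ r, ∑ i, X i l r * ∑ j, w i j * (X i l r - X j l r) := by
    simp_rw [PiLp.inner_apply, lapAt_apply]
    rw [Finset.sum_comm]
    refine Finset.sum_congr rfl fun l _ => ?_
    rw [Finset.sum_comm]
    refine Finset.sum_congr rfl fun r _ => Finset.sum_congr rfl fun i _ => ?_
    simp [mul_comm]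
  rw [h1, h2, Finset.mul_sum, Finset.mul_sum]
  refine Finset.sum_le_sum fun l _ => ?_
  rw [Finset.mul_sum, Finset.mul_sum]
  refine Finset.sum_le_sum fun r _ => hgap _ ?_
  have := congrArg (fun x : Profile n => x l r) hX
  simpa using this

variable {m d : ℕ} {Γ : Game N m d} {D : ∀ i, Set (Vec (Γ.n i))} {η ℓF ℓp c K : ℝ}
  {w : Matrix (Fin N) (Fin N) ℝ}

/-- `S ^ 2 < 4 η K` is positive definiteness. Completing the square in the two possible ways leaves
a margin in `a` and a margin in `b`; averaging the two bounds explains the factor `1 / 2` in `μ`. -/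
lemma exists_quadratic_bound {η S K : ℝ} (hη : 0 < η) (hK : S ^ 2 / (4 * η) < K) :
    ∃ μ, 0 < μ ∧ ∀ a b : ℝ, μ * (a ^ 2 + b ^ 2) ≤ η * a ^ 2 - S * (a * b) + K * b ^ 2 := by
  have hK0 : 0 < K := lt_of_le_of_lt (by positivity) hK
  have hq : S ^ 2 / (4 * K) < η := by
    rw [div_lt_iff₀ (by positivity)] at hK ⊢
    linarith
  have key : ∀ a b : ℝ, S * (a * b) ≤ S ^ 2 / (4 * K) * a ^ 2 + K * b ^ 2 ∧
      S * (a * b) ≤ η * a ^ 2 + S ^ 2 / (4 * η) * b ^ 2 := by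
    intro a b
    constructor
    · have h : S ^ 2 / (4 * K) * a ^ 2 + K * b ^ 2 - S * (a * b)
          = (S * a - 2 * K * b) ^ 2 / (4 * K) := by field_simp; ring
      rw [← sub_nonneg, h]; positivity
    · have h : η * a ^ 2 + S ^ 2 / (4 * η) * b ^ 2 - S * (a * b)
          = (S * b - 2 * η * a) ^ 2 / (4 * η) := by field_simp; ring
      rw [← sub_nonneg, h]; positivity
  generalize S ^ 2 / (4 * K) = p at hq key
  generalize S ^ 2 / (4 * η) = q at hK key
  refine ⟨min (η - p) (K - q) / 2, half_pos (lt_min (sub_pos.2 hq) (sub_pos.2 hK)),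
    fun a b => ?_⟩
  obtain ⟨h1, h2⟩ := key a b
  have h3 := mul_le_mul_of_nonneg_right (min_le_left (η - p) (K - q)) (sq_nonneg a)
  have h4 := mul_le_mul_of_nonneg_right (min_le_right (η - p) (K - q)) (sq_nonneg b)
  linarith

/-- The extended pseudogradient plus a sufficiently large multiple of the Laplacian is strongly
monotone with respect to the consensus points. -/
lemma exists_restricted_strong_monotone [NeZero N] (hw : w.IsSymm)
    (hΓ : Γ.Assumptions D η ℓF) (hℓp : 0 < ℓp) (hFp : Γ.ExtLipschitz D ℓp)
    (hK : (ℓp + ℓF) ^ 2 / (4 * η) + ℓp < K)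
    (hgap : ∀ y : Fin N → ℝ, ∑ i, y i = 0 →
      K * ∑ i, y i ^ 2 ≤ c * ∑ i, y i * ∑ j, w i j * (y i - y j)) :
    ∃ μ, 0 < μ ∧ ∀ X : Estimates Γ.n, (∀ i, X i ∈ Γ.box D) → ∀ x ∈ Γ.box D,
      μ * ‖X - consensus x‖ ^ 2 ≤
        inner ℝ (Γ.extPseudograd X - Γ.pseudograd x) (decisions X - x)
          + c * ∑ i, inner ℝ (lapAt w X i) (X i - x) := by
  obtain ⟨μ, hμ, hquad⟩ := exists_quadratic_bound (K := K - ℓp) hΓ.η_pos (lt_sub_iff_add_lt.2 hK)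
  clear hK
  have hN : (0 : ℝ) < N := Nat.cast_pos.2 (Nat.pos_of_neZero N)
  have hN1 : (1 : ℝ) ≤ N := Nat.one_le_cast.2 (Nat.pos_of_neZero N)
  refine ⟨μ / N, by positivity, fun X hX x hx => ?_⟩
  -- The average of the estimates lies in `D` by convexity, so monotonicity of the pseudogradient
  -- applies at `xb`; the disagreement `e` is orthogonal to all consensus vectors.
  set xb : Profile Γ.n := ∑ i, (N : ℝ)⁻¹ • X i with hxb
  have hxbD : xb ∈ Γ.box D :=
    (Γ.convex_box hΓ.D_convex).sum_mem (fun i _ => by positivity)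
      (by simp [hN.ne']) (fun i _ => hX i)
  set e : Estimates Γ.n := X - consensus xb with he
  have hesum : ∑ i, e i = 0 := by
    have : ∑ i, e i = ∑ i, X i - (N : ℝ) • xb := by
      simp [he, Finset.sum_sub_distrib, Nat.cast_smul_eq_nsmul]
    rw [this, hxb, ← Finset.smul_sum, smul_smul, mul_inv_cancel₀ hN.ne', one_smul, sub_self]
  have hcons : ‖consensus xb - consensus x‖ ^ 2 = N * ‖xb - x‖ ^ 2 := by
    rw [PiLp.norm_sq_eq_of_L2]; simp
  have hdecomp : ‖X - consensus x‖ ^ 2 = ‖e‖ ^ 2 + N * ‖xb - x‖ ^ 2 := by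
    have h1 : X - consensus x = e + (consensus xb - consensus x) := by rw [he]; abel
    have h2 : inner ℝ e (consensus xb - consensus x) = 0 := by
      rw [PiLp.inner_apply]
      simp only [PiLp.sub_apply, consensus_apply]
      rw [← sum_inner, hesum, inner_zero_left]
    rw [h1, norm_add_sq_real, h2, hcons]; ring
  have hlap : ∑ i, inner ℝ (lapAt w X i) (X i - x) = ∑ i, inner ℝ (e i) (lapAt w e i) := by
    have h1 : ∀ i, lapAt w e i = lapAt w X i := fun i => lapAt_sub_consensus w X xb i
    have h2 : ∀ i, X i - x = e i + (xb - x) := fun i => by simp [he]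
    simp only [h1, h2, inner_add_right, Finset.sum_add_distrib]
    rw [← sum_inner, sum_lapAt hw, inner_zero_left, add_zero]
    exact Finset.sum_congr rfl fun i _ => real_inner_comm _ _
  have hgap' := spectral_gap_estimates hgap e hesum
  set a := ‖xb - x‖
  set b := ‖e‖
  have ha : 0 ≤ a := norm_nonneg _
  have hb : 0 ≤ b := norm_nonneg _
  -- With `a = ‖xb - x‖` and `b = ‖e‖`, the four products are at least `η a²`, `-ℓF a b`, `-ℓp a b`
  -- and `-ℓp b²`. The last one is why the hypothesis on `K` carries the extra `ℓp`.
  have hsplit : Γ.extPseudograd X - Γ.pseudograd x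
      = (Γ.extPseudograd X - Γ.extPseudograd (consensus xb))
        + (Γ.pseudograd xb - Γ.pseudograd x) := by
    have : Γ.extPseudograd (consensus xb) = Γ.pseudograd xb := rfl
    rw [this]; abel
  have hsplit' : decisions X - x = decisions e + (xb - x) := by
    ext i : 1
    simp [he]
  have hdec : ‖decisions e‖ ≤ b := norm_decisions_le e
  have hF1 : ‖Γ.extPseudograd X - Γ.extPseudograd (consensus xb)‖ ≤ ℓp * b :=
    hFp X (consensus xb) hX (fun _ => hxbD)
  have hF2 := hΓ.lipschitz xb hxbD x hx
  have hF3 := hΓ.strongly_monotone xb hxbD x hx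
  rw [hsplit, hsplit', hlap]
  set P := Γ.extPseudograd X - Γ.extPseudograd (consensus xb)
  set Q := Γ.pseudograd xb - Γ.pseudograd x
  have i1 : -(ℓp * b * b) ≤ inner ℝ P (decisions e) := by
    have h1 := abs_le.1 (abs_real_inner_le_norm P (decisions e))
    have h2 := mul_le_mul hF1 hdec (norm_nonneg _) (by positivity)
    linarith
  have i2 : -(ℓp * b * a) ≤ inner ℝ P (xb - x) := by
    have h1 := abs_le.1 (abs_real_inner_le_norm P (xb - x))
    have h2 := mul_le_mul_of_nonneg_right hF1 ha
    linarith
  have i3 : -(ℓF * a * b) ≤ inner ℝ Q (decisions e) := by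
    have h1 := abs_le.1 (abs_real_inner_le_norm Q (decisions e))
    have h2 := mul_le_mul hF2 hdec (norm_nonneg _) (mul_nonneg hΓ.ℓF_pos.le ha)
    linarith
  have h4 := hquad a b
  -- The squared distance to consensus is `b² + N a²`, since the deviation of the average is
  -- repeated `N` times; hence the division by `N`.
  have h5 : μ / N * ‖X - consensus x‖ ^ 2 ≤ μ * (a ^ 2 + b ^ 2) := by
    rw [hdecomp, div_mul_eq_mul_div, div_le_iff₀ hN]
    nlinarith [mul_nonneg hμ.le (sq_nonneg b), mul_nonneg (mul_nonneg hμ.le (sq_nonneg b))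
      (sub_nonneg.2 hN1)]
  refine h5.trans ?_
  clear h5
  simp only [inner_add_left, inner_add_right]
  linarith

/-- The Laplacian annihilates `consensus x`, where the extended pseudogradient is `F(x)`; relative
to that point the forward operator therefore grows at rate at most `ℓp + c C`. This handles the
displacement between successive iterates. -/
lemma inner_extPseudograd_add_lapAt_le (hFp : Γ.ExtLipschitz D ℓp)
    (hℓp : 0 < ℓp) (hc : 0 < c) {C : ℝ} (hC : ∀ X : Estimates Γ.n, ‖lapLin w Γ.n X‖ ≤ C * ‖X‖)
    {X : Estimates Γ.n} (hX : ∀ i, X i ∈ Γ.box D) {x : Profile Γ.n} (hx : x ∈ Γ.box D)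
    (Y : Estimates Γ.n) :
    -((ℓp + c * C) * ‖X - consensus x‖ * ‖Y‖) ≤
      inner ℝ (Γ.extPseudograd X - Γ.pseudograd x) (decisions Y)
        + c * ∑ i, inner ℝ (lapAt w X i) (Y i) := by
  have h1 : ‖Γ.extPseudograd X - Γ.pseudograd x‖ ≤ ℓp * ‖X - consensus x‖ :=
    hFp X (consensus x) hX (fun _ => hx)
  have h2 := abs_le.1 (abs_real_inner_le_norm (Γ.extPseudograd X - Γ.pseudograd x) (decisions Y))
  have h3 := mul_le_mul h1 (norm_decisions_le Y) (norm_nonneg _)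
    (mul_nonneg hℓp.le (norm_nonneg _))
  have h4 : ∑ i, inner ℝ (lapAt w X i) (Y i) = inner ℝ (lapLin w Γ.n (X - consensus x)) Y := by
    rw [PiLp.inner_apply]
    refine Finset.sum_congr rfl fun i _ => ?_
    rw [← lapAt_sub_consensus w X x i]; rfl
  have h5 := abs_le.1 (abs_real_inner_le_norm (lapLin w Γ.n (X - consensus x)) Y)
  have h6 := mul_le_mul_of_nonneg_right (hC (X - consensus x)) (norm_nonneg Y)
  rw [h4]
  have h7 : -(C * ‖X - consensus x‖ * ‖Y‖) ≤ inner ℝ (lapLin w Γ.n (X - consensus x)) Y := by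
    linarith
  have h8 := mul_le_mul_of_nonneg_left h7 hc.le
  linarith

end Monotone

/-! ### The proximal operator and the projection -/

section Prox

lemma isProx_prox {q : ℕ} {Ω : Set (Vec q)} {g : Vec q → ℝ} (hΩ : IsCompact Ω)
    (hne : Ω.Nonempty) (hg : LowerSemicontinuousOn g Ω) {α : ℝ} (hα : 0 ≤ α) (y : Vec q) :
    IsProx Ω g α y (prox Ω g α y) :=
  Classical.epsilon_spec (exists_prox_minimizer hΩ hne hg hα y)

lemma continuous_prox {q : ℕ} {Ω : Set (Vec q)} {g : Vec q → ℝ} (hΩ : IsCompact Ω)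
    (hne : Ω.Nonempty) (hg : LowerSemicontinuousOn g Ω) (hconv : ConvexOn ℝ Ω g) {α : ℝ}
    (hα : 0 ≤ α) : Continuous (prox Ω g α) := by
  have : LipschitzWith 1 (prox Ω g α) := LipschitzWith.of_dist_le_mul fun y y' => by
    rw [dist_eq_norm, dist_eq_norm, NNReal.coe_one, one_mul]
    have h := isProx_prox hΩ hne hg hα y
    have h' := isProx_prox hΩ hne hg hα y'
    exact norm_prox_sub_le hconv hα h.1 h.2 h'.1 h'.2
  exact this.continuous

lemma continuous_projNonneg {q : ℕ} : Continuous (projNonneg : Vec q → Vec q) := by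
  refine (PiLp.continuous_toLp 2 _).comp (continuous_pi fun r => ?_)
  fun_prop

lemma projNonneg_nonneg {q : ℕ} (y : Vec q) (r : Fin q) : 0 ≤ projNonneg y r := le_max_right _ _

lemma inner_sub_projNonneg_nonneg {q : ℕ} (y : Vec q) {l : Vec q} (hl : ∀ r, 0 ≤ l r) :
    0 ≤ inner ℝ (y - projNonneg y) (projNonneg y - l) := by
  rw [PiLp.inner_apply]
  refine Finset.sum_nonneg fun r _ => ?_
  simp only [PiLp.sub_apply, projNonneg, RCLike.inner_apply, conj_trivial]
  rcases le_total (y r) 0 with h | h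
  · rw [max_eq_right h]
    have := mul_nonneg (hl r) (neg_nonneg.2 h)
    linarith
  · rw [max_eq_left h]; simp

lemma inner_toEuclideanLin_transpose {q m : ℕ} (A : Matrix (Fin m) (Fin q) ℝ) (l : Vec m)
    (x : Vec q) : inner ℝ (A.transpose.toEuclideanLin l) x = inner ℝ l (A.toEuclideanLin x) := by
  have h := Matrix.toEuclideanLin_conjTranspose_eq_adjoint A
  rw [Matrix.conjTranspose_eq_transpose_of_trivial] at h
  rw [h, LinearMap.adjoint_inner_left]

end Prox

/-! ### One step of the preconditioned iteration -/

section OneStep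

variable {N m d : ℕ} {Γ : Game N m d} {w : Matrix (Fin N) (Fin N) ℝ} {p : Params N}
  {G : SimpleGraph (Fin N)}

/-- `(x, v, l)` solves the optimality system of the game with dual consensus. -/
structure IsKKT (Γ : Game N m d) (G : SimpleGraph (Fin N)) (w : Matrix (Fin N) (Fin N) ℝ)
    (x : Profile Γ.n) (v : Edge G → Vec m) (l : Vec m) : Prop where
  mem : ∀ i, x i ∈ Γ.Ω i
  nonneg : ∀ r, 0 ≤ l r
  primal : ∀ i, ∀ u ∈ Γ.Ω i, 0 ≤ inner ℝ (Γ.pseudograd x i) (u - x i)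
    + inner ℝ l ((Γ.A i).toEuclideanLin (u - x i)) + (Γ.g i u - Γ.g i (x i))
  dual : ∀ i, ∀ y : Vec m, (∀ r, 0 ≤ y r) →
    inner ℝ ((Γ.A i).toEuclideanLin (x i) - Γ.b i - incidenceTransposeMul G w v i) (y - l) ≤ 0

/-- Only the total residual `s = ∑ A_i x_i - b` has a sign and complementarity with `l`. The edge
variables redistribute it so that every agent sees the same share `s / N`. -/
lemma exists_isKKT {D : ∀ i, Set (Vec (Γ.n i))} {η ℓF : ℝ} (hΓ : Γ.Assumptions D η ℓF)
    (hG : G.Connected) (hw : IsWeighting G w) {x : Profile Γ.n} (hx : x ∈ Γ.feasible)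
    (hvi : ∀ y ∈ Γ.feasible,
      0 ≤ inner ℝ (Γ.pseudograd x) (y - x) + ∑ i, (Γ.g i (y i) - Γ.g i (x i))) :
    ∃ v l, IsKKT Γ G w x v l := by
  obtain ⟨l, hl, hcomp, hpr⟩ := hΓ.exists_multiplier hx hvi
  have := hG.nonempty
  have hN : (N : ℝ) ≠ 0 := by
    have : 0 < N := Fin.pos_iff_nonempty.2 hG.nonempty
    positivity
  set s : Vec m := Γ.coupling x - Γ.rhs with hs
  set z : Fin N → Vec m := fun i => (Γ.A i).toEuclideanLin (x i) - Γ.b i - (N : ℝ)⁻¹ • s with hz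
  have hzsum : ∑ i, z i = 0 := by
    simp only [hz, Finset.sum_sub_distrib, Finset.sum_const, Finset.card_univ, Fintype.card_fin]
    rw [← Γ.coupling_apply, ← Nat.cast_smul_eq_nsmul ℝ, smul_smul, mul_inv_cancel₀ hN, one_smul]
    exact sub_self s
  obtain ⟨v, hv⟩ := mem_range_incidenceTransposeLin hG hw hzsum
  refine ⟨v, l, hx.1, hl, hpr, fun i y hy => ?_⟩
  have h1 : (Γ.A i).toEuclideanLin (x i) - Γ.b i - incidenceTransposeMul G w v i
      = (N : ℝ)⁻¹ • s := by
    rw [← incidenceTransposeLin_apply, hv]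
    simp only [hz]
    module
  have h2 : inner ℝ s (y - l) ≤ 0 := by
    rw [PiLp.inner_apply]
    refine Finset.sum_nonpos fun r _ => ?_
    have h3 := hcomp r
    have h4 : s r ≤ 0 := sub_nonpos.2 ((Γ.mem_feasible_iff.1 hx).2 r)
    have h5 := mul_nonpos_of_nonneg_of_nonpos (hy r) h4
    have h6 : l r * s r = 0 := h3
    simp only [PiLp.sub_apply, RCLike.inner_apply, conj_trivial]
    linarith
  rw [h1, inner_smul_left]
  exact mul_nonpos_of_nonneg_of_nonpos (by simp) h2

/-- The weight of the `l`-th component of the estimate of agent `i` in the metric. -/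
def weight (p : Params N) (i l : Fin N) : ℝ :=
  if l = i then (p.α i)⁻¹ else p.c / (p.κ * p.α i)

/-- The squared norm of the preconditioning metric of the iteration. -/
def metricSq (Γ : Game N m d) (G : SimpleGraph (Fin N)) (w : Matrix (Fin N) (Fin N) ℝ)
    (p : Params N) (X : Estimates Γ.n) (v : Edge G → Vec m) (lam : Fin N → Vec m) : ℝ :=
  ∑ i, ∑ l, weight p i l * ‖X i l‖ ^ 2 + p.ν⁻¹ * ∑ e, ‖v e‖ ^ 2 + ∑ i, (p.δ i)⁻¹ * ‖lam i‖ ^ 2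
    - 2 * ∑ i, inner ℝ (lam i) ((Γ.A i).toEuclideanLin (X i i) - incidenceTransposeMul G w v i)

lemma norm_sq_three_point {E : Type*} [NormedAddCommGroup E] [InnerProductSpace ℝ E] (a b : E) :
    ‖a‖ ^ 2 - ‖b‖ ^ 2 - ‖b - a‖ ^ 2 = 2 * inner ℝ (a - b) b := by
  simp only [← real_inner_self_eq_norm_sq, inner_sub_left, inner_sub_right, real_inner_comm a b]
  ring

/-- The identity `‖a‖² - ‖b‖² - ‖b - a‖² = 2 ⟨a - b, b⟩` for the metric. The cross terms are grouped
to match the algorithm: `lam'` meets the extrapolations `2 X' - X` and `2 v' - v`, and `lam` meets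
`X'` and `v'`. -/
lemma metricSq_three_point (X X' : Estimates Γ.n) (v v' : Edge G → Vec m)
    (lam lam' : Fin N → Vec m) :
    metricSq Γ G w p X v lam - metricSq Γ G w p X' v' lam'
      - metricSq Γ G w p (X' - X) (v' - v) (lam' - lam) =
    2 * (∑ i, ∑ l, weight p i l * inner ℝ (X i l - X' i l) (X' i l)
      + p.ν⁻¹ * ∑ e, inner ℝ (v e - v' e) (v' e)
      + ∑ i, (p.δ i)⁻¹ * inner ℝ (lam i - lam' i) (lam' i)
      + ∑ i, (inner ℝ (lam' i) ((Γ.A i).toEuclideanLin ((2 : ℝ) • X' i i - X i i)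
          - incidenceTransposeMul G w ((2 : ℝ) • v' - v) i)
        - inner ℝ (lam i) ((Γ.A i).toEuclideanLin (X' i i) - incidenceTransposeMul G w v' i))) := by
  have hV : ∀ i, incidenceTransposeMul G w (v' - v) i =
      incidenceTransposeMul G w v' i - incidenceTransposeMul G w v i := fun i => by
    rw [← incidenceTransposeLin_apply, map_sub]; rfl
  have hV2 : ∀ i, incidenceTransposeMul G w ((2 : ℝ) • v' - v) i =
      (2 : ℝ) • incidenceTransposeMul G w v' i - incidenceTransposeMul G w v i := fun i => by
    rw [← incidenceTransposeLin_apply, map_sub, map_smul]; rfl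
  have h1 : ∑ i, ∑ l, weight p i l * ‖X i l‖ ^ 2 - ∑ i, ∑ l, weight p i l * ‖X' i l‖ ^ 2
      - ∑ i, ∑ l, weight p i l * ‖(X' - X) i l‖ ^ 2
      = 2 * ∑ i, ∑ l, weight p i l * inner ℝ (X i l - X' i l) (X' i l) := by
    simp only [← Finset.sum_sub_distrib, Finset.mul_sum]
    refine Finset.sum_congr rfl fun i _ => Finset.sum_congr rfl fun l _ => ?_
    have := norm_sq_three_point (X i l) (X' i l)
    simp only [PiLp.sub_apply]
    rw [← mul_sub, ← mul_sub, this]; ring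
  have h2 : ∑ e, ‖v e‖ ^ 2 - ∑ e, ‖v' e‖ ^ 2 - ∑ e, ‖(v' - v) e‖ ^ 2
      = 2 * ∑ e, inner ℝ (v e - v' e) (v' e) := by
    simp only [← Finset.sum_sub_distrib, Finset.mul_sum]
    exact Finset.sum_congr rfl fun e _ => norm_sq_three_point (v e) (v' e)
  have h3 : ∑ i, (p.δ i)⁻¹ * ‖lam i‖ ^ 2 - ∑ i, (p.δ i)⁻¹ * ‖lam' i‖ ^ 2
      - ∑ i, (p.δ i)⁻¹ * ‖(lam' - lam) i‖ ^ 2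
      = 2 * ∑ i, (p.δ i)⁻¹ * inner ℝ (lam i - lam' i) (lam' i) := by
    simp only [← Finset.sum_sub_distrib, Finset.mul_sum]
    refine Finset.sum_congr rfl fun i _ => ?_
    have := norm_sq_three_point (lam i) (lam' i)
    simp only [Pi.sub_apply]
    rw [← mul_sub, ← mul_sub, this]; ring
  have h4 : ∑ i, inner ℝ (lam' i)
        ((Γ.A i).toEuclideanLin (X' i i) - incidenceTransposeMul G w v' i)
      - ∑ i, inner ℝ (lam i) ((Γ.A i).toEuclideanLin (X i i) - incidenceTransposeMul G w v i)
      + ∑ i, inner ℝ ((lam' - lam) i) ((Γ.A i).toEuclideanLin ((X' - X) i i)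
          - incidenceTransposeMul G w (v' - v) i)
      = ∑ i, (inner ℝ (lam' i) ((Γ.A i).toEuclideanLin ((2 : ℝ) • X' i i - X i i)
          - incidenceTransposeMul G w ((2 : ℝ) • v' - v) i)
        - inner ℝ (lam i)
          ((Γ.A i).toEuclideanLin (X' i i) - incidenceTransposeMul G w v' i)) := by
    simp only [← Finset.sum_sub_distrib, ← Finset.sum_add_distrib]
    refine Finset.sum_congr rfl fun i _ => ?_
    simp only [hV, hV2, PiLp.sub_apply, Pi.sub_apply, map_sub, map_smul, inner_sub_left,
      inner_sub_right, inner_smul_right]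
    ring
  simp only [metricSq]
  have h2' := congrArg (fun t => p.ν⁻¹ * t) h2
  simp only [mul_sub] at h2'
  linarith

lemma nextEstimates_same (S : Oracle Γ.n) (X : Estimates Γ.n) (lam : Fin N → Vec m) (i : Fin N) :
    nextEstimates Γ w p S X lam i i = nextDecision Γ w p S X lam i := by
  simp [nextEstimates]

lemma nextEstimates_of_ne (S : Oracle Γ.n) (X : Estimates Γ.n) (lam : Fin N → Vec m)
    {i l : Fin N} (h : l ≠ i) :
    nextEstimates Γ w p S X lam i l = X i l - (p.α i * p.κ) • lapAt w X i l := by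
  simp only [nextEstimates]
  rw [setAt_of_ne _ h]; rfl

lemma nextDecision_mem {D : ∀ i, Set (Vec (Γ.n i))} {η ℓF : ℝ} (hΓ : Γ.Assumptions D η ℓF)
    {i : Fin N} (hα : 0 ≤ p.α i) (S : Oracle Γ.n) (X : Estimates Γ.n) (lam : Fin N → Vec m) :
    nextDecision Γ w p S X lam i ∈ Γ.Ω i :=
  (isProx_prox (hΓ.Ω_compact i) (hΓ.Ω_nonempty i) (hΓ.g_lsc i) hα _).1

/-- Test the proximal inequality at the equilibrium and the KKT inequality at the new decision; in
the sum the nonsmooth costs cancel. -/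
lemma nextDecision_inner_le {D : ∀ i, Set (Vec (Γ.n i))} {η ℓF : ℝ} (hΓ : Γ.Assumptions D η ℓF)
    {x : Profile Γ.n} {v : Edge G → Vec m} {l : Vec m} (hK : IsKKT Γ G w x v l)
    {i : Fin N} (hα : 0 < p.α i) (S : Oracle Γ.n) (X : Estimates Γ.n) (lam : Fin N → Vec m)
    {x' : Vec (Γ.n i)} (hx' : x' = nextDecision Γ w p S X lam i) :
    p.c * inner ℝ (lapAt w X i i) (x' - x i)
        + inner ℝ (S i (X i) - Γ.pseudograd x i) (x' - x i)
        + inner ℝ (lam i - l) ((Γ.A i).toEuclideanLin (x' - x i))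
      ≤ (p.α i)⁻¹ * inner ℝ (X i i - x') (x' - x i) := by
  have hprox := isProx_prox (hΓ.Ω_compact i) (hΓ.Ω_nonempty i) (hΓ.g_lsc i) hα.le
    (X i i - p.α i • (S i (X i) + (Γ.A i).transpose.toEuclideanLin (lam i)
      + p.c • ∑ j, w i j • (X i i - X j i)))
  have h1 := inner_le_of_prox_minimizer (hΓ.g_convex i) hα.le hprox.1 hprox.2 (hK.mem i)
  rw [← nextDecision, ← hx', ← lapAt_apply] at h1
  have hmem : x' ∈ Γ.Ω i := hx' ▸ nextDecision_mem hΓ hα.le S X lam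
  have h2 := hK.primal i x' hmem
  have h3 : inner ℝ (X i i - p.α i • (S i (X i) + (Γ.A i).transpose.toEuclideanLin (lam i)
      + p.c • lapAt w X i i) - x') (x i - x') =
      -inner ℝ (X i i - x') (x' - x i) + p.α i * (inner ℝ (S i (X i)) (x' - x i)
        + inner ℝ (lam i) ((Γ.A i).toEuclideanLin (x' - x i))
        + p.c * inner ℝ (lapAt w X i i) (x' - x i)) := by
    rw [← inner_toEuclideanLin_transpose, ← neg_sub x' (x i), inner_neg_right]
    simp only [inner_sub_left, inner_add_left, inner_smul_left, conj_trivial]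
    ring
  rw [h3] at h1
  rw [inv_mul_eq_div, le_div_iff₀ hα]
  simp only [inner_sub_left (S i (X i)), inner_sub_left (lam i)]
  have h4 := mul_le_mul_of_nonneg_left h2 hα.le
  linarith

/-- The fundamental inequality of the preconditioned forward-backward step. -/
lemma metricSq_edgeStep_le {D : ∀ i, Set (Vec (Γ.n i))} {η ℓF : ℝ} (hΓ : Γ.Assumptions D η ℓF)
    {x : Profile Γ.n} {v : Edge G → Vec m} {l : Vec m} (hK : IsKKT Γ G w x v l)
    (hα : ∀ i, 0 < p.α i) (hν : 0 < p.ν) (hδ : ∀ i, 0 < p.δ i) (hκ : 0 < p.κ)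
    (S : Oracle Γ.n) {u u' : EdgeState Γ.n m G} (hu : u' = edgeStep Γ w p G S u) :
    metricSq Γ G w p (u'.xhat - consensus x) (u'.v - v) (u'.lam - fun _ => l) ≤
      metricSq Γ G w p (u.xhat - consensus x) (u.v - v) (u.lam - fun _ => l)
      - metricSq Γ G w p (u'.xhat - u.xhat) (u'.v - u.v) (u'.lam - u.lam)
      - 2 * (∑ i, inner ℝ (S i (u.xhat i) - Γ.pseudograd x i) (u'.xhat i i - x i)
        + p.c * ∑ i, inner ℝ (lapAt w u.xhat i) (u'.xhat i - x)) := by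
  have h3p := metricSq_three_point (Γ := Γ) (G := G) (w := w) (p := p) (u.xhat - consensus x)
    (u'.xhat - consensus x) (u.v - v) (u'.v - v) (u.lam - fun _ => l) (u'.lam - fun _ => l)
  simp only [sub_sub_sub_cancel_right] at h3p
  have hX' : u'.xhat = nextEstimates Γ w p S u.xhat u.lam := by rw [hu]; rfl
  have hv' : u'.v = u.v + p.ν • incidenceMul G w u.lam := by rw [hu]; rfl
  have hl' : ∀ i, u'.lam i = projNonneg (u.lam i + p.δ i •
      ((2 : ℝ) • (Γ.A i).toEuclideanLin (u'.xhat i i) - (Γ.A i).toEuclideanLin (u.xhat i i) - Γ.b i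
        - incidenceTransposeMul G w ((2 : ℝ) • u'.v - u.v) i)) := fun i => by rw [hu]; rfl
  -- estimates
  have hX : p.c * ∑ i, inner ℝ (lapAt w u.xhat i) (u'.xhat i - x)
      + ∑ i, inner ℝ (S i (u.xhat i) - Γ.pseudograd x i) (u'.xhat i i - x i)
      + ∑ i, inner ℝ (u.lam i - l) ((Γ.A i).toEuclideanLin (u'.xhat i i - x i))
      ≤ ∑ i, ∑ j, weight p i j * inner ℝ ((u.xhat - consensus x) i j - (u'.xhat - consensus x) i j)
          ((u'.xhat - consensus x) i j) := by
    simp only [Finset.mul_sum, ← Finset.sum_add_distrib]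
    refine Finset.sum_le_sum fun i _ => ?_
    have h1 := nextDecision_inner_le hΓ hK (hα i) S u.xhat u.lam
      (x' := u'.xhat i i) (by rw [hX', nextEstimates_same])
    rw [PiLp.inner_apply, Finset.mul_sum, ← Finset.add_sum_erase _ _ (Finset.mem_univ i),
      ← Finset.add_sum_erase (a := i) _ (fun j => weight p i j * _) (Finset.mem_univ i)]
    -- The metric weight `c / (κ α_i)` times the step `α_i κ` of the estimate update equals `c`. So,
    -- for any `κ`, the estimate update is a forward step on `c L`.
    have h2 : ∑ j ∈ Finset.univ.erase i, p.c * inner ℝ (lapAt w u.xhat i j) ((u'.xhat i - x) j)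
        = ∑ j ∈ Finset.univ.erase i, weight p i j *
          inner ℝ ((u.xhat - consensus x) i j - (u'.xhat - consensus x) i j)
            ((u'.xhat - consensus x) i j) := by
      refine Finset.sum_congr rfl fun j hj => ?_
      have hne := Finset.ne_of_mem_erase hj
      have h3 : u.xhat i j - u'.xhat i j = (p.α i * p.κ) • lapAt w u.xhat i j := by
        rw [hX', nextEstimates_of_ne _ _ _ hne]; abel
      simp only [PiLp.sub_apply, consensus_apply, sub_sub_sub_cancel_right, h3, weight, hne,
        if_false, inner_smul_left, conj_trivial]
      have := (hα i).ne'
      field_simp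
    rw [h2]
    have h4 : weight p i i = (p.α i)⁻¹ := if_pos rfl
    simp only [PiLp.sub_apply, consensus_apply, sub_sub_sub_cancel_right, h4] at h1 ⊢
    linarith
  -- edge variables
  have hv : p.ν⁻¹ * ∑ e, inner ℝ ((u.v - v) e - (u'.v - v) e) ((u'.v - v) e)
      = -∑ i, inner ℝ (u.lam i - l) (incidenceTransposeMul G w (u'.v - v) i) := by
    rw [sum_inner_incidenceTransposeMul, Finset.mul_sum, ← Finset.sum_neg_distrib]
    refine Finset.sum_congr rfl fun e _ => ?_
    have h1 : (u.v - v) e - (u'.v - v) e = -(p.ν • incidenceMul G w u.lam e) := by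
      rw [hv']; simp
    have h2 : incidenceMul G w (fun i => u.lam i - l) e = incidenceMul G w u.lam e := by
      simp [incidenceMul_apply]
    rw [h1, h2, inner_neg_left, inner_smul_left]
    simp only [conj_trivial]
    field_simp
  -- multipliers
  have hL : ∀ i, 0 ≤ (p.δ i)⁻¹ * inner ℝ (u.lam i - l - (u'.lam i - l)) (u'.lam i - l)
      + inner ℝ (u'.lam i - l) ((Γ.A i).toEuclideanLin
          ((2 : ℝ) • (u'.xhat - consensus x) i i - (u.xhat - consensus x) i i)
        - incidenceTransposeMul G w ((2 : ℝ) • (u'.v - v) - (u.v - v)) i) := by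
    intro i
    have h1 := inner_sub_projNonneg_nonneg (u.lam i + p.δ i •
      ((2 : ℝ) • (Γ.A i).toEuclideanLin (u'.xhat i i) - (Γ.A i).toEuclideanLin (u.xhat i i) - Γ.b i
        - incidenceTransposeMul G w ((2 : ℝ) • u'.v - u.v) i)) hK.nonneg
    rw [← hl' i] at h1
    have h2 := hK.dual i (u'.lam i) (fun r => by rw [hl' i]; exact projNonneg_nonneg _ r)
    have h3 : (Γ.A i).toEuclideanLin
          ((2 : ℝ) • (u'.xhat - consensus x) i i - (u.xhat - consensus x) i i)
        - incidenceTransposeMul G w ((2 : ℝ) • (u'.v - v) - (u.v - v)) i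
        = ((2 : ℝ) • (Γ.A i).toEuclideanLin (u'.xhat i i) - (Γ.A i).toEuclideanLin (u.xhat i i)
          - Γ.b i - incidenceTransposeMul G w ((2 : ℝ) • u'.v - u.v) i)
          - ((Γ.A i).toEuclideanLin (x i) - Γ.b i - incidenceTransposeMul G w v i) := by
      simp only [← incidenceTransposeLin_apply, map_sub, map_smul, PiLp.sub_apply,
        consensus_apply, Pi.sub_apply, Pi.smul_apply]
      module
    rw [h3]
    set q := (2 : ℝ) • (Γ.A i).toEuclideanLin (u'.xhat i i) - (Γ.A i).toEuclideanLin (u.xhat i i)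
          - Γ.b i - incidenceTransposeMul G w ((2 : ℝ) • u'.v - u.v) i
    set q' := (Γ.A i).toEuclideanLin (x i) - Γ.b i - incidenceTransposeMul G w v i
    have h4 : 0 ≤ (p.δ i)⁻¹ * inner ℝ (u.lam i + p.δ i • q - u'.lam i) (u'.lam i - l) :=
      mul_nonneg (inv_nonneg.2 (hδ i).le) h1
    have h5 : (p.δ i)⁻¹ * inner ℝ (u.lam i + p.δ i • q - u'.lam i) (u'.lam i - l)
        = (p.δ i)⁻¹ * inner ℝ (u.lam i - u'.lam i) (u'.lam i - l)
          + inner ℝ (u'.lam i - l) q := by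
      rw [show u.lam i + p.δ i • q - u'.lam i = (u.lam i - u'.lam i) + p.δ i • q by abel,
        inner_add_left, inner_smul_left, mul_add, real_inner_comm q]
      simp only [conj_trivial]
      rw [inv_mul_cancel_left₀ (hδ i).ne']
    rw [sub_sub_sub_cancel_right, inner_sub_right (u'.lam i - l), real_inner_comm q' (u'.lam i - l)]
    linarith
  have hLs := Finset.sum_nonneg fun i (_ : i ∈ Finset.univ) => hL i
  rw [Finset.sum_add_distrib] at hLs
  -- These are the products with the old multiplier, due to the decision and edge updates using
  -- `λ^k`. The cross terms of the metric cancel both of them exactly.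
  have hsplit : ∑ i, inner ℝ (u.lam i - l) ((Γ.A i).toEuclideanLin ((u'.xhat - consensus x) i i)
        - incidenceTransposeMul G w (u'.v - v) i)
      = ∑ i, inner ℝ (u.lam i - l) ((Γ.A i).toEuclideanLin (u'.xhat i i - x i))
        - ∑ i, inner ℝ (u.lam i - l) (incidenceTransposeMul G w (u'.v - v) i) := by
    simp only [inner_sub_right, Finset.sum_sub_distrib, PiLp.sub_apply, consensus_apply]
  simp only [Finset.sum_sub_distrib, Pi.sub_apply (f := u.lam), Pi.sub_apply (f := u'.lam)] at h3p
  rw [hv, hsplit] at h3p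
  linarith

end OneStep

/-! ### Step sizes and the energy bound -/

section Energy

variable {N m d : ℕ} {Γ : Game N m d} {w : Matrix (Fin N) (Fin N) ℝ} {G : SimpleGraph (Fin N)}

lemma sum_norm_sq_incidenceTransposeMul_le (v : Edge G → Vec m) :
    ∑ i, ‖incidenceTransposeMul G w v i‖ ^ 2
      ≤ (∑ i, ∑ e, incidence G w e i ^ 2) * ∑ e, ‖v e‖ ^ 2 := by
  rw [Finset.sum_mul]
  refine Finset.sum_le_sum fun i _ => ?_
  have h1 : ‖incidenceTransposeMul G w v i‖ ≤ ∑ e, |incidence G w e i| * ‖v e‖ := by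
    refine (norm_sum_le _ _).trans (Finset.sum_le_sum fun e _ => ?_)
    rw [norm_smul, Real.norm_eq_abs]
  refine (pow_le_pow_left₀ (norm_nonneg _) h1 2).trans ?_
  refine (Finset.sum_mul_sq_le_sq_mul_sq _ _ _).trans_eq ?_
  simp only [sq_abs]

lemma two_mul_abs_inner_le {E : Type*} [NormedAddCommGroup E] [InnerProductSpace ℝ E] (a b : E) :
    2 * |inner ℝ a b| ≤ ‖a‖ ^ 2 + ‖b‖ ^ 2 := by
  nlinarith [abs_real_inner_le_norm a b, sq_nonneg (‖a‖ - ‖b‖)]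

variable (Γ w G) in
-- Diagonal dominance: by Young's inequality the cross terms cost at most `2 ‖lam‖²`, `a² ‖X i i‖²`
-- and `B ‖v‖²`, and small steps make the diagonal weights exceed these costs with `R ‖X‖²` to
-- spare. The first conclusion keeps the estimate update a convex combination.
lemma exists_stepsizes (hw : IsWeighting G w) {c κ R : ℝ} (hc : 0 < c) (hκ : 0 < κ) (hR : 0 ≤ R) :
    ∃ αbar νbar δbar : ℝ, 0 < αbar ∧ 0 < νbar ∧ 0 < δbar ∧
      ∀ (α : Fin N → ℝ) (ν : ℝ) (δ : Fin N → ℝ), (∀ i, α i ∈ Set.Ioo 0 αbar) →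
        ν ∈ Set.Ioo 0 νbar → (∀ i, δ i ∈ Set.Ioo 0 δbar) →
        (∀ i, α i * κ * ∑ j, w i j ≤ 1) ∧
        ∀ (X : Estimates Γ.n) (v : Edge G → Vec m) (lam : Fin N → Vec m),
          R * ‖X‖ ^ 2 ≤ metricSq Γ G w ⟨α, ν, δ, c, κ⟩ X v lam := by
  set a : ℝ := ∑ i, ‖(Γ.A i).toEuclideanLin.toContinuousLinearMap‖ with ha
  have haA : ∀ i (x : Vec (Γ.n i)), ‖(Γ.A i).toEuclideanLin x‖ ^ 2 ≤ a ^ 2 * ‖x‖ ^ 2 := by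
    intro i x
    have h1 : ‖(Γ.A i).toEuclideanLin x‖
        ≤ ‖(Γ.A i).toEuclideanLin.toContinuousLinearMap‖ * ‖x‖ :=
      (Γ.A i).toEuclideanLin.toContinuousLinearMap.le_opNorm x
    have h2 : ‖(Γ.A i).toEuclideanLin.toContinuousLinearMap‖ ≤ a :=
      Finset.single_le_sum (f := fun i => ‖(Γ.A i).toEuclideanLin.toContinuousLinearMap‖)
        (fun j _ => norm_nonneg _) (Finset.mem_univ i)
    rw [← mul_pow]
    exact pow_le_pow_left₀ (norm_nonneg _)
      (h1.trans (mul_le_mul_of_nonneg_right h2 (norm_nonneg x))) 2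
  set B : ℝ := ∑ i, ∑ e : Edge G, incidence G w e i ^ 2 with hB
  have hB0 : 0 ≤ B := Finset.sum_nonneg fun i _ => Finset.sum_nonneg fun e _ => sq_nonneg _
  set W : ℝ := ∑ i, ∑ j, w i j with hW
  have hWi : ∀ i, ∑ j, w i j ≤ W := fun i =>
    Finset.single_le_sum (f := fun i => ∑ j, w i j)
      (fun j _ => Finset.sum_nonneg fun l _ => hw.nonneg j l) (Finset.mem_univ i)
  have hW0 : 0 ≤ W := Finset.sum_nonneg fun i _ => Finset.sum_nonneg fun j _ => hw.nonneg i j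
  -- The three bounds on `α` serve, in order, the own decisions, the estimates of the others, and
  -- the convex combination. The added ones keep all denominators positive.
  refine ⟨min (R + a ^ 2 + 1)⁻¹ (min (c / (κ * (R + 1))) (κ * (W + 1))⁻¹), (B + 1)⁻¹, 2⁻¹,
    by positivity, by positivity, by positivity, fun α ν δ hα hν hδ => ⟨fun i => ?_, ?_⟩⟩
  · have h1 : α i < (κ * (W + 1))⁻¹ :=
      (hα i).2.trans_le ((min_le_right _ _).trans (min_le_right _ _))
    have h2 : α i * (κ * (W + 1)) < 1 := by
      rwa [← one_div, lt_div_iff₀ (by positivity)] at h1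
    have h3 : α i * κ * ∑ j, w i j ≤ α i * κ * (W + 1) :=
      mul_le_mul_of_nonneg_left ((hWi i).trans (by linarith)) (mul_pos (hα i).1 hκ).le
    linarith
  intro X v lam
  have hα1 : ∀ i, R + a ^ 2 ≤ (α i)⁻¹ := fun i => by
    have h := (hα i).2.trans_le (min_le_left _ _)
    have := (lt_inv_comm₀ (hα i).1 (by positivity)).1 h
    linarith
  have hα2 : ∀ i, R ≤ c / (κ * α i) := fun i => by
    have h := (hα i).2.trans_le ((min_le_right _ _).trans (min_le_left _ _))
    rw [lt_div_iff₀ (by positivity)] at h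
    rw [le_div_iff₀ (mul_pos hκ (hα i).1)]
    have := mul_pos hκ (hα i).1
    linarith
  have hν1 : B ≤ ν⁻¹ := by
    have := (lt_inv_comm₀ hν.1 (by positivity)).1 hν.2
    linarith
  have hδ1 : ∀ i, 2 ≤ (δ i)⁻¹ := fun i =>
    ((lt_inv_comm₀ (hδ i).1 (by positivity)).1 (hδ i).2).le
  have h1 : R * ‖X‖ ^ 2 + ∑ i, a ^ 2 * ‖X i i‖ ^ 2
      ≤ ∑ i, ∑ l, weight ⟨α, ν, δ, c, κ⟩ i l * ‖X i l‖ ^ 2 := by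
    rw [PiLp.norm_sq_eq_of_L2, Finset.mul_sum, ← Finset.sum_add_distrib]
    refine Finset.sum_le_sum fun i _ => ?_
    rw [PiLp.norm_sq_eq_of_L2, Finset.mul_sum, ← Finset.add_sum_erase _ _ (Finset.mem_univ i),
      ← Finset.add_sum_erase (a := i) _ (fun l => weight _ i l * _) (Finset.mem_univ i)]
    have e1 : R * ‖X i i‖ ^ 2 + a ^ 2 * ‖X i i‖ ^ 2
        ≤ weight ⟨α, ν, δ, c, κ⟩ i i * ‖X i i‖ ^ 2 := by
      rw [weight, if_pos rfl, ← add_mul]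
      exact mul_le_mul_of_nonneg_right (hα1 i) (sq_nonneg _)
    have e2 : ∑ l ∈ Finset.univ.erase i, R * ‖X i l‖ ^ 2
        ≤ ∑ l ∈ Finset.univ.erase i, weight ⟨α, ν, δ, c, κ⟩ i l * ‖X i l‖ ^ 2 := by
      refine Finset.sum_le_sum fun l hl => ?_
      rw [weight, if_neg (Finset.ne_of_mem_erase hl)]
      exact mul_le_mul_of_nonneg_right (hα2 i) (sq_nonneg _)
    linarith
  have h2 : B * ∑ e, ‖v e‖ ^ 2 ≤ ν⁻¹ * ∑ e, ‖v e‖ ^ 2 :=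
    mul_le_mul_of_nonneg_right hν1 (Finset.sum_nonneg fun e _ => sq_nonneg _)
  have h3 : ∑ i, 2 * ‖lam i‖ ^ 2 ≤ ∑ i, (δ i)⁻¹ * ‖lam i‖ ^ 2 :=
    Finset.sum_le_sum fun i _ => mul_le_mul_of_nonneg_right (hδ1 i) (sq_nonneg _)
  have h4 : 2 * ∑ i, inner ℝ (lam i)
      ((Γ.A i).toEuclideanLin (X i i) - incidenceTransposeMul G w v i)
      ≤ ∑ i, 2 * ‖lam i‖ ^ 2 + ∑ i, a ^ 2 * ‖X i i‖ ^ 2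
        + ∑ i, ‖incidenceTransposeMul G w v i‖ ^ 2 := by
    rw [Finset.mul_sum, ← Finset.sum_add_distrib, ← Finset.sum_add_distrib]
    refine Finset.sum_le_sum fun i _ => ?_
    have e1 := two_mul_abs_inner_le (lam i) ((Γ.A i).toEuclideanLin (X i i))
    have e2 := two_mul_abs_inner_le (lam i) (incidenceTransposeMul G w v i)
    have e3 := le_abs_self (inner ℝ (lam i) ((Γ.A i).toEuclideanLin (X i i)))
    have e4 := neg_abs_le (inner ℝ (lam i) (incidenceTransposeMul G w v i))
    have e5 := haA i (X i i)
    rw [inner_sub_right]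
    linarith
  have h5 := sum_norm_sq_incidenceTransposeMul_le (w := w) v
  simp only [metricSq]
  linarith

/-- The estimates stay in `D`, and the decisions in `Ω`. -/
lemma nextEstimates_mem {D : ∀ i, Set (Vec (Γ.n i))} {η ℓF : ℝ} (hΓ : Γ.Assumptions D η ℓF)
    (hw : IsWeighting G w) {p : Params N} (hα : ∀ i, 0 < p.α i) (hκ : 0 < p.κ)
    (hsmall : ∀ i, p.α i * p.κ * ∑ j, w i j ≤ 1) (S : Oracle Γ.n) {X : Estimates Γ.n}
    (hX : ∀ i l, X i l ∈ D l) (lam : Fin N → Vec m) :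
    (∀ i l, nextEstimates Γ w p S X lam i l ∈ D l) ∧
      ∀ i, nextEstimates Γ w p S X lam i i ∈ Γ.Ω i := by
  have h1 : ∀ i, nextEstimates Γ w p S X lam i i ∈ Γ.Ω i := fun i => by
    rw [nextEstimates_same]; exact nextDecision_mem hΓ (hα i).le S X lam
  refine ⟨fun i l => ?_, h1⟩
  by_cases h : l = i
  · subst h; exact hΓ.Ω_subset_D l (h1 l)
  · rw [nextEstimates_of_ne _ _ _ h]
    set t : Fin N → ℝ := fun j => p.α i * p.κ * w i j with ht
    have hαk : 0 ≤ p.α i * p.κ := (mul_pos (hα i) hκ).le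
    have hsum : ∑ j, t j ≤ 1 := by rw [ht, ← Finset.mul_sum]; exact hsmall i
    -- The estimate of agent `i` itself receives the remaining mass `1 - ∑ t k`, nonnegative by
    -- `hsmall`.
    have heq : X i l - (p.α i * p.κ) • lapAt w X i l
        = ∑ j, (t j + if j = i then 1 - ∑ k, t k else 0) • X j l := by
      simp only [add_smul, Finset.sum_add_distrib, ite_smul, zero_smul, Finset.sum_ite_eq',
        Finset.mem_univ, if_true]
      rw [lapAt_apply]
      simp only [smul_sub, Finset.sum_sub_distrib, Finset.smul_sum, smul_smul, sub_smul, one_smul,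
        Finset.sum_smul, ht]
      abel
    rw [heq]
    refine (hΓ.D_convex l).sum_mem (fun j _ => ?_) ?_ (fun j _ => hX j l)
    · refine add_nonneg (mul_nonneg hαk (hw.nonneg i j)) ?_
      split_ifs
      · linarith
      · exact le_rfl
    · simp [Finset.sum_add_distrib]

lemma iterate_mem {D : ∀ i, Set (Vec (Γ.n i))} {η ℓF : ℝ} (hΓ : Γ.Assumptions D η ℓF)
    (hw : IsWeighting G w) {p : Params N} (hα : ∀ i, 0 < p.α i) (hκ : 0 < p.κ)
    (hsmall : ∀ i, p.α i * p.κ * ∑ j, w i j ≤ 1) (S : ℕ → Oracle Γ.n) {s₀ : State Γ.n m}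
    (hX : ∀ i l, s₀.xhat i l ∈ D l) (hΩ : ∀ i, s₀.xhat i i ∈ Γ.Ω i) (k : ℕ) :
    (∀ i l, (iterate Γ w p S s₀ k).xhat i l ∈ D l) ∧
      ∀ i, (iterate Γ w p S s₀ k).xhat i i ∈ Γ.Ω i := by
  induction k with
  | zero => exact ⟨hX, hΩ⟩
  | succ k ih => exact nextEstimates_mem hΓ hw hα hκ hsmall (S k) ih.1 _

/-- The error of the partial gradients that the agents use at the estimates `X`. -/
def gradError (Γ : Game N m d) (S : Oracle Γ.n) (X : Estimates Γ.n) (i : Fin N) : Vec (Γ.n i) :=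
  S i (X i) - Γ.pseudograd (X i) i

/-- Split the new decisions into the old ones plus `Δ`. Strong monotonicity at the old state
supplies `-2 μ ‖X - consensus x‖²`, half of which pays for the forward operator against `Δ`. The
`‖Δ‖²` terms produced are covered by the metric. -/
lemma metricSq_edgeStep_le_of_gap {D : ∀ i, Set (Vec (Γ.n i))} {η ℓF ℓp μ C : ℝ}
    (hΓ : Γ.Assumptions D η ℓF) (hℓp : 0 < ℓp) (hFp : Γ.ExtLipschitz D ℓp)
    (hC : ∀ X : Estimates Γ.n, ‖lapLin w Γ.n X‖ ≤ C * ‖X‖) {p : Params N}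
    {x : Profile Γ.n} {v : Edge G → Vec m} {l : Vec m} (hK : IsKKT Γ G w x v l)
    (hα : ∀ i, 0 < p.α i) (hν : 0 < p.ν) (hδ : ∀ i, 0 < p.δ i) (hc : 0 < p.c) (hκ : 0 < p.κ)
    (hμ : 0 < μ) (hmono : ∀ X : Estimates Γ.n, (∀ i, X i ∈ Γ.box D) → ∀ x ∈ Γ.box D,
      μ * ‖X - consensus x‖ ^ 2 ≤
        inner ℝ (Γ.extPseudograd X - Γ.pseudograd x) (decisions X - x)
          + p.c * ∑ i, inner ℝ (lapAt w X i) (X i - x))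
    (hmetric : ∀ (X : Estimates Γ.n) (v : Edge G → Vec m) (lam : Fin N → Vec m),
      ((ℓp + p.c * C) ^ 2 / μ + 1) * ‖X‖ ^ 2 ≤ metricSq Γ G w p X v lam)
    (S : Oracle Γ.n) {u u' : EdgeState Γ.n m G} (hu : u' = edgeStep Γ w p G S u)
    (hX : ∀ i, u.xhat i ∈ Γ.box D) :
    metricSq Γ G w p (u'.xhat - consensus x) (u'.v - v) (u'.lam - fun _ => l) ≤
      metricSq Γ G w p (u.xhat - consensus x) (u.v - v) (u.lam - fun _ => l)
      - μ * ‖decisions u.xhat - x‖ ^ 2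
      + ∑ i, (‖gradError Γ S u.xhat i‖ ^ 2
        - 2 * inner ℝ (gradError Γ S u.xhat i) (decisions u.xhat i - x i)) := by
  have hstep := metricSq_edgeStep_le hΓ hK hα hν hδ hκ S hu
  have hmet := hmetric (u'.xhat - u.xhat) (u'.v - u.v) (u'.lam - u.lam)
  have hxD : x ∈ Γ.box D := hΓ.box_subset hK.mem
  have hmon := hmono u.xhat hX x hxD
  have hlip := inner_extPseudograd_add_lapAt_le (c := p.c) hFp hℓp hc hC hX hxD (u'.xhat - u.xhat)
  set Δ := u'.xhat - u.xhat with hΔ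
  have e1 : ∑ i, inner ℝ (S i (u.xhat i) - Γ.pseudograd x i) (u'.xhat i i - x i)
      = ∑ i, inner ℝ (gradError Γ S u.xhat i) (decisions u.xhat i - x i)
        + ∑ i, inner ℝ (gradError Γ S u.xhat i) (Δ i i)
        + inner ℝ (Γ.extPseudograd u.xhat - Γ.pseudograd x) (decisions u.xhat - x)
        + inner ℝ (Γ.extPseudograd u.xhat - Γ.pseudograd x) (decisions Δ) := by
    rw [PiLp.inner_apply, PiLp.inner_apply, ← Finset.sum_add_distrib, ← Finset.sum_add_distrib,
      ← Finset.sum_add_distrib]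
    refine Finset.sum_congr rfl fun i _ => ?_
    have a1 : S i (u.xhat i) - Γ.pseudograd x i
        = gradError Γ S u.xhat i + (Γ.extPseudograd u.xhat - Γ.pseudograd x) i := by
      have : Γ.extPseudograd u.xhat i = Γ.pseudograd (u.xhat i) i := rfl
      rw [gradError, PiLp.sub_apply, this]; abel
    have a2 : u'.xhat i i - x i = (decisions u.xhat i - x i) + Δ i i := by
      simp only [hΔ, PiLp.sub_apply, decisions_apply]; abel
    rw [a1, a2]
    simp only [inner_add_left, inner_add_right, PiLp.sub_apply, decisions_apply]
    ring
  have e2 : ∑ i, inner ℝ (lapAt w u.xhat i) (u'.xhat i - x)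
      = ∑ i, inner ℝ (lapAt w u.xhat i) (u.xhat i - x)
        + ∑ i, inner ℝ (lapAt w u.xhat i) (Δ i) := by
    rw [← Finset.sum_add_distrib]
    refine Finset.sum_congr rfl fun i _ => ?_
    rw [← inner_add_right]
    congr 1
    simp only [hΔ, PiLp.sub_apply]; abel
  -- The `+ 1` in the constant of `hmetric` is spent here: the error is correlated with `Δ`, so this
  -- product is bounded by Young rather than averaged out.
  have e3 : -∑ i, ‖gradError Γ S u.xhat i‖ ^ 2 - ‖Δ‖ ^ 2
      ≤ 2 * ∑ i, inner ℝ (gradError Γ S u.xhat i) (Δ i i) := by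
    have a1 : ‖decisions Δ‖ ^ 2 ≤ ‖Δ‖ ^ 2 :=
      pow_le_pow_left₀ (norm_nonneg _) (norm_decisions_le Δ) 2
    rw [PiLp.norm_sq_eq_of_L2] at a1
    have a2 : -∑ i, ‖gradError Γ S u.xhat i‖ ^ 2 - ∑ i, ‖decisions Δ i‖ ^ 2
        ≤ 2 * ∑ i, inner ℝ (gradError Γ S u.xhat i) (Δ i i) := by
      rw [Finset.mul_sum, ← Finset.sum_neg_distrib, ← Finset.sum_sub_distrib]
      refine Finset.sum_le_sum fun i _ => ?_
      have b1 := two_mul_abs_inner_le (gradError Γ S u.xhat i) (Δ i i)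
      have b2 := neg_abs_le (inner ℝ (gradError Γ S u.xhat i) (Δ i i))
      rw [decisions_apply]
      linarith
    linarith
  have e4 : 2 * ((ℓp + p.c * C) * ‖u.xhat - consensus x‖ * ‖Δ‖)
      ≤ μ * ‖u.xhat - consensus x‖ ^ 2 + (ℓp + p.c * C) ^ 2 / μ * ‖Δ‖ ^ 2 := by
    have h : μ * ‖u.xhat - consensus x‖ ^ 2 + (ℓp + p.c * C) ^ 2 / μ * ‖Δ‖ ^ 2
        - 2 * ((ℓp + p.c * C) * ‖u.xhat - consensus x‖ * ‖Δ‖)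
        = (μ * ‖u.xhat - consensus x‖ - (ℓp + p.c * C) * ‖Δ‖) ^ 2 / μ := by
      field_simp; ring
    have : 0 ≤ (μ * ‖u.xhat - consensus x‖ - (ℓp + p.c * C) * ‖Δ‖) ^ 2 / μ := by positivity
    rw [← h] at this
    exact sub_nonneg.1 this
  have e5 : μ * ‖decisions u.xhat - x‖ ^ 2 ≤ μ * ‖u.xhat - consensus x‖ ^ 2 :=
    mul_le_mul_of_nonneg_left
      (pow_le_pow_left₀ (norm_nonneg _) (norm_decisions_le (u.xhat - consensus x)) 2) hμ.le
  rw [e1, e2] at hstep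
  rw [Finset.sum_sub_distrib, ← Finset.mul_sum]
  generalize (ℓp + p.c * C) ^ 2 / μ = q at hmet e4
  rw [mul_add] at hstep
  linarith

/-- The energy bound: the squared distances of the decisions to the equilibrium, summed over the
iterations, are bounded in terms of the initial state and of the gradient errors. -/
theorem exists_energy_bound {D : ∀ i, Set (Vec (Γ.n i))} {η ℓF ℓp c κ : ℝ}
    (hΓ : Γ.Assumptions D η ℓF) (hG : G.Connected) (hw : IsWeighting G w) (hℓp : 0 < ℓp)
    (hFp : Γ.ExtLipschitz D ℓp) (hc : 0 < c) (hc' : CouplingLarge w η ℓF ℓp c) (hκ : 0 < κ)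
    {x : Profile Γ.n} (hx : x ∈ Γ.feasible)
    (hvi : ∀ y ∈ Γ.feasible,
      0 ≤ inner ℝ (Γ.pseudograd x) (y - x) + ∑ i, (Γ.g i (y i) - Γ.g i (x i))) :
    ∃ μ αbar νbar δbar : ℝ, 0 < μ ∧ 0 < αbar ∧ 0 < νbar ∧ 0 < δbar ∧
      ∀ (α : Fin N → ℝ) (ν : ℝ) (δ : Fin N → ℝ), (∀ i, α i ∈ Set.Ioo 0 αbar) →
        ν ∈ Set.Ioo 0 νbar → (∀ i, δ i ∈ Set.Ioo 0 δbar) →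
        (∀ i, α i * κ * ∑ j, w i j ≤ 1) ∧
        ∃ V : Estimates Γ.n × (Fin N → Vec m) × (Fin N → Vec m) → ℝ, Continuous V ∧
          ∀ (S : ℕ → Oracle Γ.n) (s₀ : State Γ.n m), (∀ i l, s₀.xhat i l ∈ D l) →
            (∀ i, s₀.xhat i i ∈ Γ.Ω i) → ∑ i, s₀.z i = 0 → ∀ K : ℕ,
            μ * ∑ k ∈ Finset.range K,
                ‖decisions (iterate Γ w ⟨α, ν, δ, c, κ⟩ S s₀ k).xhat - x‖ ^ 2
              ≤ V (s₀.xhat, s₀.z, s₀.lam) + ∑ k ∈ Finset.range K, ∑ i,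
                (‖gradError Γ (S k) (iterate Γ w ⟨α, ν, δ, c, κ⟩ S s₀ k).xhat i‖ ^ 2
                - 2 * inner ℝ (gradError Γ (S k) (iterate Γ w ⟨α, ν, δ, c, κ⟩ S s₀ k).xhat i)
                  (decisions (iterate Γ w ⟨α, ν, δ, c, κ⟩ S s₀ k).xhat i - x i)) := by
  have hNe : NeZero N := ⟨(Fin.pos_iff_nonempty.2 hG.nonempty).ne'⟩
  obtain ⟨v, l, hK⟩ := exists_isKKT hΓ hG hw hx hvi
  obtain ⟨K', hK', hgap⟩ := exists_spectral_gap hG hw hc'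
  obtain ⟨μ, hμ, hmono⟩ := exists_restricted_strong_monotone hw.symm hΓ hℓp hFp hK' hgap
  obtain ⟨C, hC0, hC⟩ := exists_lapLin_bound w Γ.n
  obtain ⟨T, hT⟩ := exists_incidenceTranspose_rightInverse hG hw m
  obtain ⟨αbar, νbar, δbar, hαb, hνb, hδb, hbar⟩ := exists_stepsizes Γ w G hw hc hκ
    (R := (ℓp + c * C) ^ 2 / μ + 1) (by positivity)
  refine ⟨μ, αbar, νbar, δbar, hμ, hαb, hνb, hδb, fun α ν δ hα hν hδ => ?_⟩
  obtain ⟨hsmall, hmetric⟩ := hbar α ν δ hα hν hδ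
  set p : Params N := ⟨α, ν, δ, c, κ⟩ with hp
  refine ⟨hsmall, fun s => metricSq Γ G w p (s.1 - consensus x) (T s.2.1 - v)
    (s.2.2 - fun _ => l), ?_, fun S s₀ hX hΩ hz K => ?_⟩
  · have hTc : Continuous T := T.continuous_of_finiteDimensional
    have hVc : Continuous (incidenceTransposeLin G w m) :=
      (incidenceTransposeLin G w m).continuous_of_finiteDimensional
    have hAc : ∀ i, Continuous (Γ.A i).toEuclideanLin := fun i =>
      (Γ.A i).toEuclideanLin.continuous_of_finiteDimensional
    simp only [metricSq, ← incidenceTransposeLin_apply]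
    fun_prop
  -- The energy lives on edge variables, so the trajectory is lifted from `v⁰ = T z⁰`; its estimates
  -- are those of the algorithm.
  set u : ℕ → EdgeState Γ.n m G := fun k =>
    Nat.rec ⟨s₀.xhat, T s₀.z, s₀.lam⟩ (fun k u => edgeStep Γ w p G (S k) u) k with hu
  have hus : ∀ k, (u k).toState w = iterate Γ w p S s₀ k := by
    intro k
    induction k with
    | zero => exact State.ext rfl (hT _ hz) rfl
    | succ k ih => rw [iterate, ← ih]; exact toState_edgeStep Γ p hw (S k) (u k)
  have hxhat : ∀ k, (u k).xhat = (iterate Γ w p S s₀ k).xhat := fun k => by rw [← hus]; rfl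
  have hmem := fun k => iterate_mem (p := p) hΓ hw (fun i => (hα i).1) hκ hsmall S hX hΩ k
  have key : ∀ K : ℕ, metricSq Γ G w p ((u K).xhat - consensus x) ((u K).v - v)
        ((u K).lam - fun _ => l)
      + μ * ∑ k ∈ Finset.range K, ‖decisions (iterate Γ w p S s₀ k).xhat - x‖ ^ 2
      ≤ metricSq Γ G w p (s₀.xhat - consensus x) (T s₀.z - v) (s₀.lam - fun _ => l)
        + ∑ k ∈ Finset.range K, ∑ i,
          (‖gradError Γ (S k) (iterate Γ w p S s₀ k).xhat i‖ ^ 2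
          - 2 * inner ℝ (gradError Γ (S k) (iterate Γ w p S s₀ k).xhat i)
            (decisions (iterate Γ w p S s₀ k).xhat i - x i)) := by
    intro K
    induction K with
    | zero => simp [hu]
    | succ K ih =>
      have h1 := metricSq_edgeStep_le_of_gap (p := p) hΓ hℓp hFp hC hK (fun i => (hα i).1) hν.1
        (fun i => (hδ i).1) hc hκ hμ hmono hmetric (S K) (u := u K) (u' := u (K + 1)) rfl
        (fun i => by rw [hxhat]; exact (hmem K).1 i)
      rw [Finset.sum_range_succ, Finset.sum_range_succ, mul_add]
      simp only [hxhat K] at h1 ih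
      linarith
  -- The final energy left over by the telescoping is nonnegative and may be dropped.
  have hnn : 0 ≤ metricSq Γ G w p ((u K).xhat - consensus x) ((u K).v - v)
      ((u K).lam - fun _ => l) :=
    le_trans (by positivity) (hmetric _ _ _)
  linarith [key K]

end Energy

/-! ### A jointly measurable version of the partial gradients -/

section GradSample

variable {N m d : ℕ}

lemma measurable_piLp {ι A : Type*} [Fintype ι] [MeasurableSpace A] {E : ι → Type*}
    [∀ i, NormedAddCommGroup (E i)] [∀ i, MeasurableSpace (E i)] {F : A → PiLp 2 E}
    (h : ∀ i, Measurable fun a => F a i) : Measurable F := by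
  have : F = fun a => WithLp.toLp 2 fun i => F a i := rfl
  rw [this]
  exact (WithLp.measurable_toLp 2 _).comp (measurable_pi_lambda _ h)

/-- A jointly measurable version of the partial gradient: the upper limit of difference
quotients. -/
def gradSample (Γ : Game N m d) (i : Fin N) (x : Profile Γ.n) (s : Vec d) : Vec (Γ.n i) :=
  WithLp.toLp 2 fun r => limsup (fun k : ℕ => ((k : ℝ) + 1) *
    (Γ.f i (setAt x i (x i + ((k : ℝ) + 1)⁻¹ • EuclideanSpace.single r 1)) s - Γ.f i x s)) atTop

variable {Γ : Game N m d} {D : ∀ i, Set (Vec (Γ.n i))} {η ℓF : ℝ}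

lemma measurable_gradSample (hΓ : Γ.Assumptions D η ℓF) (i : Fin N) :
    Measurable fun q : Profile Γ.n × Vec d => gradSample Γ i q.1 q.2 := by
  refine measurable_piLp fun r => Measurable.limsup fun k => ?_
  refine measurable_const.mul (Measurable.sub ?_ (hΓ.f_measurable i))
  refine (hΓ.f_measurable i).comp (Measurable.prodMk ?_ measurable_snd)
  refine (measurable_setAt i).comp (measurable_fst.prodMk ?_)
  have : Continuous fun x : Profile Γ.n =>
      x i + ((k : ℝ) + 1)⁻¹ • (EuclideanSpace.single r 1 : Vec (Γ.n i)) := by fun_prop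
  exact this.measurable.comp measurable_fst

/-- Where `f` is differentiable in the own decision, the difference quotients converge, so their
upper limit is the partial derivative. Differentiability is assumed only on `D` and `Ξ`; the upper
limit provides a version measurable on the whole space. -/
lemma gradSample_eq (hΓ : Γ.Assumptions D η ℓF) {i : Fin N} {x : Profile Γ.n} (hx : x ∈ Γ.box D)
    {s : Vec d} (hs : s ∈ Γ.Ξ i) : gradSample Γ i x s = Γ.partialGrad i x s := by
  ext r
  have hd := hΓ.differentiableAt_f hx hs
  set h : Vec (Γ.n i) → ℝ := fun y => Γ.f i (setAt x i y) s with hh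
  set e : Vec (Γ.n i) := EuclideanSpace.single r 1 with he
  have hpath : HasDerivAt (fun t : ℝ => x i + t • e) e 0 := by
    simpa using ((hasDerivAt_id (0 : ℝ)).smul_const e).const_add (x i)
  have hder : HasDerivAt (fun t : ℝ => h (x i + t • e)) (inner ℝ (gradient h (x i)) e) 0 := by
    have h1 : HasFDerivAt h (InnerProductSpace.toDual ℝ _ (gradient h (x i)))
        (x i + (0 : ℝ) • e) := by
      simpa using hd.hasGradientAt.hasFDerivAt
    have h2 := h1.comp_hasDerivAt (0 : ℝ) hpath
    rwa [InnerProductSpace.toDual_apply_apply] at h2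
  have ht : Tendsto (fun k : ℕ => ((k : ℝ) + 1)⁻¹) atTop (𝓝[>] (0 : ℝ)) := by
    refine tendsto_nhdsWithin_iff.2 ⟨?_, Eventually.of_forall fun k => ?_⟩
    · simpa [one_div] using tendsto_one_div_add_atTop_nhds_zero_nat (𝕜 := ℝ)
    · exact inv_pos.2 (Nat.cast_add_one_pos (α := ℝ) k)
  have hlim := hder.tendsto_slope_zero_right.comp ht
  have hval : inner ℝ (gradient h (x i)) e = Γ.partialGrad i x s r := by
    rw [he, EuclideanSpace.inner_single_right]
    simp [Game.partialGrad, hh]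
  rw [hval] at hlim
  rw [← hlim.limsup_eq]
  simp only [gradSample, Function.comp_def, zero_add, zero_smul, add_zero, inv_inv, smul_eq_mul,
    hh, setAt_self]
  rfl

lemma ae_gradSample_eq (hΓ : Γ.Assumptions D η ℓF) {i : Fin N} {x : Profile Γ.n}
    (hx : x ∈ Γ.box D) : ∀ᵐ s ∂Γ.P, gradSample Γ i x (s i) = Γ.partialGrad i x (s i) := by
  filter_upwards [hΓ.mem_Ξ] with s hs using gradSample_eq hΓ hx (hs i)

lemma integrable_gradSample (hΓ : Γ.Assumptions D η ℓF) (i : Fin N) {x : Profile Γ.n}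
    (hx : x ∈ Γ.box D) : Integrable (fun s => gradSample Γ i x (s i)) Γ.P :=
  (integrable_congr (ae_gradSample_eq hΓ hx)).2 (hΓ.grad_integrable i x hx)

lemma integral_gradSample (hΓ : Γ.Assumptions D η ℓF) (i : Fin N) {x : Profile Γ.n}
    (hx : x ∈ Γ.box D) : ∫ s, gradSample Γ i x (s i) ∂Γ.P = Γ.pseudograd x i :=
  integral_congr_ae (ae_gradSample_eq hΓ hx)

end GradSample

/-! ### Second moments of sample averages -/

section Variance

variable {Θ : Type*} [MeasurableSpace Θ] {μ : Measure Θ}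

/-- Tonelli for the joint law, a product by independence. It plays the role of conditioning on `a`.
-/
lemma lintegral_indep [IsFiniteMeasure μ] {A B : Type*} [MeasurableSpace A] [MeasurableSpace B]
    {a : Θ → A} {b : Θ → B} (ha : Measurable a) (hb : Measurable b) (hab : IndepFun a b μ)
    {h : A × B → ℝ≥0∞} (hh : Measurable h) :
    ∫⁻ θ, h (a θ, b θ) ∂μ = ∫⁻ θ, ∫⁻ θ', h (a θ, b θ') ∂μ ∂μ := by
  have h1 := (indepFun_iff_map_prod_eq_prod_map_map ha.aemeasurable hb.aemeasurable).1 hab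
  rw [← lintegral_map (f := h) hh (ha.prodMk hb), h1, lintegral_prod _ hh.aemeasurable,
    lintegral_map hh.lintegral_prod_right' ha]
  refine lintegral_congr fun θ => ?_
  exact lintegral_map (hh.comp measurable_prodMk_left) hb

lemma integral_indep [IsFiniteMeasure μ] {A B : Type*} [MeasurableSpace A] [MeasurableSpace B]
    {a : Θ → A} {b : Θ → B} (ha : Measurable a) (hb : Measurable b) (hab : IndepFun a b μ)
    {h : A × B → ℝ} (hh : Measurable h) (hi : Integrable (fun θ => h (a θ, b θ)) μ) :
    ∫ θ, h (a θ, b θ) ∂μ = ∫ θ, ∫ θ', h (a θ, b θ') ∂μ ∂μ := by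
  have h1 := (indepFun_iff_map_prod_eq_prod_map_map ha.aemeasurable hb.aemeasurable).1 hab
  have hi' : Integrable h ((μ.map a).prod (μ.map b)) := by
    rw [← h1]
    exact (integrable_map_measure hh.aestronglyMeasurable (ha.prodMk hb).aemeasurable).2 hi
  rw [← integral_map (f := h) (ha.prodMk hb).aemeasurable hh.aestronglyMeasurable, h1,
    integral_prod _ hi', integral_map ha.aemeasurable
      hh.stronglyMeasurable.integral_prod_right'.aestronglyMeasurable]
  refine integral_congr_ae (Eventually.of_forall fun θ => ?_)
  exact integral_map hb.aemeasurable (hh.comp measurable_prodMk_left).aestronglyMeasurable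

/-- By Tonelli `y + X` is square integrable for almost every value `y` of `Y`; one such value
suffices, since constants are square integrable. -/
lemma memLp_two_of_add_indep [IsProbabilityMeasure μ] {X Y : Θ → ℝ} (hX : Measurable X)
    (hY : Measurable Y) (hXY : IndepFun X Y μ) (h : MemLp (X + Y) 2 μ) : MemLp X 2 μ := by
  have h1 : ∫⁻ θ, ‖Y θ + X θ‖ₑ ^ 2 ∂μ < ∞ := by
    have := (eLpNorm_lt_top_iff_lintegral_rpow_enorm_lt_top two_ne_zero ENNReal.ofNat_ne_top).1 h.2
    simpa [add_comm] using this
  rw [lintegral_indep (h := fun q : ℝ × ℝ => ‖q.1 + q.2‖ₑ ^ 2) hY hX hXY.symm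
    (by fun_prop)] at h1
  have hmeas : Measurable fun θ => ∫⁻ θ', ‖Y θ + X θ'‖ₑ ^ 2 ∂μ :=
    Measurable.lintegral_prod_right' (f := fun q : Θ × Θ => ‖Y q.1 + X q.2‖ₑ ^ 2) (by fun_prop)
  obtain ⟨θ, hθ⟩ := (ae_lt_top hmeas h1.ne).exists
  have h2 : MemLp (fun θ' => Y θ + X θ') 2 μ := by
    refine ⟨(by fun_prop : Measurable _).aestronglyMeasurable, ?_⟩
    rw [eLpNorm_lt_top_iff_lintegral_rpow_enorm_lt_top two_ne_zero ENNReal.ofNat_ne_top]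
    simpa using hθ
  have h3 := h2.sub (memLp_const (Y θ))
  convert h3 using 1
  ext θ'; simp

variable {A : Type*} [MeasurableSpace A] {P : Measure A} {X : ℕ → Θ → A} {φ : A → ℝ}

/-- The last summand is independent of the sum of the others, so it inherits square integrability
from the total. -/
lemma memLp_two_of_memLp_sum [IsProbabilityMeasure μ] (hX : ∀ t, Measurable (X t))
    (hlaw : ∀ t, μ.map (X t) = P) (hind : iIndepFun X μ) (hφ : Measurable φ) {M : ℕ} (hM : M ≠ 0)
    (h : MemLp (fun θ => ∑ t ∈ Finset.range M, φ (X t θ)) 2 μ) : MemLp φ 2 P := by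
  obtain ⟨M, rfl⟩ := Nat.exists_eq_succ_of_ne_zero hM
  have hind' : iIndepFun (fun t θ => φ (X t θ)) μ := hind.comp (fun _ => φ) fun _ => hφ
  have h1 : IndepFun (fun θ => φ (X M θ)) (∑ t ∈ Finset.range M, fun θ => φ (X t θ)) μ :=
    (hind'.indepFun_finsetSum_of_notMem (fun t => hφ.comp (hX t)) (by simp)).symm
  have h2 : MemLp (fun θ => φ (X M θ)) 2 μ := by
    refine memLp_two_of_add_indep (hφ.comp (hX M)) ?_ h1 ?_
    · rw [Finset.sum_fn]
      exact Finset.measurable_fun_sum _ fun t _ => hφ.comp (hX t)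
    · convert h using 1
      ext θ
      simp [Finset.sum_range_succ, add_comm]
  rw [← hlaw M]
  exact (memLp_map_measure_iff hφ.aestronglyMeasurable (hX M).aemeasurable).2 h2

/-- Variances of independent centered variables add. -/
lemma integral_sq_average [IsProbabilityMeasure μ] (hX : ∀ t, Measurable (X t))
    (hlaw : ∀ t, μ.map (X t) = P) (hind : iIndepFun X μ) (hφ : Measurable φ) (hφ2 : MemLp φ 2 P)
    (hφ0 : ∫ s, φ s ∂P = 0) {M : ℕ} (hM : M ≠ 0) :
    ∫ θ, ((M : ℝ)⁻¹ * ∑ t ∈ Finset.range M, φ (X t θ)) ^ 2 ∂μ = (∫ s, φ s ^ 2 ∂P) / M := by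
  have hL2 : ∀ t, MemLp (fun θ => φ (X t θ)) 2 μ := fun t => by
    rw [← hlaw t] at hφ2
    exact (memLp_map_measure_iff hφ.aestronglyMeasurable (hX t).aemeasurable).1 hφ2
  have hmean : ∀ t, ∫ θ, φ (X t θ) ∂μ = 0 := fun t => by
    rw [← hφ0, ← hlaw t, integral_map (hX t).aemeasurable hφ.aestronglyMeasurable]
  have hsq : ∀ t, variance (fun θ => φ (X t θ)) μ = ∫ s, φ s ^ 2 ∂P := fun t => by
    rw [variance_of_integral_eq_zero (hL2 t).aemeasurable (hmean t), ← hlaw t,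
      integral_map (hX t).aemeasurable (hφ.pow_const 2).aestronglyMeasurable]
  have hind' : iIndepFun (fun t θ => φ (X t θ)) μ := hind.comp (fun _ => φ) fun _ => hφ
  have hvar := IndepFun.variance_sum (s := Finset.range M) (fun t _ => hL2 t)
    (fun t _ t' _ htt' => hind'.indepFun htt')
  have hsum : ∫ θ, (∑ t ∈ Finset.range M, fun θ => φ (X t θ)) θ ∂μ = 0 := by
    simp only [Finset.sum_apply]
    rw [integral_finsetSum _ fun t _ => (hL2 t).integrable one_le_two]
    simp [hmean]
  rw [variance_of_integral_eq_zero (memLp_finsetSum' _ fun t _ => hL2 t).aemeasurable hsum] at hvar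
  simp only [hsq, Finset.sum_const, Finset.card_range, nsmul_eq_mul, Finset.sum_apply] at hvar
  simp only [mul_pow]
  rw [integral_const_mul, hvar]
  have : (M : ℝ) ≠ 0 := Nat.cast_ne_zero.2 hM
  field_simp

lemma lintegral_enorm_sq_eq {f : Θ → ℝ} (hf : MemLp f 2 μ) :
    ∫⁻ θ, ‖f θ‖ₑ ^ 2 ∂μ = ENNReal.ofReal (∫ θ, f θ ^ 2 ∂μ) := by
  rw [ofReal_integral_eq_lintegral_ofReal hf.integrable_sq
    (Eventually.of_forall fun θ => sq_nonneg _)]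
  refine lintegral_congr fun θ => ?_
  rw [← ofReal_norm, ← ENNReal.ofReal_pow (norm_nonneg _), Real.norm_eq_abs, sq_abs]

lemma memLp_two_of_lintegral {E : Type*} [NormedAddCommGroup E] {f : Θ → E}
    (hf : AEStronglyMeasurable f μ) (h : ∫⁻ θ, ‖f θ‖ₑ ^ 2 ∂μ < ∞) : MemLp f 2 μ := by
  refine ⟨hf, ?_⟩
  rw [eLpNorm_lt_top_iff_lintegral_rpow_enorm_lt_top two_ne_zero ENNReal.ofNat_ne_top]
  simpa using h

/-- If a sample average of a centered function has a finite second moment, then the second moment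
of all sample averages decreases like the inverse of the sample size. -/
lemma lintegral_sq_average_le [IsProbabilityMeasure μ] {X' : ℕ → Θ → A} (hX : ∀ t, Measurable (X t))
    (hlaw : ∀ t, μ.map (X t) = P) (hind : iIndepFun X μ) (hX' : ∀ t, Measurable (X' t))
    (hlaw' : ∀ t, μ.map (X' t) = P) (hind' : iIndepFun X' μ) (hφ : Measurable φ)
    (hφ0 : ∫ s, φ s ∂P = 0) {M M' : ℕ} (hM : M ≠ 0) (hM' : M' ≠ 0) {σ : ℝ}
    (h : ∫⁻ θ, ‖(M : ℝ)⁻¹ * ∑ t ∈ Finset.range M, φ (X t θ)‖ₑ ^ 2 ∂μ ≤ ENNReal.ofReal (σ ^ 2)) :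
    ∫⁻ θ, ‖(M' : ℝ)⁻¹ * ∑ t ∈ Finset.range M', φ (X' t θ)‖ₑ ^ 2 ∂μ
      ≤ ENNReal.ofReal (M * σ ^ 2 / M') := by
  have hMr : (M : ℝ) ≠ 0 := Nat.cast_ne_zero.2 hM
  have hmeas : ∀ (X : ℕ → Θ → A), (∀ t, Measurable (X t)) → ∀ M : ℕ,
      Measurable fun θ => (M : ℝ)⁻¹ * ∑ t ∈ Finset.range M, φ (X t θ) := fun X hX M =>
    measurable_const.mul (Finset.measurable_fun_sum _ fun t _ => hφ.comp (hX t))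
  have h1 : MemLp (fun θ => (M : ℝ)⁻¹ * ∑ t ∈ Finset.range M, φ (X t θ)) 2 μ :=
    memLp_two_of_lintegral (hmeas X hX M).aestronglyMeasurable
      (h.trans_lt ENNReal.ofReal_lt_top)
  have h2 : MemLp φ 2 P := by
    refine memLp_two_of_memLp_sum hX hlaw hind hφ hM ?_
    convert h1.const_mul (M : ℝ) using 1
    ext θ
    rw [mul_inv_cancel_left₀ hMr]
  have h3 := integral_sq_average hX hlaw hind hφ h2 hφ0 hM
  have h4 := integral_sq_average hX' hlaw' hind' hφ h2 hφ0 hM'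
  -- Read backwards, the bound on the average over `M` samples gives `E φ² ≤ M σ²` for a single
  -- sample.
  rw [lintegral_enorm_sq_eq h1, ENNReal.ofReal_le_ofReal_iff (sq_nonneg _), h3,
    div_le_iff₀ (by positivity)] at h
  have hL2 : ∀ t, MemLp (fun θ => φ (X' t θ)) 2 μ := fun t => by
    rw [← hlaw' t] at h2
    exact (memLp_map_measure_iff hφ.aestronglyMeasurable (hX' t).aemeasurable).1 h2
  have h5' : MemLp (fun θ => ∑ t ∈ Finset.range M', φ (X' t θ)) 2 μ :=
    memLp_finsetSum _ fun t _ => hL2 t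
  have h5 := h5'.const_mul (M' : ℝ)⁻¹
  rw [lintegral_enorm_sq_eq h5, h4]
  refine ENNReal.ofReal_le_ofReal ?_
  have : (0 : ℝ) < M' := Nat.cast_pos.2 (Nat.pos_of_ne_zero hM')
  rw [mul_comm (M : ℝ)]
  gcongr

end Variance

/-! ### Independence of the current state and the future samples -/

section Independence

variable {Θ : Type*} [mΘ : MeasurableSpace Θ] {μ : Measure Θ}

/-- The law of the triple `(a, b, c)` is the product of the three laws, which can be reassociated.
This is the induction step that moves a consumed batch from the future into the past. -/
lemma indepFun_prodMk_of_indepFun [IsProbabilityMeasure μ] {A B C : Type*} [MeasurableSpace A]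
    [MeasurableSpace B] [MeasurableSpace C] {a : Θ → A} {b : Θ → B} {c : Θ → C} (ha : Measurable a)
    (hb : Measurable b) (hc : Measurable c) (habc : IndepFun a (fun θ => (b θ, c θ)) μ)
    (hbc : IndepFun b c μ) : IndepFun (fun θ => (a θ, b θ)) c μ := by
  have hab : IndepFun a b μ := habc.comp measurable_id measurable_fst
  rw [indepFun_iff_map_prod_eq_prod_map_map (ha.prodMk hb).aemeasurable hc.aemeasurable,
    (indepFun_iff_map_prod_eq_prod_map_map ha.aemeasurable hb.aemeasurable).1 hab]
  have h1 := (indepFun_iff_map_prod_eq_prod_map_map ha.aemeasurable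
    (hb.prodMk hc).aemeasurable).1 habc
  rw [(indepFun_iff_map_prod_eq_prod_map_map hb.aemeasurable hc.aemeasurable).1 hbc] at h1
  have := Measure.isProbabilityMeasure_map (μ := μ) ha.aemeasurable
  have := Measure.isProbabilityMeasure_map (μ := μ) hb.aemeasurable
  have := Measure.isProbabilityMeasure_map (μ := μ) hc.aemeasurable
  have h2 := (measurePreserving_prodAssoc (μ.map a) (μ.map b) (μ.map c)).symm.map_eq
  rw [← h2, ← h1, Measure.map_map MeasurableEquiv.prodAssoc.symm.measurable
    (ha.prodMk (hb.prodMk hc))]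
  rfl

lemma comap_pi_le {Θ ι S : Type*} [MeasurableSpace S] {m : MeasurableSpace Θ} {f : Θ → ι → S}
    (h : ∀ i, MeasurableSpace.comap (fun θ => f θ i) inferInstance ≤ m) :
    MeasurableSpace.comap f MeasurableSpace.pi ≤ m :=
  (measurable_pi_lambda _ fun i => measurable_iff_comap_le.2 (h i)).comap_le

/-- The two are measurable with respect to samples indexed by disjoint sets. -/
lemma indepFun_block_tail {S : Type*} [MeasurableSpace S] {ξ : ℕ → ℕ → Θ → S}
    (hξ : ∀ k t, Measurable (ξ k t)) (hind : iIndepFun (fun q : ℕ × ℕ => ξ q.1 q.2) μ) (k : ℕ) :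
    IndepFun (fun θ t => ξ k t θ) (fun θ (j t : ℕ) => ξ (k + 1 + j) t θ) μ := by
  set m : ℕ × ℕ → MeasurableSpace Θ := fun q => MeasurableSpace.comap (ξ q.1 q.2) inferInstance
  have hle : ∀ q, m q ≤ mΘ := fun q => (hξ q.1 q.2).comap_le
  have hdisj : Disjoint {q : ℕ × ℕ | q.1 = k} {q : ℕ × ℕ | k < q.1} := by
    rw [Set.disjoint_left]
    exact fun q hq hq' => (Nat.ne_of_gt hq') hq
  have h := indep_iSup_of_disjoint hle hind hdisj
  refine indep_of_indep_of_le_left (indep_of_indep_of_le_right h ?_) ?_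
  · exact comap_pi_le fun j => comap_pi_le fun t =>
      le_iSup₂_of_le (k + 1 + j, t) (show k < k + 1 + j by omega) le_rfl
  · exact comap_pi_le fun t => le_iSup₂_of_le (k, t) rfl le_rfl

variable {N m d : ℕ} {Γ : Game N m d} {w : Matrix (Fin N) (Fin N) ℝ} {p : Params N}
  {D : ∀ i, Set (Vec (Γ.n i))} {η ℓF : ℝ}

/-- The average over a batch of the measurable version of the partial gradients. -/
def batchOracle (Γ : Game N m d) (M : ℕ) (b : ℕ → Fin N → Vec d) : Oracle Γ.n :=
  fun i x => (M : ℝ)⁻¹ • ∑ t ∈ Finset.range M, gradSample Γ i x (b t i)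

/-- The components of a state. -/
def State.tuple {n : Fin N → ℕ} (s : State n m) :
    Estimates n × (Fin N → Vec m) × (Fin N → Vec m) := (s.xhat, s.z, s.lam)

/-- One iteration as a function of the components of the state and of the batch. -/
def tupleStep (Γ : Game N m d) (w : Matrix (Fin N) (Fin N) ℝ) (p : Params N) (M : ℕ)
    (q : (Estimates Γ.n × (Fin N → Vec m) × (Fin N → Vec m)) × (ℕ → Fin N → Vec d)) :
    Estimates Γ.n × (Fin N → Vec m) × (Fin N → Vec m) :=
  (step Γ w p (batchOracle Γ M q.2) ⟨q.1.1, q.1.2.1, q.1.2.2⟩).tuple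

lemma measurable_batchOracle {A : Type*} [MeasurableSpace A] (hΓ : Γ.Assumptions D η ℓF) (M : ℕ)
    (i : Fin N) {x : A → Profile Γ.n} {b : A → ℕ → Fin N → Vec d} (hx : Measurable x)
    (hb : Measurable b) : Measurable fun a => batchOracle Γ M (b a) i (x a) := by
  have h : ∀ t, Measurable fun a => gradSample Γ i (x a) (b a t i) := fun t => by
    have h1 := measurable_gradSample hΓ i
    have h2 : Measurable fun a => (x a, b a t i) := Measurable.prodMk hx (by fun_prop)
    have h3 := h1.comp h2
    exact h3
  have h4 : Measurable fun a => ∑ t ∈ Finset.range M, gradSample Γ i (x a) (b a t i) :=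
    Finset.measurable_fun_sum _ fun t _ => h t
  have h5 := h4.const_smul (M : ℝ)⁻¹
  exact h5

lemma measurable_toEuclideanLin {q q' : ℕ} (A : Matrix (Fin q) (Fin q') ℝ) :
    Measurable A.toEuclideanLin :=
  A.toEuclideanLin.continuous_of_finiteDimensional.measurable

/-! ### Measurability of one iteration. -/

section Step

variable {A : Type*} [MeasurableSpace A]

lemma measurable_weighted_sum {q : ℕ} {f : Fin N → A → Vec q} (hf : ∀ i, Measurable (f i))
    (i : Fin N) : Measurable fun a => ∑ j, w i j • (f i a - f j a) :=
  Finset.measurable_fun_sum _ fun j _ => ((hf i).sub (hf j)).const_smul (w i j)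

variable {X : A → Estimates Γ.n} {lam : A → Fin N → Vec m} {S : A → Oracle Γ.n}

lemma measurable_nextDecision (hΓ : Γ.Assumptions D η ℓF) {i : Fin N} (hα : 0 ≤ p.α i)
    (hX : ∀ i l, Measurable fun a => X a i l) (hl : Measurable fun a => lam a i)
    (hS : Measurable fun a => S a i (X a i)) :
    Measurable fun a => nextDecision Γ w p (S a) (X a) (lam a) i := by
  have h1 : Measurable fun a => S a i (X a i) + (Γ.A i).transpose.toEuclideanLin (lam a i)
      + p.c • ∑ j, w i j • (X a i i - X a j i) :=
    (hS.add ((measurable_toEuclideanLin _).comp hl)).add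
      ((measurable_weighted_sum (f := fun j a => X a j i) (fun j => hX j i) i).const_smul p.c)
  exact (continuous_prox (hΓ.Ω_compact i) (hΓ.Ω_nonempty i) (hΓ.g_lsc i) (hΓ.g_convex i)
    hα).measurable.comp ((hX i i).sub (h1.const_smul (p.α i)))

lemma measurable_nextEstimates (hΓ : Γ.Assumptions D η ℓF) (hα : ∀ i, 0 ≤ p.α i)
    (hX : ∀ i l, Measurable fun a => X a i l) (hl : ∀ i, Measurable fun a => lam a i)
    (hS : ∀ i, Measurable fun a => S a i (X a i)) (i l : Fin N) :
    Measurable fun a => nextEstimates Γ w p (S a) (X a) (lam a) i l := by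
  by_cases h : l = i
  · subst h
    simp only [nextEstimates_same]
    exact measurable_nextDecision hΓ (hα l) hX (hl l) (hS l)
  · simp only [nextEstimates_of_ne _ _ _ h, lapAt_apply]
    exact (hX i l).sub ((measurable_weighted_sum (f := fun j a => X a j l)
      (fun j => hX j l) i).const_smul (p.α i * p.κ))

lemma measurable_tuple_step (hΓ : Γ.Assumptions D η ℓF) (hα : ∀ i, 0 ≤ p.α i)
    {z : A → Fin N → Vec m} (hX : ∀ i l, Measurable fun a => X a i l)
    (hz : ∀ i, Measurable fun a => z a i) (hl : ∀ i, Measurable fun a => lam a i)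
    (hS : ∀ i, Measurable fun a => S a i (X a i)) :
    Measurable fun a => (step Γ w p (S a) ⟨X a, z a, lam a⟩).tuple := by
  have hest := fun i l => measurable_nextEstimates (w := w) hΓ hα hX hl hS i l
  have hz' : ∀ i, Measurable fun a => z a i + p.ν • ∑ j, w i j • (lam a i - lam a j) := fun i =>
    (hz i).add ((measurable_weighted_sum (f := fun j a => lam a j) hl i).const_smul p.ν)
  have hlam : ∀ i, Measurable fun a => lam a i + p.δ i •
      ((2 : ℝ) • (Γ.A i).toEuclideanLin (nextEstimates Γ w p (S a) (X a) (lam a) i i)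
        - (Γ.A i).toEuclideanLin (X a i i) - Γ.b i
        - (2 : ℝ) • (z a i + p.ν • ∑ j, w i j • (lam a i - lam a j)) + z a i) := fun i => by
    have h1 := ((measurable_toEuclideanLin (Γ.A i)).comp (hest i i)).const_smul (2 : ℝ)
    have h2 := (measurable_toEuclideanLin (Γ.A i)).comp (hX i i)
    have h3 := (hz' i).const_smul (2 : ℝ)
    exact (hl i).add (((((h1.sub h2).sub_const (Γ.b i)).sub h3).add (hz i)).const_smul (p.δ i))
  exact Measurable.prodMk (measurable_piLp fun i => measurable_piLp fun l => hest i l)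
    (Measurable.prodMk (measurable_pi_lambda _ hz')
      (measurable_pi_lambda _ fun i => continuous_projNonneg.measurable.comp (hlam i)))

end Step

lemma measurable_tupleStep (hΓ : Γ.Assumptions D η ℓF) (hα : ∀ i, 0 ≤ p.α i) (M : ℕ) :
    Measurable (tupleStep Γ w p M) := by
  have hX : ∀ i, Measurable fun X : Estimates Γ.n => X i := fun i =>
    (by fun_prop : Continuous fun X : Estimates Γ.n => X i).measurable
  have hXl : ∀ i l, Measurable fun X : Estimates Γ.n => X i l := fun i l =>
    (by fun_prop : Continuous fun X : Estimates Γ.n => X i l).measurable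
  set A := (Estimates Γ.n × (Fin N → Vec m) × (Fin N → Vec m)) × (ℕ → Fin N → Vec d)
  have hq : Measurable fun q : A => q.1.1 := measurable_fst.comp measurable_fst
  have hz : ∀ i, Measurable fun q : A => q.1.2.1 i := fun i => by fun_prop
  have hl : ∀ i, Measurable fun q : A => q.1.2.2 i := fun i => by fun_prop
  have hXq : ∀ i, Measurable fun q : A => q.1.1 i := fun i => (hX i).comp hq
  have hXlq : ∀ i l, Measurable fun q : A => q.1.1 i l := fun i l => (hXl i l).comp hq
  have hS : ∀ i, Measurable fun q : A => batchOracle Γ M q.2 i (q.1.1 i) := fun i =>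
    measurable_batchOracle hΓ M i (hXq i) measurable_snd
  exact measurable_tuple_step (S := fun q : A => batchOracle Γ M q.2) hΓ hα hXlq hz hl hS

/-- The components of the iterates are measurable, and they are, together with the initial state,
independent of the samples of the present and of the future. -/
lemma measurable_indepFun_iterate [IsProbabilityMeasure μ] (hΓ : Γ.Assumptions D η ℓF)
    (hα : ∀ i, 0 ≤ p.α i) {M : ℕ → ℕ} {ξ : ℕ → ℕ → Θ → Fin N → Vec d} (hξ : IsIIDSampling Γ μ ξ)
    {s₀ : Θ → State Γ.n m} (hs₀ : IsInit Γ μ D ξ s₀) (k : ℕ) :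
    Measurable (fun θ => (iterate Γ w p (fun k => batchOracle Γ (M k) fun t => ξ k t θ)
      (s₀ θ) k).tuple) ∧
    IndepFun (fun θ => ((s₀ θ).tuple, (iterate Γ w p
      (fun k => batchOracle Γ (M k) fun t => ξ k t θ) (s₀ θ) k).tuple))
      (fun θ (j t : ℕ) => ξ (k + j) t θ) μ := by
  have hm₀ : Measurable fun θ => (s₀ θ).tuple := hs₀.measurable
  have htail : ∀ k, Measurable fun θ (j t : ℕ) => ξ (k + j) t θ := fun k =>
    measurable_pi_lambda _ fun j => measurable_pi_lambda _ fun t => hξ.measurable _ _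
  have hblk : ∀ k, Measurable fun θ (t : ℕ) => ξ k t θ := fun k =>
    measurable_pi_lambda _ fun t => hξ.measurable _ _
  induction k with
  | zero =>
    refine ⟨hm₀, ?_⟩
    have hφ : Measurable fun s : Estimates Γ.n × (Fin N → Vec m) × (Fin N → Vec m) => (s, s) :=
      measurable_id.prodMk measurable_id
    have hψ : Measurable fun (f : ℕ × ℕ → Fin N → Vec d) (j t : ℕ) => f (0 + j, t) :=
      measurable_pi_lambda _ fun j => measurable_pi_lambda _ fun t => measurable_pi_apply _
    exact hs₀.indep.comp hφ hψ
  | succ k ih =>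
    have heq : ∀ θ, (iterate Γ w p (fun k => batchOracle Γ (M k) fun t => ξ k t θ)
        (s₀ θ) (k + 1)).tuple = tupleStep Γ w p (M k)
          ((iterate Γ w p (fun k => batchOracle Γ (M k) fun t => ξ k t θ) (s₀ θ) k).tuple,
            fun t => ξ k t θ) := fun θ => rfl
    simp only [heq]
    refine ⟨(measurable_tupleStep hΓ hα (M k)).comp (ih.1.prodMk (hblk k)), ?_⟩
    -- The samples from time `k` on split into batch `k`, which the step consumes, and the samples
    -- from time `k + 1` on.
    have hψ : Measurable fun f : ℕ → ℕ → Fin N → Vec d => (f 0, fun j => f (1 + j)) :=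
      (measurable_pi_apply 0).prodMk (measurable_pi_lambda _ fun j => measurable_pi_apply _)
    have h1 := ih.2.comp measurable_id hψ
    have h2 : IndepFun (fun θ => ((s₀ θ).tuple, (iterate Γ w p
        (fun k => batchOracle Γ (M k) fun t => ξ k t θ) (s₀ θ) k).tuple))
        (fun θ => ((fun t => ξ k t θ), fun j t => ξ (k + 1 + j) t θ)) μ := by
      convert h1 using 1
      · rfl
      · funext θ
        simp only [Function.comp_apply, add_zero, add_assoc]
    have h3 := indepFun_prodMk_of_indepFun (hm₀.prodMk ih.1) (hblk k) (htail (k + 1)) h2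
      (indepFun_block_tail hξ.measurable hξ.indep k)
    have hφ : Measurable fun q : ((Estimates Γ.n × (Fin N → Vec m) × (Fin N → Vec m)) ×
        (Estimates Γ.n × (Fin N → Vec m) × (Fin N → Vec m))) × (ℕ → Fin N → Vec d) =>
        (q.1.1, tupleStep Γ w p (M k) (q.1.2, q.2)) :=
      (measurable_fst.comp measurable_fst).prodMk ((measurable_tupleStep hΓ hα (M k)).comp
        ((measurable_snd.comp measurable_fst).prodMk measurable_snd))
    exact h3.comp hφ measurable_id

end Independence

/-! ### Moments of the gradient errors -/

section Moments

variable {N m d : ℕ} {Γ : Game N m d} {w : Matrix (Fin N) (Fin N) ℝ} {p : Params N}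
  {D : ∀ i, Set (Vec (Γ.n i))} {η ℓF : ℝ} {Θ : Type*} [MeasurableSpace Θ] {μ : Measure Θ}
  {M : ℕ → ℕ} {ξ : ℕ → ℕ → Θ → Fin N → Vec d}

/-- The error of a batch average of the measurable version of the partial gradients. -/
def batchError (Γ : Game N m d) (M : ℕ) (i : Fin N) (x : Profile Γ.n) (b : ℕ → Fin N → Vec d) :
    Vec (Γ.n i) := batchOracle Γ M b i x - ∫ s, gradSample Γ i x (s i) ∂Γ.P

/-- Centering with the integral of `gradSample` instead of the pseudogradient keeps the error
measurable in `x` outside `D` as well; on `D` the two coincide. -/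
lemma measurable_batchError {A : Type*} [MeasurableSpace A] (hΓ : Γ.Assumptions D η ℓF) (M : ℕ)
    (i : Fin N) {x : A → Profile Γ.n} {b : A → ℕ → Fin N → Vec d} (hx : Measurable x)
    (hb : Measurable b) : Measurable fun a => batchError Γ M i (x a) (b a) := by
  have := hΓ.prob
  have h1 : Measurable fun q : Profile Γ.n × (Fin N → Vec d) => gradSample Γ i q.1 (q.2 i) := by
    have h2 : Measurable fun q : Profile Γ.n × (Fin N → Vec d) => (q.1, q.2 i) := by fun_prop
    have h3 := (measurable_gradSample hΓ i).comp h2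
    exact h3
  have h4 : Measurable fun x : Profile Γ.n => ∫ s, gradSample Γ i x (s i) ∂Γ.P :=
    h1.stronglyMeasurable.integral_prod_right'.measurable
  have h5 := (measurable_batchOracle hΓ M i hx hb).sub (h4.comp hx)
  exact h5

lemma ae_mem_Ξ (hΓ : Γ.Assumptions D η ℓF) (hξ : IsIIDSampling Γ μ ξ) :
    ∀ᵐ θ ∂μ, ∀ k t i, ξ k t θ i ∈ Γ.Ξ i := by
  rw [ae_all_iff]
  intro k
  rw [ae_all_iff]
  intro t
  have h := hΓ.mem_Ξ
  rw [← hξ.law k t] at h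
  exact ae_of_ae_map (hξ.measurable k t).aemeasurable h

lemma batchError_apply {M : ℕ} (hM : M ≠ 0) (i : Fin N) (x : Profile Γ.n)
    (b : ℕ → Fin N → Vec d) (r : Fin (Γ.n i)) :
    batchError Γ M i x b r = (M : ℝ)⁻¹ * ∑ t ∈ Finset.range M,
      (gradSample Γ i x (b t i) - ∫ s, gradSample Γ i x (s i) ∂Γ.P) r := by
  have hMr : (M : ℝ) ≠ 0 := Nat.cast_ne_zero.2 hM
  simp only [batchError, batchOracle, PiLp.sub_apply, Finset.sum_sub_distrib, Finset.sum_const,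
    Finset.card_range, nsmul_eq_mul, mul_sub, PiLp.smul_apply, WithLp.ofLp_sum, Finset.sum_apply,
    smul_eq_mul]
  rw [inv_mul_cancel_left₀ hMr]

lemma batchError_eq_gradError (hΓ : Γ.Assumptions D η ℓF) (M : ℕ) (i : Fin N) (X : Estimates Γ.n)
    (hX : X i ∈ Γ.box D) (b : ℕ → Fin N → Vec d) :
    gradError Γ (batchOracle Γ M b) X i = batchError Γ M i (X i) b := by
  rw [gradError, batchError, integral_gradSample hΓ i hX]

lemma integral_batchError [IsProbabilityMeasure μ] (hΓ : Γ.Assumptions D η ℓF)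
    (hξ : IsIIDSampling Γ μ ξ) (k : ℕ) (hM : M k ≠ 0) (i : Fin N) {x : Profile Γ.n}
    (hx : x ∈ Γ.box D) : Integrable (fun θ => batchError Γ (M k) i x fun t => ξ k t θ) μ ∧
      ∫ θ, batchError Γ (M k) i x (fun t => ξ k t θ) ∂μ = 0 := by
  have hMr : (M k : ℝ) ≠ 0 := Nat.cast_ne_zero.2 hM
  have hint := integrable_gradSample hΓ i hx
  have h1 : ∀ t, Integrable (fun θ => gradSample Γ i x (ξ k t θ i)) μ := fun t => by
    have h := hint
    rw [← hξ.law k t] at h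
    exact h.comp_measurable (hξ.measurable k t)
  have h2 : ∀ t, ∫ θ, gradSample Γ i x (ξ k t θ i) ∂μ = ∫ s, gradSample Γ i x (s i) ∂Γ.P :=
      fun t => by
    have h := hint.aestronglyMeasurable
    rw [← hξ.law k t] at h
    rw [← integral_map (hξ.measurable k t).aemeasurable h, hξ.law k t]
  have h3 : Integrable (fun θ => ∑ t ∈ Finset.range (M k), gradSample Γ i x (ξ k t θ i)) μ :=
    integrable_finsetSum _ fun t _ => h1 t
  have h4 : Integrable (fun θ => batchOracle Γ (M k) (fun t => ξ k t θ) i x) μ :=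
    h3.smul (M k : ℝ)⁻¹
  refine ⟨h4.sub (integrable_const _), ?_⟩
  simp only [batchError]
  rw [integral_sub h4 (integrable_const _), integral_const, probReal_univ, one_smul]
  simp only [batchOracle]
  rw [integral_smul, integral_finsetSum _ fun t _ => h1 t]
  simp only [h2, Finset.sum_const, Finset.card_range]
  rw [← Nat.cast_smul_eq_nsmul ℝ, smul_smul, inv_mul_cancel₀ hMr, one_smul, sub_self]

lemma enorm_sq_eq_sum {q : ℕ} (v : Vec q) : ‖v‖ₑ ^ 2 = ∑ r, ‖v r‖ₑ ^ 2 := by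
  rw [← ofReal_norm, ← ENNReal.ofReal_pow (norm_nonneg _), PiLp.norm_sq_eq_of_L2,
    ENNReal.ofReal_sum_of_nonneg fun r _ => sq_nonneg _]
  refine Finset.sum_congr rfl fun r _ => ?_
  rw [← ofReal_norm, ← ENNReal.ofReal_pow (norm_nonneg _)]

lemma enorm_apply_le {ι : Type*} [Fintype ι] {E : ι → Type*} [∀ i, NormedAddCommGroup (E i)]
    (v : PiLp 2 E) (i : ι) : ‖v i‖ₑ ≤ ‖v‖ₑ := by
  rw [← ofReal_norm, ← ofReal_norm]
  exact ENNReal.ofReal_le_ofReal (PiLp.norm_apply_le v i)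

/-- The second moments of the batch errors decrease like the inverse of the batch sizes. -/
lemma exists_lintegral_batchError_le [IsProbabilityMeasure μ] (hΓ : Γ.Assumptions D η ℓF)
    (hξ : IsIIDSampling Γ μ ξ) (hM : ∀ k, M k ≠ 0) (hvar : BoundedVariance Γ μ D M ξ) :
    ∃ B : ℝ, 0 ≤ B ∧ ∀ k i, ∀ x ∈ Γ.box D,
      ∫⁻ θ, ‖batchError Γ (M k) i x (fun t => ξ k t θ)‖ₑ ^ 2 ∂μ ≤ ENNReal.ofReal (B / M k) := by
  obtain ⟨σ, hσ, hvar⟩ := hvar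
  -- `M 0 * σ ^ 2` bounds the variance of each coordinate of one sampled gradient, inferred from
  -- batch 0 alone. Summing over the coordinates gives `Γ.n i`, and summing over the agents makes
  -- the bound uniform in `i`.
  refine ⟨∑ i, (Γ.n i : ℝ) * (M 0 * σ ^ 2), by positivity, fun k i x hx => ?_⟩
  have hcoord : ∀ r, ∫⁻ θ, ‖batchError Γ (M k) i x (fun t => ξ k t θ) r‖ₑ ^ 2 ∂μ
      ≤ ENNReal.ofReal (M 0 * σ ^ 2 / M k) := by
    intro r
    set φ : (Fin N → Vec d) → ℝ := fun s =>
      (gradSample Γ i x (s i) - ∫ s, gradSample Γ i x (s i) ∂Γ.P) r with hφ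
    have hφm : Measurable φ := by
      have h2 : Measurable fun s : Fin N → Vec d => (x, s i) := by fun_prop
      have h3 := ((measurable_gradSample hΓ i).comp h2).sub_const
        (∫ s, gradSample Γ i x (s i) ∂Γ.P)
      have h4 : Measurable fun v : Vec (Γ.n i) => v r := by fun_prop
      have h5 := h4.comp h3
      exact h5
    have hφ0 : ∫ s, φ s ∂Γ.P = 0 := by
      have := hΓ.prob
      have h1 := integrable_gradSample hΓ i hx
      have h2 := (EuclideanSpace.proj r : Vec (Γ.n i) →L[ℝ] ℝ).integral_comp_comm
        (h1.sub (integrable_const (∫ s, gradSample Γ i x (s i) ∂Γ.P)))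
      have h3 : ∫ s, (gradSample Γ i x (s i) - ∫ s, gradSample Γ i x (s i) ∂Γ.P) ∂Γ.P = 0 := by
        rw [integral_sub h1 (integrable_const _), integral_const, probReal_univ, one_smul,
          sub_self]
      have h4 : ∫ s, φ s ∂Γ.P = (EuclideanSpace.proj r : Vec (Γ.n i) →L[ℝ] ℝ)
          (∫ s, (gradSample Γ i x (s i) - ∫ s, gradSample Γ i x (s i) ∂Γ.P) ∂Γ.P) := h2
      rw [h4, h3, map_zero]
    have hind : ∀ k, iIndepFun (ξ k) μ := fun k =>
      hξ.indep.precomp (g := fun t : ℕ => (k, t)) fun t t' h => (Prod.mk.inj h).2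
    have hle : ∫⁻ θ, ‖(M 0 : ℝ)⁻¹ * ∑ t ∈ Finset.range (M 0), φ (ξ 0 t θ)‖ₑ ^ 2 ∂μ
        ≤ ENNReal.ofReal (σ ^ 2) := by
      refine (lintegral_mono_ae ?_).trans (hvar 0 x hx)
      filter_upwards [ae_mem_Ξ hΓ hξ] with θ hθ
      have h1 : (M 0 : ℝ)⁻¹ * ∑ t ∈ Finset.range (M 0), φ (ξ 0 t θ)
          = ((WithLp.toLp 2 fun i => sampleOracle Γ M ξ θ 0 i x) - Γ.pseudograd x) i r := by
        rw [← batchError_apply (hM 0), batchError, integral_gradSample hΓ i hx]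
        have h2 : batchOracle Γ (M 0) (fun t => ξ 0 t θ) i x = sampleOracle Γ M ξ θ 0 i x := by
          simp only [batchOracle, sampleOracle]
          congr 1
          exact Finset.sum_congr rfl fun t _ => gradSample_eq hΓ hx (hθ 0 t i)
        rw [h2]; rfl
      rw [h1]
      gcongr
      exact (enorm_apply_le _ r).trans (enorm_apply_le _ i)
    have h := lintegral_sq_average_le (hξ.measurable 0) (hξ.law 0) (hind 0) (hξ.measurable k)
      (hξ.law k) (hind k) hφm hφ0 (hM 0) (hM k) hle
    simpa only [batchError_apply (hM k)] using h
  have hmeas : ∀ r, Measurable fun θ => ‖batchError Γ (M k) i x (fun t => ξ k t θ) r‖ₑ ^ 2 := by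
    intro r
    have h1 : Measurable fun θ (t : ℕ) => ξ k t θ := measurable_pi_lambda _ (hξ.measurable k)
    have h2 := measurable_batchError hΓ (M k) i (measurable_const (a := x)) h1
    have h4 : Measurable fun v : Vec (Γ.n i) => ‖v r‖ₑ ^ 2 := by fun_prop
    have h5 := h4.comp h2
    exact h5
  simp only [enorm_sq_eq_sum]
  rw [lintegral_finsetSum _ fun r _ => hmeas r]
  refine (Finset.sum_le_sum fun r _ => hcoord r).trans ?_
  rw [Finset.sum_const, Finset.card_univ, Fintype.card_fin, ← ENNReal.ofReal_nsmul, nsmul_eq_mul]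
  refine ENNReal.ofReal_le_ofReal ?_
  rw [mul_div_assoc']
  gcongr
  exact Finset.single_le_sum (f := fun i => (Γ.n i : ℝ) * (M 0 * σ ^ 2))
    (fun j _ => by positivity) (Finset.mem_univ i)

lemma integral_norm_sq_le_of_lintegral_le {E : Type*} [NormedAddCommGroup E] {f : Θ → E} {c : ℝ}
    (hc : 0 ≤ c) (h : ∫⁻ θ, ‖f θ‖ₑ ^ 2 ∂μ ≤ ENNReal.ofReal c) : ∫ θ, ‖f θ‖ ^ 2 ∂μ ≤ c := by
  by_cases hi : Integrable (fun θ => ‖f θ‖ ^ 2) μ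
  · rw [← ENNReal.ofReal_le_ofReal_iff hc,
      ofReal_integral_eq_lintegral_ofReal hi (Eventually.of_forall fun θ => sq_nonneg _)]
    refine le_trans (le_of_eq (lintegral_congr fun θ => ?_)) h
    rw [ENNReal.ofReal_pow (norm_nonneg _), ofReal_norm]
  -- A function that is not integrable has integral `0`.
  · rw [integral_undef hi]; exact hc

end Moments

/-! ### Almost sure convergence -/

section Convergence

variable {N m d : ℕ} {Γ : Game N m d} {w : Matrix (Fin N) (Fin N) ℝ} {p : Params N}
  {D : ∀ i, Set (Vec (Γ.n i))} {η ℓF : ℝ} {Θ : Type*} [MeasurableSpace Θ] {μ : Measure Θ}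
  {M : ℕ → ℕ} {ξ : ℕ → ℕ → Θ → Fin N → Vec d}

lemma IncreasingBatch.ne_zero (hM : IncreasingBatch M) (k : ℕ) : M k ≠ 0 := by
  obtain ⟨C, k₀, a, hC, hk₀, ha, h⟩ := hM
  have h1 : (0 : ℝ) < M k := lt_of_lt_of_le (by positivity) (h k)
  exact (Nat.cast_pos.1 h1).ne'

lemma IncreasingBatch.summable_inv (hM : IncreasingBatch M) :
    Summable fun k => ((M k : ℝ))⁻¹ := by
  obtain ⟨C, k₀, a, hC, hk₀, ha, h⟩ := hM
  have h1 : Summable fun k : ℕ => 1 / |(k : ℝ) + k₀| ^ (a + 1) :=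
    (Real.summable_one_div_nat_add_rpow k₀ (a + 1)).2 (by linarith)
  refine Summable.of_nonneg_of_le (fun k => by positivity) (fun k => ?_) (h1.mul_left C⁻¹)
  have h2 : (0 : ℝ) < k + k₀ := by positivity
  rw [abs_of_pos h2, one_div, ← mul_inv]
  exact inv_anti₀ (by positivity) (h k)

/-- A sequence of nonnegative random variables with summable expectations tends to zero. -/
lemma ae_tendsto_zero_of_sum_integral_le {f : ℕ → Θ → ℝ} (hf : ∀ k, Measurable (f k))
    (hi : ∀ k, Integrable (f k) μ) (hnn : ∀ k θ, 0 ≤ f k θ) {C : ℝ}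
    (hC : ∀ K, ∑ k ∈ Finset.range K, ∫ θ, f k θ ∂μ ≤ C) :
    ∀ᵐ θ ∂μ, Tendsto (fun k => f k θ) atTop (𝓝 0) := by
  have hsum : Summable fun k => ∫ θ, f k θ ∂μ :=
    summable_of_sum_range_le (fun k => integral_nonneg (hnn k)) hC
  have h1 : ∫⁻ θ, ∑' k, ENNReal.ofReal (f k θ) ∂μ ≠ ∞ := by
    rw [lintegral_tsum fun k => (hf k).ennreal_ofReal.aemeasurable]
    have h2 : ∀ k, ∫⁻ θ, ENNReal.ofReal (f k θ) ∂μ = ENNReal.ofReal (∫ θ, f k θ ∂μ) := fun k =>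
      (ofReal_integral_eq_lintegral_ofReal (hi k) (Eventually.of_forall (hnn k))).symm
    simp only [h2]
    exact hsum.tsum_ofReal_ne_top
  have h3 := ae_lt_top (Measurable.tsum fun k => (hf k).ennreal_ofReal) h1
  filter_upwards [h3] with θ hθ
  have h4 := ENNReal.tendsto_atTop_zero_of_tsum_ne_top hθ.ne
  have h5 := (ENNReal.tendsto_toReal ENNReal.zero_ne_top).comp h4
  simpa [Function.comp_def, ENNReal.toReal_ofReal (hnn _ θ)] using h5

lemma step_congr {S S' : Oracle Γ.n} {s : State Γ.n m}
    (h : ∀ i, S i (s.xhat i) = S' i (s.xhat i)) : step Γ w p S s = step Γ w p S' s := by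
  have h1 : ∀ i, nextDecision Γ w p S s.xhat s.lam i = nextDecision Γ w p S' s.xhat s.lam i :=
    fun i => by simp only [nextDecision, h]
  have h2 : nextEstimates Γ w p S s.xhat s.lam = nextEstimates Γ w p S' s.xhat s.lam := by
    simp only [nextEstimates, h1]
  simp only [step, h2]

/-- Two oracles need to agree only at the points that one of the trajectories visits, which is all
that `gradSample_eq` offers. -/
lemma iterate_congr {S S' : ℕ → Oracle Γ.n} {s₀ : State Γ.n m}
    (h : ∀ k i, S k i ((iterate Γ w p S' s₀ k).xhat i) = S' k i ((iterate Γ w p S' s₀ k).xhat i))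
    (k : ℕ) : iterate Γ w p S s₀ k = iterate Γ w p S' s₀ k := by
  induction k with
  | zero => rfl
  | succ k ih => rw [iterate, iterate, ih]; exact step_congr (h k)

/-- Second moment of the gradient error at the current state, and orthogonality of this error to
bounded functions of the initial and of the current state. -/
lemma gradError_moments [IsProbabilityMeasure μ] (hΓ : Γ.Assumptions D η ℓF)
    (hξ : IsIIDSampling Γ μ ξ) {k : ℕ} (hM : M k ≠ 0) {B : ℝ} (hB : 0 ≤ B) {i : Fin N}
    (hmom : ∀ x ∈ Γ.box D,
      ∫⁻ θ, ‖batchError Γ (M k) i x (fun t => ξ k t θ)‖ₑ ^ 2 ∂μ ≤ ENNReal.ofReal (B / M k))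
    {A : Type*} [MeasurableSpace A] {W : Θ → A} (hW : Measurable W)
    (hind : IndepFun W (fun θ t => ξ k t θ) μ) {x : A → Profile Γ.n} (hx : Measurable x)
    (hxD : ∀ θ, x (W θ) ∈ Γ.box D) {u : A → Vec (Γ.n i)} (hu : Measurable u) {C : ℝ}
    (huC : ∀ θ, ‖u (W θ)‖ ≤ C) :
    Integrable (fun θ => ‖batchError Γ (M k) i (x (W θ)) fun t => ξ k t θ‖ ^ 2) μ ∧
    ∫ θ, ‖batchError Γ (M k) i (x (W θ)) fun t => ξ k t θ‖ ^ 2 ∂μ ≤ B / M k ∧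
    Integrable (fun θ => inner ℝ (batchError Γ (M k) i (x (W θ)) fun t => ξ k t θ) (u (W θ))) μ ∧
    ∫ θ, inner ℝ (batchError Γ (M k) i (x (W θ)) fun t => ξ k t θ) (u (W θ)) ∂μ = 0 := by
  have hb : Measurable fun θ (t : ℕ) => ξ k t θ := measurable_pi_lambda _ (hξ.measurable k)
  have herr : Measurable fun q : A × (ℕ → Fin N → Vec d) =>
      batchError Γ (M k) i (x q.1) q.2 :=
    measurable_batchError hΓ (M k) i (hx.comp measurable_fst) measurable_snd
  have herrθ : Measurable fun θ => batchError Γ (M k) i (x (W θ)) fun t => ξ k t θ :=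
    measurable_batchError hΓ (M k) i (hx.comp hW) hb
  have hlint : ∫⁻ θ, ‖batchError Γ (M k) i (x (W θ)) fun t => ξ k t θ‖ₑ ^ 2 ∂μ
      ≤ ENNReal.ofReal (B / M k) := by
    have h1 : Measurable fun q : A × (ℕ → Fin N → Vec d) =>
        ‖batchError Γ (M k) i (x q.1) q.2‖ₑ ^ 2 := herr.enorm.pow_const 2
    have h2 := lintegral_indep hW hb hind h1
    rw [h2]
    refine (lintegral_mono fun θ => hmom (x (W θ)) (hxD θ)).trans ?_
    rw [lintegral_const, measure_univ, mul_one]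
  have hL2 : MemLp (fun θ => batchError Γ (M k) i (x (W θ)) fun t => ξ k t θ) 2 μ :=
    memLp_two_of_lintegral herrθ.aestronglyMeasurable (hlint.trans_lt ENNReal.ofReal_lt_top)
  have hint : Integrable
      (fun θ => inner ℝ (batchError Γ (M k) i (x (W θ)) fun t => ξ k t θ) (u (W θ))) μ := by
    refine Integrable.mono' ((hL2.integrable one_le_two).norm.mul_const C)
      (herrθ.inner (hu.comp hW)).aestronglyMeasurable (Eventually.of_forall fun θ => ?_)
    exact (norm_inner_le_norm _ _).trans (mul_le_mul_of_nonneg_left (huC θ) (norm_nonneg _))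
  refine ⟨hL2.integrable_norm_pow two_ne_zero,
    integral_norm_sq_le_of_lintegral_le (by positivity) hlint, hint, ?_⟩
  have h1 : Measurable fun q : A × (ℕ → Fin N → Vec d) =>
      (inner ℝ (batchError Γ (M k) i (x q.1) q.2) (u q.1) : ℝ) :=
    herr.inner (hu.comp measurable_fst)
  have h2 := integral_indep hW hb hind h1 hint
  rw [h2]
  -- With `W` frozen at `W θ`, the inner integral averages over the batch at a fixed point, where
  -- the error has mean zero.
  refine integral_eq_zero_of_ae (Eventually.of_forall fun θ => ?_)
  obtain ⟨h3, h4⟩ := integral_batchError hΓ hξ k hM i (hxD θ)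
  have h5 := integral_inner (𝕜 := ℝ) h3 (u (W θ))
  rw [h4, inner_zero_right] at h5
  rw [Pi.zero_apply, ← h5]
  exact integral_congr_ae (Eventually.of_forall fun θ' => real_inner_comm _ _)

/-- The convergence of the decisions for the measurable version of the sampled gradients. -/
lemma ae_tendsto_batch [IsProbabilityMeasure μ] (hΓ : Γ.Assumptions D η ℓF)
    (hα : ∀ i, 0 ≤ p.α i) (hM : IncreasingBatch M) (hξ : IsIIDSampling Γ μ ξ)
    (hvar : BoundedVariance Γ μ D M ξ) {s₀ : Θ → State Γ.n m} (hs₀ : IsInit Γ μ D ξ s₀)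
    {S : ℕ → Θ → Oracle Γ.n} (hS : S = fun k θ => batchOracle Γ (M k) fun t => ξ k t θ)
    (hmem : ∀ θ k, (∀ i l, (iterate Γ w p (fun k => S k θ) (s₀ θ) k).xhat i l ∈ D l) ∧
      ∀ i, (iterate Γ w p (fun k => S k θ) (s₀ θ) k).xhat i i ∈ Γ.Ω i)
    {x : Profile Γ.n} {ρ : ℝ} (hρ : 0 < ρ)
    {V : Estimates Γ.n × (Fin N → Vec m) × (Fin N → Vec m) → ℝ} (hV : Measurable V)
    (henergy : ∀ θ (K : ℕ),
      ρ * ∑ k ∈ Finset.range K,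
          ‖decisions (iterate Γ w p (fun k => S k θ) (s₀ θ) k).xhat - x‖ ^ 2
        ≤ V (s₀ θ).tuple + ∑ k ∈ Finset.range K, ∑ i,
          (‖gradError Γ (S k θ) (iterate Γ w p (fun k => S k θ) (s₀ θ) k).xhat i‖ ^ 2
          - 2 * inner ℝ (gradError Γ (S k θ) (iterate Γ w p (fun k => S k θ) (s₀ θ) k).xhat i)
            (decisions (iterate Γ w p (fun k => S k θ) (s₀ θ) k).xhat i - x i))) :
    ∀ᵐ θ ∂μ, Tendsto (fun k => decisions (iterate Γ w p (fun k => S k θ) (s₀ θ) k).xhat)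
      atTop (𝓝 x) := by
  obtain ⟨B, hB, hmom⟩ := exists_lintegral_batchError_le hΓ hξ hM.ne_zero hvar
  have hmeasind := fun k => measurable_indepFun_iterate (w := w) (p := p) (M := M) hΓ hα hξ hs₀ k
  set X : ℕ → Θ → Estimates Γ.n := fun k θ =>
    (iterate Γ w p (fun k => S k θ) (s₀ θ) k).xhat with hX
  -- Compactness of `Ω` bounds the decisions, so their products with the gradient errors are
  -- integrable.
  obtain ⟨C, hC⟩ : ∃ C, ∀ y ∈ Γ.box Γ.Ω, ‖y - x‖ ≤ C := by
    obtain ⟨C, hC⟩ := (Γ.isCompact_box hΓ.Ω_compact).isBounded.subset_closedBall x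
    exact ⟨C, fun y hy => by simpa [dist_eq_norm] using hC hy⟩
  have hXC : ∀ k θ, ‖decisions (X k θ) - x‖ ≤ C := fun k θ => hC _ (hmem θ k).2
  have hXmeas : ∀ k, Measurable (X k) := fun k => by
    have h := (hmeasind k).1.fst
    rw [hX, hS]; exact h
  have hdec : ∀ k, Measurable fun θ => decisions (X k θ) := fun k => by
    have h1 : Measurable (decisions : Estimates Γ.n → Profile Γ.n) :=
      measurable_piLp fun i =>
        (by fun_prop : Continuous fun Y : Estimates Γ.n => Y i i).measurable
    exact h1.comp (hXmeas k)
  have hm₀ : Measurable fun θ => (s₀ θ).tuple := hs₀.measurable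
  have hVm : Measurable fun θ => V (s₀ θ).tuple := hV.comp hm₀
  -- convergence on the set of initial states with bounded energy
  have hR : ∀ R : ℕ, ∀ᵐ θ ∂μ, V (s₀ θ).tuple ≤ R →
      Tendsto (fun k => ‖decisions (X k θ) - x‖ ^ 2) atTop (𝓝 0) := by
    intro R
    -- The initial energy may fail to be integrable, hence this truncation. As `χ` depends on the
    -- initial state only, which is jointly with the current state independent of batch `k`, it does
    -- not disturb the orthogonality.
    set χ : (Estimates Γ.n × (Fin N → Vec m) × (Fin N → Vec m)) → ℝ :=
      fun q => if V q ≤ R then 1 else 0 with hχ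
    have hχm : Measurable χ :=
      Measurable.ite (measurableSet_le hV measurable_const) measurable_const measurable_const
    have hχ0 : ∀ q, 0 ≤ χ q := fun q => by simp only [hχ]; split_ifs <;> norm_num
    have hχ1 : ∀ q, χ q ≤ 1 := fun q => by simp only [hχ]; split_ifs <;> norm_num
    have hmoments : ∀ k i,
        Integrable (fun θ => ‖gradError Γ (S k θ) (X k θ) i‖ ^ 2) μ ∧
        ∫ θ, ‖gradError Γ (S k θ) (X k θ) i‖ ^ 2 ∂μ ≤ B / M k ∧
        Integrable (fun θ => inner ℝ (gradError Γ (S k θ) (X k θ) i)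
          (χ (s₀ θ).tuple • (decisions (X k θ) i - x i))) μ ∧
        ∫ θ, inner ℝ (gradError Γ (S k θ) (X k θ) i)
          (χ (s₀ θ).tuple • (decisions (X k θ) i - x i)) ∂μ = 0 := by
      intro k i
      have hW : Measurable fun θ => ((s₀ θ).tuple, (iterate Γ w p
          (fun k => batchOracle Γ (M k) fun t => ξ k t θ) (s₀ θ) k).tuple) :=
        hm₀.prodMk (hmeasind k).1
      have hψ : Measurable fun f : ℕ → ℕ → Fin N → Vec d => f 0 := measurable_pi_apply 0
      have hind := (hmeasind k).2.comp measurable_id hψ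
      have hcomp : ∀ i, Measurable fun Y : Estimates Γ.n => Y i := fun i =>
        (by fun_prop : Continuous fun Y : Estimates Γ.n => Y i).measurable
      have hcomp' : Measurable fun Y : Estimates Γ.n => Y i i - x i :=
        (by fun_prop : Continuous fun Y : Estimates Γ.n => Y i i - x i).measurable
      have hres := gradError_moments (M := M) (k := k) hΓ hξ (hM.ne_zero k) hB (i := i)
        (hmom k i) hW hind
        (x := fun q => q.2.1 i) ((hcomp i).comp (measurable_fst.comp measurable_snd))
        (fun θ => by have h := (hmem θ k).1 i; rw [hS] at h; exact h)
        (u := fun q => χ q.1 • (q.2.1 i i - x i))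
        ((hχm.comp measurable_fst).smul (hcomp'.comp (measurable_fst.comp measurable_snd)))
        (C := C) (fun θ => by
          have h1 := (PiLp.norm_apply_le (decisions (X k θ) - x) i).trans (hXC k θ)
          simp only [hX, hS] at h1
          rw [norm_smul, Real.norm_of_nonneg (hχ0 _)]
          exact (mul_le_of_le_one_left (norm_nonneg _) (hχ1 _)).trans h1)
      have heq : ∀ θ, gradError Γ (S k θ) (X k θ) i = batchError Γ (M k) i (X k θ i)
          fun t => ξ k t θ := fun θ => by
        rw [hS]
        exact batchError_eq_gradError hΓ (M k) i (X k θ) ((hmem θ k).1 i) _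
      simp only [heq]
      simp only [hX, hS]
      exact hres
    have hfm : ∀ k, Measurable fun θ => χ (s₀ θ).tuple * ‖decisions (X k θ) - x‖ ^ 2 := fun k =>
      (hχm.comp hm₀).mul (((hdec k).sub_const x).norm.pow_const 2)
    have hfnn : ∀ k θ, 0 ≤ χ (s₀ θ).tuple * ‖decisions (X k θ) - x‖ ^ 2 := fun k θ =>
      mul_nonneg (hχ0 _) (sq_nonneg _)
    have hfi : ∀ k, Integrable (fun θ => χ (s₀ θ).tuple * ‖decisions (X k θ) - x‖ ^ 2) μ :=
      fun k => by
      refine Integrable.of_bound (hfm k).aestronglyMeasurable (C ^ 2)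
        (Eventually.of_forall fun θ => ?_)
      rw [Real.norm_of_nonneg (hfnn k θ)]
      exact (mul_le_of_le_one_left (sq_nonneg _) (hχ1 _)).trans
        (pow_le_pow_left₀ (norm_nonneg _) (hXC k θ) 2)
    have hbound : ∀ K, ∑ k ∈ Finset.range K,
        ∫ θ, χ (s₀ θ).tuple * ‖decisions (X k θ) - x‖ ^ 2 ∂μ
        ≤ (R + N * B * ∑' k, ((M k : ℝ))⁻¹) / ρ := by
      intro K
      rw [le_div_iff₀' hρ, ← integral_finsetSum _ fun k _ => hfi k, ← integral_const_mul]
      -- The squared errors are left without `χ`: off the event the left side is zero and the right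
      -- side is a sum of nonnegative terms.
      have hpt : ∀ θ, ρ * ∑ k ∈ Finset.range K, χ (s₀ θ).tuple * ‖decisions (X k θ) - x‖ ^ 2
          ≤ R + ∑ k ∈ Finset.range K, ∑ i, (‖gradError Γ (S k θ) (X k θ) i‖ ^ 2
            - 2 * inner ℝ (gradError Γ (S k θ) (X k θ) i)
              (χ (s₀ θ).tuple • (decisions (X k θ) i - x i))) := by
        intro θ
        by_cases hθ : V (s₀ θ).tuple ≤ R
        · have h1 : χ (s₀ θ).tuple = 1 := if_pos hθ
          simp only [h1, one_mul, one_smul]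
          have := henergy θ K
          linarith
        · have h1 : χ (s₀ θ).tuple = 0 := if_neg hθ
          simp only [h1, zero_mul, zero_smul, inner_zero_right, mul_zero, sub_zero,
            Finset.sum_const_zero]
          positivity
      have hi1 : ∀ k i, Integrable (fun θ => ‖gradError Γ (S k θ) (X k θ) i‖ ^ 2
            - 2 * inner ℝ (gradError Γ (S k θ) (X k θ) i)
              (χ (s₀ θ).tuple • (decisions (X k θ) i - x i))) μ := fun k i =>
        (hmoments k i).1.sub ((hmoments k i).2.2.1.const_mul 2)
      have hi2 : ∀ k, Integrable (fun θ => ∑ i, (‖gradError Γ (S k θ) (X k θ) i‖ ^ 2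
            - 2 * inner ℝ (gradError Γ (S k θ) (X k θ) i)
              (χ (s₀ θ).tuple • (decisions (X k θ) i - x i)))) μ := fun k =>
        integrable_finsetSum _ fun i _ => hi1 k i
      have hi3 := integrable_finsetSum (Finset.range K) fun k _ => hi2 k
      refine (integral_mono ((integrable_finsetSum _ fun k _ => hfi k).const_mul ρ)
        ((integrable_const (R : ℝ)).add hi3) hpt).trans ?_
      simp only [Pi.add_apply]
      rw [integral_add (integrable_const _) hi3, integral_const, probReal_univ, one_smul,
        integral_finsetSum _ fun k _ => hi2 k]
      gcongr
      have hk : ∀ k ∈ Finset.range K, ∫ θ, ∑ i, (‖gradError Γ (S k θ) (X k θ) i‖ ^ 2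
            - 2 * inner ℝ (gradError Γ (S k θ) (X k θ) i)
              (χ (s₀ θ).tuple • (decisions (X k θ) i - x i))) ∂μ ≤ N * B * ((M k : ℝ))⁻¹ := by
        intro k _
        rw [integral_finsetSum _ fun i _ => hi1 k i]
        have h1 : ∀ i ∈ Finset.univ, ∫ θ, (‖gradError Γ (S k θ) (X k θ) i‖ ^ 2
            - 2 * inner ℝ (gradError Γ (S k θ) (X k θ) i)
              (χ (s₀ θ).tuple • (decisions (X k θ) i - x i))) ∂μ ≤ B / M k := by
          intro i _
          obtain ⟨a1, a2, a3, a4⟩ := hmoments k i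
          rw [integral_sub a1 (a3.const_mul 2), integral_const_mul, a4, mul_zero, sub_zero]
          exact a2
        refine (Finset.sum_le_sum h1).trans_eq ?_
        rw [Finset.sum_const, Finset.card_univ, Fintype.card_fin, nsmul_eq_mul]
        ring
      refine (Finset.sum_le_sum hk).trans ?_
      rw [← Finset.mul_sum]
      gcongr
      exact hM.summable_inv.sum_le_tsum _ fun k _ => by positivity
    have h1 := ae_tendsto_zero_of_sum_integral_le hfm hfi hfnn hbound
    filter_upwards [h1] with θ hθ hle
    have h2 : χ (s₀ θ).tuple = 1 := if_pos hle
    simpa only [h2, one_mul] using hθ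
  rw [← ae_all_iff] at hR
  filter_upwards [hR] with θ hθ
  -- Countably many levels `R` exhaust the probability space.
  obtain ⟨R, hR⟩ := exists_nat_ge (V (s₀ θ).tuple)
  have h1 := hθ R hR
  rw [tendsto_iff_norm_sub_tendsto_zero]
  have h2 := h1.sqrt
  simpa only [Real.sqrt_sq (norm_nonneg _), Real.sqrt_zero] using h2

/-- The iterates for the sampled gradients agree almost surely with the ones for the measurable
version of the sampled gradients. -/
lemma ae_iterate_sampleOracle_eq (hΓ : Γ.Assumptions D η ℓF) (hξ : IsIIDSampling Γ μ ξ)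
    {s₀ : Θ → State Γ.n m}
    (hmem : ∀ θ k i l, (iterate Γ w p (fun k => batchOracle Γ (M k) fun t => ξ k t θ)
      (s₀ θ) k).xhat i l ∈ D l) :
    ∀ᵐ θ ∂μ, ∀ k, iterate Γ w p (sampleOracle Γ M ξ θ) (s₀ θ) k
      = iterate Γ w p (fun k => batchOracle Γ (M k) fun t => ξ k t θ) (s₀ θ) k := by
  filter_upwards [ae_mem_Ξ hΓ hξ] with θ hθ
  refine iterate_congr fun k i => ?_
  simp only [batchOracle, sampleOracle]
  congr 1
  exact Finset.sum_congr rfl fun t _ => (gradSample_eq hΓ (hmem θ k i) (hθ k t i)).symm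

end Convergence

end SGNE

end

/-! ### The main theorem. -/

theorem theorem2 {N m d : ℕ} (Γ : SGNE.Game N m d) (D : ∀ i, Set (SGNE.Vec (Γ.n i)))
    (G : SimpleGraph (Fin N)) (w : Matrix (Fin N) (Fin N) ℝ) (η ℓF ℓp c κ : ℝ)
    (hΓ : Γ.Assumptions D η ℓF)
    (hG : G.Connected) (hw : SGNE.IsWeighting G w)
    (hℓp : 0 < ℓp) (hFp : Γ.ExtLipschitz D ℓp)
    (hc : 0 < c) (hc' : SGNE.CouplingLarge w η ℓF ℓp c) (hκ : 0 < κ) :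
    (∀ (α : Fin N → ℝ) (ν : ℝ) (δ : Fin N → ℝ),
      SGNE.OneRound Γ w ⟨α, ν, δ, c, κ⟩ G ∧ SGNE.ChangeOfVariables Γ w ⟨α, ν, δ, c, κ⟩ G) ∧
    ∃ xstar : SGNE.Profile Γ.n,
      (Γ.IsVariational xstar ∧ ∀ y, Γ.IsVariational y → y = xstar) ∧
      ∃ αbar νbar δbar : ℝ, 0 < αbar ∧ 0 < νbar ∧ 0 < δbar ∧
        ∀ (α : Fin N → ℝ) (ν : ℝ) (δ : Fin N → ℝ),
          (∀ i, α i ∈ Set.Ioo 0 αbar) → ν ∈ Set.Ioo 0 νbar → (∀ i, δ i ∈ Set.Ioo 0 δbar) →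
          ∀ {Θ : Type*} [MeasurableSpace Θ] (μ : MeasureTheory.Measure Θ)
            [MeasureTheory.IsProbabilityMeasure μ] (M : ℕ → ℕ)
            (ξ : ℕ → ℕ → Θ → Fin N → SGNE.Vec d) (s₀ : Θ → SGNE.State Γ.n m),
            SGNE.IncreasingBatch M → SGNE.IsIIDSampling Γ μ ξ →
            SGNE.BoundedVariance Γ μ D M ξ → SGNE.IsInit Γ μ D ξ s₀ →
            ∀ᵐ θ ∂μ, Filter.Tendsto
              (fun k => SGNE.decisions (SGNE.iterate Γ w ⟨α, ν, δ, c, κ⟩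
                (SGNE.sampleOracle Γ M ξ θ) (s₀ θ) k).xhat)
              Filter.atTop (nhds xstar) := by
  refine ⟨fun α ν δ => ⟨SGNE.oneRound Γ _ hw, SGNE.changeOfVariables Γ _ hG hw⟩, ?_⟩
  obtain ⟨x, hx, hvi⟩ := hΓ.exists_variational
  refine ⟨x, ⟨⟨hΓ.isSGNE_of_variational hx hvi, hvi⟩,
    fun y hy => hΓ.variational_unique hx hy.1.1 (hvi y hy.1.1) (hy.2 x hx)⟩, ?_⟩
  obtain ⟨ρ, αbar, νbar, δbar, hρ, hαbar, hνbar, hδbar, hbound⟩ :=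
    SGNE.exists_energy_bound hΓ hG hw hℓp hFp hc hc' hκ hx hvi
  refine ⟨αbar, νbar, δbar, hαbar, hνbar, hδbar, fun α ν δ hα hν hδ Θ _ μ _ M ξ s₀ hM hξ hvar
    hs₀ => ?_⟩
  obtain ⟨hsmall, V, hV, henergy⟩ := hbound α ν δ hα hν hδ
  have hmem := fun θ k => SGNE.iterate_mem (p := ⟨α, ν, δ, c, κ⟩) hΓ hw (fun i => (hα i).1) hκ
    hsmall (fun k => SGNE.batchOracle Γ (M k) fun t => ξ k t θ) (hs₀.estimate_mem θ)
    (hs₀.decision_mem θ) k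
  -- Convergence is first obtained for the measurable oracle and then transferred to the sampled
  -- gradients, whose trajectories coincide with it almost surely.
  have hlim := SGNE.ae_tendsto_batch (p := ⟨α, ν, δ, c, κ⟩) hΓ (fun i => (hα i).1.le) hM hξ hvar hs₀
    rfl hmem hρ hV.measurable fun θ K => henergy _ (s₀ θ) (hs₀.estimate_mem θ)
      (hs₀.decision_mem θ) (hs₀.z_sum θ) K
  filter_upwards [hlim, SGNE.ae_iterate_sampleOracle_eq hΓ hξ fun θ k => (hmem θ k).1] with θ h₁ h₂
  simpa only [h₂] using h₁
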